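/- Let $d\ge 1$, $b,\mu_0\in\mathbb{R}^d$, and let $Q,\Sigma_0\in\mathbb{R}^{d\times d}$ be symmetric positive definite. Let $\rho^*$ be the density of $\mathcal N(b,Q)$, $V=-\log\rho^*$, and $K_1(x,y)=x^\top y+1$. Consider the mean-field SVGD equation $$\partial_t\rho_t(x)=\nabla\cdot\Bigl(\rho_t(x)\int_{\mathbb{R}^d} K_1(x,y)\bigl(\nabla\rho_t(y)+\rho_t(y)\nabla V(y)\bigr)\,dy\Bigr),\qquad t\ge 0,\tag{1}$$ with $\rho_0$ the density of $\mathcal N(\mu_0,\Sigma_0)$. A weak solution of (1) is a weakly continuous curve $(\rho_t)_{t\ge0}$ of probability measures on $\mathbb{R}^d$ with $\sup_{t\le T}\int|1+V|\,d\rho_t<\infty$ for all $T$ and $$\int_0^\infty\!\!\int\bigl(\partial_t\phi(t,x)+\nabla\phi(t,x)^\top U[\rho_t](x)\bigr)\rho_t(dx)\,dt+\int\phi(0,x)\,\rho_0(dx)=0\quad\text{for all }\phi\in C_c^\infty([0,\infty)\times\mathbb{R}^d),$$ where $U[\rho](x)=\int\bigl(\nabla_yK_1(x,y)-K_1(x,y)\nabla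 V(y)\bigr)\rho(dy)$. Then the following hold. 1. The system $$\dot\mu_t=(I-Q^{-1}\Sigma_t)\mu_t-(1+\mu_t^\top\mu_t)Q^{-1}(\mu_t-b),$$ $$\dot\Sigma_t=2\Sigma_t-\Sigma_t\bigl(\Sigma_t+\mu_t(\mu_t-b)^\top\bigr)Q^{-1}-Q^{-1}\bigl(\Sigma_t+(\mu_t-b)\mu_t^\top\bigr)\Sigma_t$$ with initial value $(\mu_0,\Sigma_0)$ has a unique solution on $[0,\infty)$, and $\Sigma_t$ is symmetric positive definite for all $t\ge0$. 2. The densities of $\mathcal N(\mu_t,\Sigma_t)$, $t\ge 0$, solve (1) in the classical sense, and the laws $\mathcal N(\mu_t,\Sigma_t)$ form a weak solution of (1). Every weak solution $(\rho_t)$ of (1) satisfies $\rho_t=\mathcal N(\mu_t,\Sigma_t)$ for all $t\ge0$. 3. $\rho_t$ converges weakly to $\mathcal N(b,Q)$ as $t\to\infty$, and for every $\epsilon>0$, as $t\to\infty$, $$\lVert\mu_t-b\rVert=\mathcal O\bigl(e^{-2(\gamma-\epsilon)t}\bigr),\qquad \lVert\Sigma_t-Q\rVert=\mathcal O\bigl(e^{-2(\gamma-\epsilon)t}\bigr)$$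 (Euclidean norm and spectral norm), where $\gamma$ is the smallest eigenvalue of $$\begin{bmatrix} I_{d^2} & \frac1{\sqrt2}\,b\otimes Q^{-1/2}\\ \frac1{\sqrt2}\,b^\top\otimes Q^{-1/2} & \frac12(1+b^\top b)\,Q^{-1}\end{bmatrix}.$$ Moreover $\gamma>\dfrac{1}{1+b^\top b+2\lambda}$, where $\lambda$ is the largest eigenvalue of $Q$. -/

import Mathlib

open MeasureTheory ProbabilityTheory Filter Topology Set Asymptotics
open scoped Matrix Kronecker ContDiff MatrixOrder Matrix.Norms.L2Operator

noncomputable section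

namespace SVGD

/-- Euclidean space `ℝ^d`. -/
abbrev Vec (d : ℕ) := EuclideanSpace ℝ (Fin d)

/-- Real `d × d` matrices. Their norm here is the spectral (`ℓ²` operator) norm. -/
abbrev Mat (d : ℕ) := Matrix (Fin d) (Fin d) ℝ

/-! ### Gaussians -/

/-- The density of `N(m, S)` for a positive definite `S`. -/
def gaussianDensity {d : ℕ} (m : Vec d) (S : Mat d) (x : Vec d) : ℝ :=
  (Real.sqrt ((2 * Real.pi) ^ d * S.det))⁻¹ *
    Real.exp (-(1 / 2) * ((x - m).ofLp ⬝ᵥ (S⁻¹ *ᵥ (x - m).ofLp)))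

/-- The law `N(m, S)`, as a point of the space of probability measures (which carries the topology
of weak convergence). -/
def gaussianLaw {d : ℕ} (m : Vec d) (S : Mat d) : ProbabilityMeasure (Vec d) :=
  ⟨multivariateGaussian m S, inferInstance⟩

/-- The potential `V = -log ρ*` of the target `N(b, Q)`. -/
def gaussianPotential {d : ℕ} (b : Vec d) (Q : Mat d) (x : Vec d) : ℝ :=
  -Real.log (gaussianDensity b Q x)

/-! ### The mean-field SVGD equation -/

/-- The bilinear kernel `K₁(x, y) = xᵀ y + 1`. -/
def bilinearKernel {d : ℕ} (x y : Vec d) : ℝ := inner ℝ x y + 1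

/-- The divergence of a vector field on `ℝ^d`. -/
def divergence {d : ℕ} (v : Vec d → Vec d) (x : Vec d) : ℝ :=
  ∑ i, (fderiv ℝ v x (EuclideanSpace.single i 1)) i

/-- The flux `ρ(x) ∫ K(x, y) (∇ρ(y) + ρ(y) ∇V(y)) dy`. -/
def flux {d : ℕ} (K : Vec d → Vec d → ℝ) (V : Vec d → ℝ) (ρ : Vec d → ℝ) (x : Vec d) : Vec d :=
  ρ x • ∫ y, K x y • (gradient ρ y + ρ y • gradient V y)

/-- `ρ` is a classical solution on `[0, ∞)`, with initial density `ρ₀`, of the mean-field SVGD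
equation `∂ₜ ρₜ(x) = ∇ · (ρₜ(x) ∫ K(x, y) (∇ρₜ(y) + ρₜ(y) ∇V(y)) dy)`, through smooth probability
densities. -/
structure IsClassicalSolution {d : ℕ} (K : Vec d → Vec d → ℝ) (V : Vec d → ℝ)
    (ρ₀ : Vec d → ℝ) (ρ : ℝ → Vec d → ℝ) : Prop where
  initial : ρ 0 = ρ₀
  smooth : ∀ t, 0 ≤ t → ContDiff ℝ ∞ (ρ t)
  nonneg : ∀ t, 0 ≤ t → ∀ x, 0 ≤ ρ t x
  integrable : ∀ t, 0 ≤ t → Integrable (ρ t)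
  integral_eq_one : ∀ t, 0 ≤ t → ∫ x, ρ t x = 1
  integrable_kernel : ∀ t, 0 ≤ t → ∀ x,
    Integrable (fun y => K x y • (gradient (ρ t) y + ρ t y • gradient V y))
  differentiable_flux : ∀ t, 0 ≤ t → Differentiable ℝ (flux K V (ρ t))
  pde : ∀ t, 0 ≤ t → ∀ x,
    HasDerivWithinAt (fun s => ρ s x) (divergence (flux K V (ρ t)) x) (Ici 0) t

/-- The velocity field of the SVGD equation at the measure `ρ`,
`U[ρ](x) = ∫ (∇_y K(x, y) - K(x, y) ∇V(y)) ρ(dy)`. If `ρ` has a density, it equals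
`-∫ K(x, y) (∇ρ(y) + ρ(y) ∇V(y)) dy` after an integration by parts, so that the equation reads
`∂ₜ ρₜ + ∇ · (ρₜ U[ρₜ]) = 0`. -/
def velocity {d : ℕ} (K : Vec d → Vec d → ℝ) (V : Vec d → ℝ) (ρ : Measure (Vec d))
    (x : Vec d) : Vec d :=
  ∫ y, (gradient (fun z => K x z) y - K x y • gradient V y) ∂ρ

/-- `ρ` is a weak (measure-valued) solution on `[0, ∞)` of the mean-field SVGD equation with initial
law `ν`: it is weakly continuous, `∫ (1 + V) dρₜ` is bounded on bounded time intervals (the absolute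
value takes care of the additive constant in `V`, which may make `V` negative somewhere), and
`∂ₜ ρₜ + ∇ · (ρₜ U[ρₜ]) = 0` holds against test functions in `C_c^∞([0, ∞) × ℝ^d)`. -/
structure IsWeakSolution {d : ℕ} (K : Vec d → Vec d → ℝ) (V : Vec d → ℝ)
    (ν : ProbabilityMeasure (Vec d)) (ρ : ℝ → ProbabilityMeasure (Vec d)) : Prop where
  continuousOn : ContinuousOn ρ (Ici 0)
  bounded : ∀ T : ℝ, ∃ C : NNReal, ∀ t ∈ Icc 0 T,
    ∫⁻ x, ‖1 + V x‖ₑ ∂(ρ t : Measure (Vec d)) ≤ C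
  weak : ∀ φ : ℝ × Vec d → ℝ, ContDiff ℝ ∞ φ → HasCompactSupport φ →
    (∫ t in Ioi (0 : ℝ), ∫ x,
        (deriv (fun s => φ (s, x)) t +
          inner ℝ (gradient (fun z => φ (t, z)) x) (velocity K V (ρ t : Measure (Vec d)) x))
        ∂(ρ t : Measure (Vec d))) +
      ∫ x, φ (0, x) ∂(ν : Measure (Vec d)) = 0

/-! ### The ODE system for the mean and the covariance -/

/-- `(I - Q⁻¹ S) m - (1 + mᵀ m) Q⁻¹ (m - b)`. -/
def meanField {d : ℕ} (b : Vec d) (Q : Mat d) (m : Vec d) (S : Mat d) : Vec d :=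
  WithLp.toLp 2 ((1 - Q⁻¹ * S) *ᵥ m.ofLp -
    (1 + m.ofLp ⬝ᵥ m.ofLp) • (Q⁻¹ *ᵥ (m - b).ofLp))

/-- `2 S - S (S + m (m - b)ᵀ) Q⁻¹ - Q⁻¹ (S + (m - b) mᵀ) S`. -/
def covField {d : ℕ} (b : Vec d) (Q : Mat d) (m : Vec d) (S : Mat d) : Mat d :=
  (2 : ℝ) • S - S * (S + Matrix.vecMulVec m.ofLp (m - b).ofLp) * Q⁻¹ -
    Q⁻¹ * (S + Matrix.vecMulVec (m - b).ofLp m.ofLp) * S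

/-- `(m, S)` solves the mean-covariance system on `[0, ∞)` with initial value `(m₀, S₀)`. -/
structure IsODESolution {d : ℕ} (b : Vec d) (Q : Mat d) (m₀ : Vec d) (S₀ : Mat d)
    (m : ℝ → Vec d) (S : ℝ → Mat d) : Prop where
  mean_zero : m 0 = m₀
  cov_zero : S 0 = S₀
  mean_deriv : ∀ t, 0 ≤ t → HasDerivWithinAt m (meanField b Q (m t) (S t)) (Ici 0) t
  cov_deriv : ∀ t, 0 ≤ t → HasDerivWithinAt S (covField b Q (m t) (S t)) (Ici 0) t

/-! ### The matrix that governs the rate -/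

/-- `b ⊗ Q^{-1/2}`, a `d² × d` matrix; the rows are indexed by pairs and the trivial column index of
the column vector `b` is dropped. -/
def kronBlock {d : ℕ} (b : Vec d) (Q : Mat d) : Matrix (Fin d × Fin d) (Fin d) ℝ :=
  (Matrix.replicateCol Unit b.ofLp ⊗ₖ CFC.sqrt Q⁻¹).submatrix id (fun j => ((), j))

/-- `bᵀ ⊗ Q^{-1/2}`, a `d × d²` matrix. -/
def kronBlockRow {d : ℕ} (b : Vec d) (Q : Mat d) : Matrix (Fin d) (Fin d × Fin d) ℝ :=
  (Matrix.replicateRow Unit b.ofLp ⊗ₖ CFC.sqrt Q⁻¹).submatrix (fun i => ((), i)) id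

/-- The block matrix with blocks `I_{d²}`, `(1/√2) b ⊗ Q^{-1/2}`, `(1/√2) bᵀ ⊗ Q^{-1/2}` and
`(1/2) (1 + bᵀ b) Q⁻¹`. -/
def rateMatrix {d : ℕ} (b : Vec d) (Q : Mat d) :
    Matrix ((Fin d × Fin d) ⊕ Fin d) ((Fin d × Fin d) ⊕ Fin d) ℝ :=
  Matrix.fromBlocks 1 ((1 / Real.sqrt 2) • kronBlock b Q)
    ((1 / Real.sqrt 2) • kronBlockRow b Q) ((1 / 2 * (1 + b.ofLp ⬝ᵥ b.ofLp)) • Q⁻¹)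

end SVGD

end

/-!
The kernel is bilinear, so the velocity field that it assigns to a probability measure is affine in
space, `x ↦ A x + c`, and `A` and `c` are determined by the mean `m` and the covariance `S` of the
measure: `A = I - Q⁻¹ (S + (m - b) mᵀ)` and `c = -Q⁻¹ (m - b)` (`velocity_eq`). Everything therefore
takes place along invertible affine maps `z ↦ m t + E t z` with `m' = A m + c` and `E' = A E`
(`IsAffineFlow`): they transport the standard Gaussian to `N(m, E Eᵀ)`, and `(m, E Eᵀ)` solves the
mean-covariance system. Positivity of the covariance is thus the invertibility of `E`, which linear
equations preserve.

*Global existence and convergence.* The relative entropy of `N(m, S)` with respect to the target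
decreases along the system, with dissipation `‖A‖² + |c|²` (`hasDerivWithinAt_energy`). Its sublevel
sets are bounded (`exists_energy_lower`), which prevents blow-up (`exists_isAffineFlow`), and on each
of them it is at most a multiple of its dissipation (`exists_energy_le_dissipation`), so that it
tends to `0`.

*The rate.* Put `X = Q⁻¹ S - I` and `u = m - b`. To second order, twice the relative entropy is
`tr(X²) / 2 + uᵀ Q⁻¹ u ≤ ‖X‖² / 2 + uᵀ Q⁻¹ u`, while the dissipation is
`‖X + Q⁻¹ u bᵀ‖² + ‖Q⁻¹ u‖²`. The latter is the quadratic form of the rate matrix at the vector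
`(X, √2 Q^{-1/2} u)`, whose squared length is `‖X‖² + 2 uᵀ Q⁻¹ u`; so near the target the dissipation
is almost `4 γ` times the relative entropy (`exists_rate`, `exists_energy_le_dissipation_near`). The
entropy then decays at the rate `4 (γ - ε)`, and the parameters, in which it is quadratic, at the
rate `2 (γ - ε)` (`IsAffineFlow.isBigO`). The lower bound for `γ` comes from an explicit estimate of
the same form (`rateMatrix_form_gt`).

*The Gaussian curve is a solution.* Classically, by differentiating the density in time and using that
the flux of a Gaussian density is the density times its affine velocity field
(`IsAffineFlow.isClassicalSolution`); weakly, by differentiating a test function along the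
trajectories `t ↦ m t + E t z` and integrating over `z` (`IsAffineFlow.weak_eq`).

*Uniqueness.* For a weak solution the integrability of the potential bounds the second moments, so
that the weak formulation extends to test functions of quadratic growth
(`IsWeakSolution.integral_eq`). With coordinates and their products as test functions, the mean and
the covariance solve the mean-covariance system (`IsWeakSolution.isODESolution`), so they are those
of the Gaussian curve. The velocity field is then a known affine field, the equation has become
linear, and functions of `⟪β t, x - m t⟫` with `β t = (E tᵀ)⁻¹ w` are constant along its trajectories
and have conserved integrals (`IsWeakSolution.integral_transport`). Taking sines and cosines
determines the characteristic function (`IsWeakSolution.eq_of_moments`).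
-/

noncomputable section

namespace SVGD

/-! ### Calculus of matrix-valued functions -/

section MatrixCalculus

variable {d : ℕ}

/-- Matrices, with the spectral norm, as a product of copies of `ℝ`. -/
def matEquivPi (d : ℕ) : Mat d ≃L[ℝ] (Fin d → Fin d → ℝ) :=
  (Matrix.ofLinearEquiv ℝ).symm.toContinuousLinearEquiv

lemma contDiff_mat_iff {E : Type*} [NormedAddCommGroup E] [NormedSpace ℝ E] {n : WithTop ℕ∞}
    {f : E → Mat d} : ContDiff ℝ n f ↔ ∀ i j, ContDiff ℝ n (fun x => f x i j) := by
  rw [← (matEquivPi d).comp_contDiff_iff, contDiff_pi]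
  exact forall_congr' fun i => contDiff_pi

lemma hasDerivWithinAt_mat_iff {f : ℝ → Mat d} {f' : Mat d} {s : Set ℝ} {x : ℝ} :
    HasDerivWithinAt f f' s x ↔ ∀ i j, HasDerivWithinAt (fun t => f t i j) (f' i j) s x := by
  have h1 : HasDerivWithinAt f f' s x ↔
      HasDerivWithinAt (fun t => matEquivPi d (f t)) (matEquivPi d f') s x := by
    constructor
    · intro h
      exact ((matEquivPi d).toContinuousLinearMap.hasFDerivAt).comp_hasDerivWithinAt x h
    · intro h
      have := ((matEquivPi d).symm.toContinuousLinearMap.hasFDerivAt).comp_hasDerivWithinAt x h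
      simpa [Function.comp_def] using this
  rw [h1, hasDerivWithinAt_pi]
  exact forall_congr' fun i => hasDerivWithinAt_pi

lemma hasDerivWithinAt_vec_iff {f : ℝ → Vec d} {f' : Vec d} {s : Set ℝ} {x : ℝ} :
    HasDerivWithinAt f f' s x ↔ ∀ i, HasDerivWithinAt (fun t => f t i) (f' i) s x := by
  rw [hasDerivWithinAt_iff_hasFDerivWithinAt, hasFDerivWithinAt_euclidean]
  exact forall_congr' fun i => by
    rw [hasDerivWithinAt_iff_hasFDerivWithinAt]
    congr!

lemma continuous_mat_apply (i j : Fin d) : Continuous (fun M : Mat d => M i j) :=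
  (continuous_apply j).comp ((continuous_apply i).comp (matEquivPi d).continuous)

lemma contDiff_mat_apply {n : WithTop ℕ∞} (i j : Fin d) :
    ContDiff ℝ n (fun M : Mat d => M i j) :=
  contDiff_mat_iff.1 contDiff_id i j

lemma contDiff_transpose {n : WithTop ℕ∞} : ContDiff ℝ n (fun M : Mat d => Mᵀ) :=
  contDiff_mat_iff.2 fun i j => contDiff_mat_apply j i

lemma contDiff_det {n : WithTop ℕ∞} : ContDiff ℝ n (fun M : Mat d => M.det) := by
  simp only [Matrix.det_apply']
  refine ContDiff.sum fun σ _ => ?_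
  exact contDiff_const.mul (contDiff_prod fun i _ => contDiff_mat_apply _ _)

lemma contDiff_mulVec {E : Type*} [NormedAddCommGroup E] [NormedSpace ℝ E]
    {n : WithTop ℕ∞} {f : E → Mat d} {g : E → Vec d} (hf : ContDiff ℝ n f) (hg : ContDiff ℝ n g) :
    ContDiff ℝ n (fun x => (WithLp.toLp 2 (f x *ᵥ (g x).ofLp) : Vec d)) := by
  rw [contDiff_euclidean] at hg ⊢
  intro i
  simp only [Matrix.mulVec, dotProduct]
  exact ContDiff.sum fun j _ => (contDiff_mat_iff.1 hf i j).mul (hg j)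

lemma contDiff_vecMulVec {E : Type*} [NormedAddCommGroup E] [NormedSpace ℝ E]
    {n : WithTop ℕ∞} {f : E → Vec d} {g : E → Vec d} (hf : ContDiff ℝ n f) (hg : ContDiff ℝ n g) :
    ContDiff ℝ n (fun x => (Matrix.vecMulVec (f x).ofLp (g x).ofLp : Mat d)) := by
  rw [contDiff_euclidean] at hf hg
  rw [contDiff_mat_iff]
  intro i j
  simp only [Matrix.vecMulVec_apply]
  exact (hf i).mul (hg j)

/-- Smoothness of the matrix inverse at invertible matrices, along a smooth curve. -/
lemma contDiff_matrix_inv {E : Type*} [NormedAddCommGroup E] [NormedSpace ℝ E]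
    {n : WithTop ℕ∞} {f : E → Mat d} (hf : ContDiff ℝ n f) (h : ∀ x, (f x).det ≠ 0) :
    ContDiff ℝ n (fun x => (f x)⁻¹) := by
  simp only [Matrix.inv_def, Ring.inverse_eq_inv']
  refine ((contDiff_det.comp hf).inv h).smul ?_
  rw [contDiff_mat_iff]
  intro i j
  simp only [Matrix.adjugate_apply]
  refine contDiff_det.comp ?_
  rw [contDiff_mat_iff]
  intro k l
  by_cases hk : k = j
  · subst hk; simp only [Matrix.updateRow_self]; exact contDiff_const
  · simp only [Matrix.updateRow_ne hk]; exact contDiff_mat_iff.1 hf k l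

/-- **Jacobi's formula** for the derivative of a determinant, at an invertible matrix. -/
lemma hasDerivWithinAt_det {f : ℝ → Mat d} {f' : Mat d} {s : Set ℝ} {x : ℝ}
    (hf : HasDerivWithinAt f f' s x) (h0 : (f x).det ≠ 0) :
    HasDerivWithinAt (fun t => (f t).det) ((f x).det * ((f x)⁻¹ * f').trace) s x := by
  have hd : HasFDerivAt (fun M : Mat d => M.det) (fderiv ℝ (fun M : Mat d => M.det) (f x)) (f x) :=
    ((contDiff_det (n := 1)).differentiable one_ne_zero (f x)).hasFDerivAt
  have h1 := hd.comp_hasDerivWithinAt x hf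
  have h2 : HasDerivAt (fun t : ℝ => (f x + t • f').det)
      (fderiv ℝ (fun M : Mat d => M.det) (f x) f') 0 := by
    have hc : HasDerivAt (fun t : ℝ => f x + t • f') f' 0 := by
      simpa using ((hasDerivAt_id (0:ℝ)).smul_const f').const_add (f x)
    have hd' : HasFDerivAt (fun M : Mat d => M.det) (fderiv ℝ (fun M : Mat d => M.det) (f x))
      (f x + (0:ℝ) • f') := by simpa using hd
    exact hd'.comp_hasDerivAt 0 hc
  have h3 : HasDerivAt (fun t : ℝ => (f x + t • f').det)
      ((f x).det * ((f x)⁻¹ * f').trace) 0 := by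
    have hu : IsUnit (f x).det := isUnit_iff_ne_zero.2 h0
    have he : (fun t : ℝ => (f x + t • f').det) = fun t : ℝ =>
        (f x).det * (1 + ((f x)⁻¹ * f').trace * t +
          (Matrix.det (1 + (Polynomial.X : Polynomial ℝ) •
            ((f x)⁻¹ * f').map Polynomial.C)).divX.divX.eval t * t ^ 2) := by
      funext t
      rw [← Matrix.det_one_add_smul, ← Matrix.det_mul, mul_add, mul_one, Matrix.mul_smul,
        ← Matrix.mul_assoc, Matrix.mul_nonsing_inv _ hu, one_mul]
    rw [he]
    have hp := (Polynomial.hasDerivAt (Matrix.det (1 + (Polynomial.X : Polynomial ℝ) •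
            ((f x)⁻¹ * f').map Polynomial.C)).divX.divX 0).mul ((hasDerivAt_id (0:ℝ)).pow 2)
    have := ((((hasDerivAt_id (0:ℝ)).const_mul ((f x)⁻¹ * f').trace).const_add 1).add
      hp).const_mul (f x).det
    simpa using this
  rwa [h2.unique h3] at h1

lemma hasDerivWithinAt_transpose {f : ℝ → Mat d} {f' : Mat d} {s : Set ℝ} {x : ℝ}
    (hf : HasDerivWithinAt f f' s x) : HasDerivWithinAt (fun t => (f t)ᵀ) f'ᵀ s x :=
  hasDerivWithinAt_mat_iff.2 fun i j => hasDerivWithinAt_mat_iff.1 hf j i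

lemma hasDerivWithinAt_trace {f : ℝ → Mat d} {f' : Mat d} {s : Set ℝ} {x : ℝ}
    (hf : HasDerivWithinAt f f' s x) : HasDerivWithinAt (fun t => (f t).trace) f'.trace s x := by
  simp only [Matrix.trace, Matrix.diag]
  exact HasDerivWithinAt.fun_sum fun i _ => hasDerivWithinAt_mat_iff.1 hf i i

lemma hasDerivWithinAt_mulVec {f : ℝ → Mat d} {f' : Mat d} {g : ℝ → Vec d} {g' : Vec d}
    {s : Set ℝ} {x : ℝ} (hf : HasDerivWithinAt f f' s x) (hg : HasDerivWithinAt g g' s x) :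
    HasDerivWithinAt (fun t => (WithLp.toLp 2 (f t *ᵥ (g t).ofLp) : Vec d))
      (WithLp.toLp 2 (f' *ᵥ (g x).ofLp + f x *ᵥ g'.ofLp)) s x := by
  rw [hasDerivWithinAt_vec_iff] at hg ⊢
  intro i
  simp only [Matrix.mulVec, dotProduct, Pi.add_apply, ← Finset.sum_add_distrib]
  exact HasDerivWithinAt.fun_sum fun j _ => (hasDerivWithinAt_mat_iff.1 hf i j).mul (hg j)

lemma hasDerivWithinAt_dotProduct {f g : ℝ → Vec d} {f' g' : Vec d}
    {s : Set ℝ} {x : ℝ} (hf : HasDerivWithinAt f f' s x) (hg : HasDerivWithinAt g g' s x) :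
    HasDerivWithinAt (fun t => (f t).ofLp ⬝ᵥ (g t).ofLp)
      (f'.ofLp ⬝ᵥ (g x).ofLp + (f x).ofLp ⬝ᵥ g'.ofLp) s x := by
  rw [hasDerivWithinAt_vec_iff] at hf hg
  simp only [dotProduct, ← Finset.sum_add_distrib]
  exact HasDerivWithinAt.fun_sum fun j _ => (hf j).mul (hg j)

end MatrixCalculus

/-! ### Global solutions of autonomous equations -/

section ODE

variable {E : Type*} [NormedAddCommGroup E] [NormedSpace ℝ E]

/-- A bounded Lipschitz vector field has a solution for all (positive and negative) times. -/
lemma exists_global_solution [CompleteSpace E] {F : E → E} {K L : NNReal} (hK : LipschitzWith K F)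
    (hL : ∀ x, ‖F x‖ ≤ L) (x₀ : E) :
    ∃ x : ℝ → E, x 0 = x₀ ∧ ∀ t, HasDerivAt x (F (x t)) t := by
  have loc : ∀ n : ℕ, ∃ x : ℝ → E, x 0 = x₀ ∧
      ∀ t ∈ Icc (-(n + 1 : ℝ)) (n + 1), HasDerivWithinAt x (F (x t)) (Icc (-(n + 1 : ℝ)) (n + 1)) t := by
    intro n
    have h0 : (0:ℝ) ∈ Icc (-(n + 1 : ℝ)) (n + 1) := ⟨by linarith [n.cast_nonneg (α := ℝ)], by positivity⟩
    have hpl : IsPicardLindelof (fun _ : ℝ => F) (⟨0, h0⟩ : Icc (-(n + 1 : ℝ)) (n + 1)) x₀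
        (L * (n + 1)) 0 L K :=
      IsPicardLindelof.of_time_independent (fun x _ => hL x) (hK.lipschitzOnWith)
        (by simp)
    exact hpl.exists_eq_forall_mem_Icc_hasDerivWithinAt₀
  choose x hx0 hx using loc
  have hx' : ∀ n : ℕ, ∀ t ∈ Ioo (-(n + 1 : ℝ)) (n + 1), HasDerivAt (x n) (F (x n t)) t :=
    fun n t ht => (hx n t (Ioo_subset_Icc_self ht)).hasDerivAt (Icc_mem_nhds ht.1 ht.2)
  have agree : ∀ n k : ℕ, n ≤ k → EqOn (x n) (x k) (Ioo (-(n + 1 : ℝ)) (n + 1)) := by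
    intro n k hnk
    have hnk' : (n : ℝ) ≤ k := by exact_mod_cast hnk
    refine ODE_solution_unique_of_mem_Ioo (v := fun _ => F) (s := fun _ => univ) (K := K) (t₀ := 0)
      (fun t _ => hK.lipschitzOnWith) ⟨by linarith [n.cast_nonneg (α := ℝ)], by positivity⟩
      (fun t ht => ⟨hx' n t ht, trivial⟩)
      (fun t ht => ⟨hx' k t ⟨by linarith [ht.1], by linarith [ht.2]⟩, trivial⟩) ?_
    rw [hx0, hx0]
  refine ⟨fun t => x ⌈|t|⌉₊ t, hx0 _, fun t => ?_⟩
  obtain ⟨n, hn⟩ : ∃ n : ℕ, n = ⌈|t|⌉₊ + 1 := ⟨_, rfl⟩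
  have htn : |t| < (n : ℝ) := by
    have := Nat.le_ceil |t|
    rw [hn]; push_cast; linarith
  have hmem : t ∈ Ioo (-(n : ℝ)) n := abs_lt.1 htn
  have hev : (fun s => x ⌈|s|⌉₊ s) =ᶠ[𝓝 t] x n := by
    filter_upwards [Ioo_mem_nhds hmem.1 hmem.2] with s hs
    have hs' : |s| < n := abs_lt.2 hs
    refine agree _ _ (Nat.ceil_le.2 hs'.le) ?_
    have := Nat.le_ceil |s|
    exact abs_lt.1 (by linarith)
  have := hx' n t ⟨by linarith [hmem.1], by linarith [hmem.2]⟩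
  have h2 := this.congr_of_eventuallyEq hev
  rwa [← hev.self_of_nhds] at h2

/-- Solutions of `x' = F(x)` with a smooth field `F` are smooth. -/
lemma contDiff_of_hasDerivAt {F : E → E} (hF : ContDiff ℝ ∞ F) {x : ℝ → E}
    (hx : ∀ t, HasDerivAt x (F (x t)) t) : ContDiff ℝ ∞ x := by
  rw [contDiff_infty]
  intro n
  have hd : deriv x = fun t => F (x t) := funext fun t => (hx t).deriv
  induction n with
  | zero =>
    rw [Nat.cast_zero, contDiff_zero]
    exact continuous_iff_continuousAt.2 fun t => (hx t).continuousAt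
  | succ n ih =>
    rw [Nat.cast_succ, contDiff_succ_iff_deriv]
    refine ⟨fun t => (hx t).differentiableAt, by simp, ?_⟩
    rw [hd]
    exact (hF.of_le (by exact_mod_cast le_top)).comp ih

/-- Solutions on `[0, ∞)` of `x' = F(x)` with a `C¹` field `F` on a finite-dimensional space are
determined by their initial value. -/
lemma eq_of_hasDerivWithinAt [FiniteDimensional ℝ E] {F : E → E} (hF : ContDiff ℝ 1 F)
    {x y : ℝ → E} (hx : ∀ t, 0 ≤ t → HasDerivWithinAt x (F (x t)) (Ici 0) t)
    (hy : ∀ t, 0 ≤ t → HasDerivWithinAt y (F (y t)) (Ici 0) t) (h0 : x 0 = y 0) :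
    ∀ t, 0 ≤ t → x t = y t := by
  intro T hT
  have hxc : ContinuousOn x (Icc 0 T) := fun t ht =>
    (hx t ht.1).continuousWithinAt.mono Icc_subset_Ici_self
  have hyc : ContinuousOn y (Icc 0 T) := fun t ht =>
    (hy t ht.1).continuousWithinAt.mono Icc_subset_Ici_self
  have hcomp : IsCompact (x '' Icc 0 T ∪ y '' Icc 0 T) :=
    (isCompact_Icc.image_of_continuousOn hxc).union (isCompact_Icc.image_of_continuousOn hyc)
  obtain ⟨K, hK⟩ := hF.locallyLipschitz.locallyLipschitzOn.exists_lipschitzOnWith_of_compact hcomp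
  refine ODE_solution_unique_of_mem_Icc_right (v := fun _ => F)
    (s := fun _ => x '' Icc 0 T ∪ y '' Icc 0 T) (K := K) (fun _ _ => hK) hxc ?_ ?_ hyc ?_ ?_ h0
    ⟨hT, le_rfl⟩
  · exact fun t ht => (hx t ht.1).mono (Ici_subset_Ici.2 ht.1)
  · exact fun t ht => Or.inl ⟨t, ⟨ht.1, ht.2.le⟩, rfl⟩
  · exact fun t ht => (hy t ht.1).mono (Ici_subset_Ici.2 ht.1)
  · exact fun t ht => Or.inr ⟨t, ⟨ht.1, ht.2.le⟩, rfl⟩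

end ODE

/-! ### The velocity field at a Gaussian and the relative entropy -/

section Energy

variable {d : ℕ}

/-- The linear part `A = I - Q⁻¹ (S + (m - b) mᵀ)` of the velocity field `x ↦ A x + c` at a measure
with mean `m` and covariance `S`. -/
def driftMat (b : Vec d) (Q : Mat d) (m : Vec d) (S : Mat d) : Mat d :=
  1 - Q⁻¹ * (S + Matrix.vecMulVec (m - b).ofLp m.ofLp)

/-- The constant part `c = -Q⁻¹ (m - b)` of the velocity field at a measure with mean `m`. -/
def driftVec (b : Vec d) (Q : Mat d) (m : Vec d) : Vec d :=
  WithLp.toLp 2 (-(Q⁻¹ *ᵥ (m - b).ofLp))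

lemma meanField_eq (b : Vec d) (Q : Mat d) (m : Vec d) (S : Mat d) :
    meanField b Q m S = WithLp.toLp 2 (driftMat b Q m S *ᵥ m.ofLp) + driftVec b Q m := by
  rw [meanField, driftMat, driftVec, ← WithLp.toLp_add]
  congr 1
  rw [Matrix.sub_mulVec, Matrix.sub_mulVec, Matrix.mul_add, Matrix.add_mulVec,
    ← Matrix.mulVec_mulVec m.ofLp Q⁻¹ (Matrix.vecMulVec _ _), Matrix.vecMulVec_mulVec]
  rw [show MulOpposite.op (m.ofLp ⬝ᵥ m.ofLp) • (m - b).ofLp = (m.ofLp ⬝ᵥ m.ofLp) • (m - b).ofLp from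
    op_smul_eq_smul _ _, Matrix.mulVec_smul, add_smul, one_smul]
  abel

lemma transpose_of_posDef {Q : Mat d} (hQ : Q.PosDef) : Qᵀ = Q := by
  simpa [Matrix.IsHermitian] using hQ.isHermitian.eq

lemma transpose_inv_of_posDef {Q : Mat d} (hQ : Q.PosDef) : (Q⁻¹)ᵀ = Q⁻¹ :=
  transpose_of_posDef hQ.inv

lemma covField_eq (b : Vec d) {Q : Mat d} (hQ : Q.PosDef) (m : Vec d) {S : Mat d} (hS : Sᵀ = S) :
    covField b Q m S = driftMat b Q m S * S + S * (driftMat b Q m S)ᵀ := by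
  have hQt := transpose_inv_of_posDef hQ
  rw [covField, driftMat, Matrix.transpose_sub, Matrix.transpose_mul, hQt, Matrix.transpose_add, hS,
    Matrix.transpose_vecMulVec, Matrix.transpose_one, two_smul]
  simp only [Matrix.mul_add, Matrix.add_mul, Matrix.sub_mul, Matrix.mul_sub, Matrix.mul_assoc,
    Matrix.one_mul, Matrix.mul_one]
  abel

/-- Twice the relative entropy of `N(m, S)` with respect to `N(b, Q)`. -/
def energy (b : Vec d) (Q : Mat d) (m : Vec d) (S : Mat d) : ℝ :=
  (Q⁻¹ * S).trace - d - Real.log (Q⁻¹ * S).det + (m - b).ofLp ⬝ᵥ (Q⁻¹ *ᵥ (m - b).ofLp)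

/-- The dissipation `‖A‖² + |c|²` (with the Frobenius norm) of the relative entropy. -/
def dissipation (b : Vec d) (Q : Mat d) (m : Vec d) (S : Mat d) : ℝ :=
  ((driftMat b Q m S)ᵀ * driftMat b Q m S).trace + (driftVec b Q m).ofLp ⬝ᵥ (driftVec b Q m).ofLp

/-- Along the mean-covariance system, sped up by a factor `κ`, the relative entropy decreases at
the rate given by the dissipation. -/
lemma hasDerivWithinAt_energy (b : Vec d) {Q : Mat d} (hQ : Q.PosDef) {m : ℝ → Vec d} {S : ℝ → Mat d}
    {t κ : ℝ} {s : Set ℝ} (hSt : (S t)ᵀ = S t) (hdet : (S t).det ≠ 0)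
    (hm : HasDerivWithinAt m (κ • (WithLp.toLp 2 (driftMat b Q (m t) (S t) *ᵥ (m t).ofLp) +
      driftVec b Q (m t))) s t)
    (hS : HasDerivWithinAt S (κ • (driftMat b Q (m t) (S t) * S t +
      S t * (driftMat b Q (m t) (S t))ᵀ)) s t) :
    HasDerivWithinAt (fun r => energy b Q (m r) (S r))
      (-(2 * κ * dissipation b Q (m t) (S t))) s t := by
  have hQt := transpose_inv_of_posDef hQ
  have hQd : (Q⁻¹).det ≠ 0 := (Matrix.isUnit_nonsing_inv_det _ hQ.det_pos.ne'.isUnit).ne_zero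
  have hSd : IsUnit (S t).det := isUnit_iff_ne_zero.2 hdet
  set A := driftMat b Q (m t) (S t) with hA
  set c := driftVec b Q (m t) with hc
  have h1 : HasDerivWithinAt (fun r => Q⁻¹ * S r) (Q⁻¹ * (κ • (A * S t + S t * Aᵀ))) s t :=
    hS.const_mul Q⁻¹
  have hd0 : (Q⁻¹ * S t).det ≠ 0 := by rw [Matrix.det_mul]; exact mul_ne_zero hQd hdet
  have h2 := (hasDerivWithinAt_det h1 hd0).log hd0
  have h3 : HasDerivWithinAt (fun r => m r - b) _ s t := hm.sub_const b
  have h4 := hasDerivWithinAt_dotProduct h3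
    (hasDerivWithinAt_mulVec (hasDerivWithinAt_const t s Q⁻¹) h3)
  have h5 := (((hasDerivWithinAt_trace h1).sub_const (d : ℝ)).sub h2).add h4
  refine h5.congr_deriv ?_
  have e1 : (Q⁻¹ * (κ • (A * S t + S t * Aᵀ))).trace = 2 * κ * (S t * Q⁻¹ * A).trace := by
    have : (Q⁻¹ * (S t * Aᵀ)).trace = (Q⁻¹ * (A * S t)).trace := by
      rw [← Matrix.trace_transpose, Matrix.transpose_mul, Matrix.transpose_mul, hSt, hQt,
        Matrix.transpose_transpose, Matrix.trace_mul_comm]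
    rw [Matrix.mul_smul, Matrix.trace_smul, Matrix.mul_add, Matrix.trace_add, this,
      ← Matrix.mul_assoc, Matrix.trace_mul_comm, ← Matrix.mul_assoc, smul_eq_mul]
    ring
  have e2 : (Q⁻¹ * S t).det * ((Q⁻¹ * S t)⁻¹ * (Q⁻¹ * (κ • (A * S t + S t * Aᵀ)))).trace /
      (Q⁻¹ * S t).det = 2 * κ * A.trace := by
    rw [mul_div_cancel_left₀ _ hd0, Matrix.mul_inv_rev, Matrix.mul_assoc,
      Matrix.nonsing_inv_mul_cancel_left _ _ hQd.isUnit, Matrix.mul_smul, Matrix.trace_smul,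
      Matrix.mul_add, Matrix.trace_add, Matrix.nonsing_inv_mul_cancel_left _ _ hSd,
      Matrix.trace_transpose, ← Matrix.mul_assoc, Matrix.trace_mul_comm,
      Matrix.mul_nonsing_inv_cancel_left _ _ hSd, smul_eq_mul]
    ring
  have hcu : Q⁻¹ *ᵥ (m t - b).ofLp = -c.ofLp := by rw [hc, driftVec]; simp
  rw [e1, e2]
  have e3 : ∀ v : Fin d → ℝ, (m t - b).ofLp ⬝ᵥ (Q⁻¹ *ᵥ v) = -(c.ofLp ⬝ᵥ v) := by
    intro v
    rw [Matrix.dotProduct_mulVec, ← Matrix.mulVec_transpose, hQt, hcu, neg_dotProduct]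
  have e4 : Aᵀ = 1 - S t * Q⁻¹ - Matrix.vecMulVec (m t).ofLp (m t - b).ofLp * Q⁻¹ := by
    rw [hA, driftMat, Matrix.transpose_sub, Matrix.transpose_mul, hQt, Matrix.transpose_add, hSt,
      Matrix.transpose_vecMulVec, Matrix.transpose_one, Matrix.add_mul, sub_sub]
  have e5 : (Matrix.vecMulVec (m t).ofLp (m t - b).ofLp * Q⁻¹ * A).trace =
      -(c.ofLp ⬝ᵥ (A *ᵥ (m t).ofLp)) := by
    rw [Matrix.vecMulVec_mul, Matrix.vecMulVec_mul, Matrix.trace_vecMulVec, dotProduct_comm,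
      ← Matrix.dotProduct_mulVec, ← Matrix.mulVec_transpose, hQt, hcu, neg_dotProduct]
  rw [dissipation, ← hA, ← hc, e4, Matrix.sub_mul, Matrix.sub_mul, Matrix.one_mul, Matrix.trace_sub,
    Matrix.trace_sub, e5]
  simp only [Matrix.zero_mulVec, zero_add, WithLp.ofLp_smul, WithLp.ofLp_add, e3, hcu,
    dotProduct_neg, smul_dotProduct, dotProduct_smul, add_dotProduct, dotProduct_add, smul_eq_mul]
  rw [dotProduct_comm (A *ᵥ (m t).ofLp)]
  ring

lemma dissipation_nonneg (b : Vec d) (Q : Mat d) (m : Vec d) (S : Mat d) :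
    0 ≤ dissipation b Q m S := by
  refine add_nonneg ?_ (Finset.sum_nonneg fun i _ => mul_self_nonneg _)
  simp only [Matrix.trace, Matrix.diag, Matrix.mul_apply, Matrix.transpose_apply]
  exact Finset.sum_nonneg fun i _ => Finset.sum_nonneg fun j _ => mul_self_nonneg _

/-- The square of the Frobenius norm. -/
def frobSq (M : Mat d) : ℝ := ∑ i, ∑ j, M i j ^ 2

lemma frobSq_nonneg (M : Mat d) : 0 ≤ frobSq M :=
  Finset.sum_nonneg fun _ _ => Finset.sum_nonneg fun _ _ => sq_nonneg _

lemma trace_transpose_mul_self (M : Mat d) : (Mᵀ * M).trace = frobSq M := by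
  simp only [frobSq, Matrix.trace, Matrix.diag, Matrix.mul_apply, Matrix.transpose_apply, ← sq]
  exact Finset.sum_comm

lemma trace_mul_self_le (M : Mat d) : (M * M).trace ≤ frobSq M := by
  have h1 : (M * M).trace = ∑ i, ∑ j, M i j * M j i := by
    simp [Matrix.trace, Matrix.mul_apply]
  have h2 : frobSq M = ∑ i, ∑ j, (M i j ^ 2 + M j i ^ 2) / 2 := by
    simp only [← Finset.sum_div, Finset.sum_add_distrib]
    rw [Finset.sum_comm (f := fun i j => M j i ^ 2)]
    simp [frobSq]
  rw [h1, h2]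
  refine Finset.sum_le_sum fun i _ => Finset.sum_le_sum fun j _ => ?_
  nlinarith [sq_nonneg (M i j - M j i)]

lemma frobSq_neg (M : Mat d) : frobSq (-M) = frobSq M := by simp [frobSq]

/-- Young's inequality. -/
lemma frobSq_add_le (M N : Mat d) {η : ℝ} (hη : 0 < η) :
    frobSq (M + N) ≤ (1 + η) * frobSq M + (1 + 1 / η) * frobSq N := by
  simp only [frobSq, Finset.mul_sum, ← Finset.sum_add_distrib]
  refine Finset.sum_le_sum fun i _ => Finset.sum_le_sum fun j _ => ?_
  have h : (1 + η) * M i j ^ 2 + (1 + 1 / η) * N i j ^ 2 - (M i j + N i j) ^ 2 =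
      (η * M i j - N i j) ^ 2 / η := by field_simp; ring
  have : 0 ≤ (η * M i j - N i j) ^ 2 / η := by positivity
  simp only [Matrix.add_apply]
  linarith

lemma frobSq_vecMulVec (v w : Fin d → ℝ) :
    frobSq (Matrix.vecMulVec v w) = (v ⬝ᵥ v) * (w ⬝ᵥ w) := by
  simp only [frobSq, Matrix.vecMulVec_apply, dotProduct, Finset.sum_mul_sum]
  exact Finset.sum_congr rfl fun i _ => Finset.sum_congr rfl fun j _ => by ring

lemma norm_sq_vec (v : Vec d) : ‖v‖ ^ 2 = v.ofLp ⬝ᵥ v.ofLp := by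
  rw [EuclideanSpace.real_norm_sq_eq]
  simp [dotProduct, sq]

/-- The spectral norm is at most the Frobenius norm. -/
lemma norm_sq_le_frobSq (M : Mat d) : ‖M‖ ^ 2 ≤ frobSq M := by
  have h : ‖M‖ ≤ Real.sqrt (frobSq M) := by
    rw [Matrix.cstar_norm_def]
    refine ContinuousLinearMap.opNorm_le_bound _ (Real.sqrt_nonneg _) fun x => ?_
    rw [← Real.sqrt_sq (norm_nonneg x), ← Real.sqrt_mul (frobSq_nonneg M)]
    refine Real.le_sqrt_of_sq_le ?_
    rw [EuclideanSpace.real_norm_sq_eq, EuclideanSpace.real_norm_sq_eq, frobSq, Finset.sum_mul]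
    refine Finset.sum_le_sum fun i _ => ?_
    rw [Matrix.ofLp_toEuclideanCLM]
    exact Finset.sum_mul_sq_le_sq_mul_sq Finset.univ (fun j => M i j) x.ofLp
  calc ‖M‖ ^ 2 ≤ Real.sqrt (frobSq M) ^ 2 := by gcongr
    _ = frobSq M := Real.sq_sqrt (frobSq_nonneg M)

end Energy

/-! ### The covariance relative to the target -/

section Spectral

variable {d : ℕ}

/-- The scalar function `x - 1 - log x` to which the relative entropy of Gaussians reduces. -/
def entropyFun (x : ℝ) : ℝ := x - 1 - Real.log x

lemma entropyFun_lower {x : ℝ} (hx : 0 < x) : (√x - 1) ^ 2 ≤ entropyFun x := by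
  have h1 : Real.log x = 2 * Real.log (√x) := by
    rw [Real.log_sqrt hx.le]; ring
  have h2 := Real.log_le_sub_one_of_pos (Real.sqrt_pos.2 hx)
  have h3 := Real.sq_sqrt hx.le
  rw [entropyFun, h1]
  nlinarith

lemma entropyFun_nonneg {x : ℝ} (hx : 0 < x) : 0 ≤ entropyFun x :=
  (sq_nonneg _).trans (entropyFun_lower hx)

lemma entropyFun_upper {x : ℝ} (hx : 0 < x) : entropyFun x ≤ (x - 1) ^ 2 / x := by
  have h := Real.one_sub_inv_le_log_of_pos hx
  have : (x - 1) ^ 2 / x = x - 1 - (1 - x⁻¹) := by field_simp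
  rw [entropyFun, this]; linarith

lemma exp_neg_le_of_entropyFun_le {x C : ℝ} (hx : 0 < x) (h : entropyFun x ≤ C) :
    Real.exp (-(1 + C)) ≤ x := by
  rw [← Real.le_log_iff_exp_le hx]
  rw [entropyFun] at h
  linarith

lemma sub_one_sq_le_of_entropyFun_le {x C : ℝ} (hx : 0 < x) (hC : entropyFun x ≤ C) :
    (x - 1) ^ 2 ≤ (2 + √C) ^ 2 * entropyFun x := by
  have h1 := entropyFun_lower hx
  have h2 : √x - 1 ≤ √C := Real.le_sqrt_of_sq_le (h1.trans hC)
  have h3 : x - 1 = (√x - 1) * (√x + 1) := by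
    have := Real.sq_sqrt hx.le; nlinarith
  have h4 := Real.sqrt_nonneg x
  rw [h3, mul_pow, mul_comm]
  have : (√x + 1) ^ 2 ≤ (2 + √C) ^ 2 := by
    apply pow_le_pow_left₀ (by positivity); linarith
  exact mul_le_mul this h1 (sq_nonneg _) (sq_nonneg _)

/-- Near `1`, `x - 1 - log x` is `(x - 1)² / 2` up to a factor close to `1`: this constant makes the
rate sharp. -/
lemma entropyFun_upper_near {x η : ℝ} (hη : 0 < η) (hη1 : η ≤ 1) (hx : |x - 1| ≤ η / 4) :
    entropyFun x ≤ (1 + η) / 2 * (x - 1) ^ 2 := by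
  have hlt : |1 - x| < 1 := by rw [abs_sub_comm]; linarith
  have h := Real.abs_log_sub_add_sum_range_le hlt 2
  simp only [Finset.sum_range_succ, Finset.sum_range_zero] at h
  rw [show 1 - (1 - x) = x by ring] at h
  have h1 := (abs_le.1 h).1
  have hb : |1 - x| ^ (2 + 1) / (1 - |1 - x|) ≤ η / 2 * (x - 1) ^ 2 := by
    rw [abs_sub_comm] at hlt ⊢
    rw [div_le_iff₀ (by linarith), pow_succ, sq_abs]
    have : |x - 1| ≤ η / 2 * (1 - |x - 1|) := by nlinarith
    nlinarith [sq_nonneg (x - 1)]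
  norm_num at h1
  rw [entropyFun]
  nlinarith

/-- The positive square root of a positive definite matrix is symmetric and invertible. -/
lemma sqrt_spec {S : Mat d} (hS : S.PosDef) :
    CFC.sqrt S * CFC.sqrt S = S ∧ (CFC.sqrt S)ᵀ = CFC.sqrt S ∧ IsUnit (CFC.sqrt S).det := by
  have hPP : CFC.sqrt S * CFC.sqrt S = S := CFC.sqrt_mul_sqrt_self _ hS.posSemidef.nonneg
  refine ⟨hPP, ?_, ?_⟩
  · rw [← Matrix.conjTranspose_eq_transpose_of_trivial]
    exact (CFC.sqrt_nonneg S).isSelfAdjoint.star_eq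
  · rw [isUnit_iff_ne_zero]
    intro h
    have h2 := congrArg Matrix.det hPP
    rw [Matrix.det_mul, h, zero_mul] at h2
    exact hS.det_pos.ne h2

lemma trace_mul_self_eq_sum_eigenvalues {W : Mat d} (hW : W.IsHermitian) :
    (W * W).trace = ∑ i, hW.eigenvalues i ^ 2 := by
  have hsp := hW.spectral_theorem
  rw [Unitary.conjStarAlgAut_apply] at hsp
  set U := (hW.eigenvectorUnitary : Mat d) with hU
  have hUU : star U * U = 1 := Unitary.coe_star_mul_self hW.eigenvectorUnitary
  have : W * W = U * (Matrix.diagonal (RCLike.ofReal ∘ hW.eigenvalues) *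
      Matrix.diagonal (RCLike.ofReal ∘ hW.eigenvalues)) * star U := by
    refine (congrArg₂ (· * ·) hsp hsp).trans ?_
    simp only [Matrix.mul_assoc]
    rw [← Matrix.mul_assoc (star U) U, hUU, Matrix.one_mul]
  rw [this, Matrix.trace_mul_comm, ← Matrix.mul_assoc, hUU, Matrix.one_mul,
    Matrix.diagonal_mul_diagonal, Matrix.trace_diagonal]
  simp [sq]

/-- The eigenvalues of `Q^{-1/2} S Q^{-1/2}`, through the invariants of `Q⁻¹ S`. -/
lemma exists_eigenvalues {Q : Mat d} (hQ : Q.PosDef) :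
    ∃ C : ℝ, 0 < C ∧ ∀ S : Mat d, S.PosDef →
    ∃ ev : Fin d → ℝ, (∀ i, 0 < ev i) ∧ (Q⁻¹ * S).trace = ∑ i, ev i ∧
      (Q⁻¹ * S).det = ∏ i, ev i ∧
      ((Q⁻¹ * S - 1) * (Q⁻¹ * S - 1)).trace = ∑ i, (ev i - 1) ^ 2 ∧
      ‖S - Q‖ ^ 2 ≤ C * ∑ i, (ev i - 1) ^ 2 := by
  obtain ⟨hPP, hPt, hPd⟩ := sqrt_spec hQ.inv
  set P : Mat d := CFC.sqrt Q⁻¹ with hP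
  refine ⟨(‖P⁻¹‖ * ‖P⁻¹‖) ^ 2 + 1, by positivity, fun S hS => ?_⟩
  have hW : (P * S * P).PosDef := by
    have := hS.conjTranspose_mul_mul_same (B := P)
      (Matrix.mulVec_injective_of_isUnit ((Matrix.isUnit_iff_isUnit_det _).2 hPd))
    rwa [Matrix.conjTranspose_eq_transpose_of_trivial, hPt] at this
  have hconj : Q⁻¹ * S = P * (P * S * P) * P⁻¹ := by
    rw [← hPP]
    simp only [Matrix.mul_assoc]
    rw [Matrix.mul_nonsing_inv _ hPd, Matrix.mul_one]
  have htr := trace_mul_self_eq_sum_eigenvalues hW.1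
  have htr1 : (Q⁻¹ * S).trace = ∑ i, hW.1.eigenvalues i := by
    have := hW.1.trace_eq_sum_eigenvalues
    rw [hconj, Matrix.trace_mul_comm, Matrix.nonsing_inv_mul_cancel_left _ _ hPd, this]
    simp
  have hconj1 : Q⁻¹ * S - 1 = P * (P * S * P - 1) * P⁻¹ := by
    rw [Matrix.mul_sub, Matrix.sub_mul, hconj, Matrix.mul_one, Matrix.mul_nonsing_inv _ hPd]
  have hsum : ((Q⁻¹ * S - 1) * (Q⁻¹ * S - 1)).trace = ∑ i, (hW.1.eigenvalues i - 1) ^ 2 := by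
    have hsq : ((Q⁻¹ * S) * (Q⁻¹ * S)).trace = ∑ i, hW.1.eigenvalues i ^ 2 := by
      rw [← htr, hconj]
      have : P * (P * S * P) * P⁻¹ * (P * (P * S * P) * P⁻¹) =
          P * ((P * S * P) * (P * S * P)) * P⁻¹ := by
        generalize P * S * P = W
        simp only [Matrix.mul_assoc]
        rw [Matrix.nonsing_inv_mul_cancel_left _ _ hPd]
      rw [this, Matrix.trace_mul_comm _ P⁻¹, Matrix.nonsing_inv_mul_cancel_left _ _ hPd]
    have : (Q⁻¹ * S - 1) * (Q⁻¹ * S - 1) = (Q⁻¹ * S) * (Q⁻¹ * S) - (2:ℝ) • (Q⁻¹ * S) + 1 := by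
      rw [two_smul]; noncomm_ring
    rw [this, Matrix.trace_add, Matrix.trace_sub, Matrix.trace_smul, hsq, htr1, Matrix.trace_one]
    have h : ∀ i, (hW.1.eigenvalues i - 1) ^ 2 =
        hW.1.eigenvalues i ^ 2 - 2 * hW.1.eigenvalues i + 1 := fun i => by ring
    simp only [h, Finset.sum_add_distrib, Finset.sum_sub_distrib, ← Finset.mul_sum]
    simp
  refine ⟨hW.1.eigenvalues, fun i => hW.eigenvalues_pos i, htr1, ?_, hsum, ?_⟩
  · have := hW.1.det_eq_prod_eigenvalues
    rw [hconj, Matrix.det_mul, mul_comm, ← Matrix.det_mul,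
      Matrix.nonsing_inv_mul_cancel_left _ _ hPd, this]
    simp
  · have hfrob : frobSq (P * S * P - 1) = ∑ i, (hW.1.eigenvalues i - 1) ^ 2 := by
      have ht : (P * S * P - 1)ᵀ = P * S * P - 1 := by
        rw [Matrix.transpose_sub, Matrix.transpose_one, transpose_of_posDef hW]
      rw [← hsum, ← trace_transpose_mul_self, ht, hconj1]
      have : P * (P * S * P - 1) * P⁻¹ * (P * (P * S * P - 1) * P⁻¹) =
          P * ((P * S * P - 1) * (P * S * P - 1)) * P⁻¹ := by
        generalize P * S * P - 1 = W
        simp only [Matrix.mul_assoc]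
        rw [Matrix.nonsing_inv_mul_cancel_left _ _ hPd]
      rw [this, Matrix.trace_mul_comm _ P⁻¹, Matrix.nonsing_inv_mul_cancel_left _ _ hPd]
    have hSQ : S - Q = P⁻¹ * (P * S * P - 1) * P⁻¹ := by
      have hQinv : Q = P⁻¹ * P⁻¹ := by
        rw [← Matrix.mul_inv_rev, hPP, Matrix.nonsing_inv_nonsing_inv _ hQ.det_pos.ne'.isUnit]
      rw [Matrix.mul_sub, Matrix.sub_mul, Matrix.mul_one, ← hQinv, Matrix.mul_assoc P S P,
        Matrix.nonsing_inv_mul_cancel_left _ _ hPd, Matrix.mul_assoc, Matrix.mul_nonsing_inv _ hPd,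
        Matrix.mul_one]
    have h1 : ‖S - Q‖ ≤ ‖P⁻¹‖ * ‖P⁻¹‖ * ‖P * S * P - 1‖ := by
      rw [hSQ]
      refine (norm_mul_le _ _).trans ?_
      have := mul_le_mul_of_nonneg_right (norm_mul_le P⁻¹ (P * S * P - 1)) (norm_nonneg P⁻¹)
      linarith
    have h2 := pow_le_pow_left₀ (norm_nonneg _) h1 2
    rw [mul_pow] at h2
    have h3 := norm_sq_le_frobSq (P * S * P - 1)
    rw [hfrob] at h3
    have h4 := mul_le_mul_of_nonneg_left h3 (sq_nonneg (‖P⁻¹‖ * ‖P⁻¹‖))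
    have h5 : 0 ≤ ∑ i, (hW.1.eigenvalues i - 1) ^ 2 := Finset.sum_nonneg fun _ _ => sq_nonneg _
    linarith

/-- The quadratic forms of `Q⁻¹`, of `Q⁻²` and of the identity dominate each other. -/
lemma exists_form_bound {Q : Mat d} (hQ : Q.PosDef) :
    ∃ C : ℝ, 0 < C ∧ ∀ v : Fin d → ℝ, 0 ≤ v ⬝ᵥ (Q⁻¹ *ᵥ v) ∧ v ⬝ᵥ v ≤ C * (v ⬝ᵥ (Q⁻¹ *ᵥ v)) ∧
      v ⬝ᵥ (Q⁻¹ *ᵥ v) ≤ C * ((Q⁻¹ *ᵥ v) ⬝ᵥ (Q⁻¹ *ᵥ v)) := by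
  obtain ⟨hPP, hPt, hPd⟩ := sqrt_spec hQ.inv
  set P : Mat d := CFC.sqrt Q⁻¹ with hP
  have hform : ∀ v : Fin d → ℝ, v ⬝ᵥ (Q⁻¹ *ᵥ v) = (P *ᵥ v) ⬝ᵥ (P *ᵥ v) := fun v => by
    rw [← hPP, ← Matrix.mulVec_mulVec, Matrix.dotProduct_mulVec, ← Matrix.mulVec_transpose, hPt]
  have hb : ∀ v : Fin d → ℝ, v ⬝ᵥ v ≤ (‖P⁻¹‖ ^ 2 + 1) * ((P *ᵥ v) ⬝ᵥ (P *ᵥ v)) := fun v => by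
    have h1 := Matrix.l2_opNorm_mulVec P⁻¹ (WithLp.toLp 2 (P *ᵥ v))
    simp only [Matrix.mulVec_mulVec, Matrix.nonsing_inv_mul _ hPd, Matrix.one_mulVec] at h1
    have h2 := pow_le_pow_left₀ (norm_nonneg _) h1 2
    rw [mul_pow, norm_sq_vec (WithLp.toLp 2 (P *ᵥ v))] at h2
    have h3 : v ⬝ᵥ v ≤ ‖P⁻¹‖ ^ 2 * ((P *ᵥ v) ⬝ᵥ (P *ᵥ v)) := by
      refine le_trans (le_of_eq ?_) h2
      exact (norm_sq_vec (WithLp.toLp 2 v)).symm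
    have h4 : 0 ≤ (P *ᵥ v) ⬝ᵥ (P *ᵥ v) := Finset.sum_nonneg fun i _ => mul_self_nonneg _
    linarith
  refine ⟨‖P⁻¹‖ ^ 2 + 1, by positivity, fun v => ⟨?_, ?_, ?_⟩⟩
  · rw [hform]; exact Finset.sum_nonneg fun i _ => mul_self_nonneg _
  · rw [hform]; exact hb v
  · rw [hform, ← hPP, ← Matrix.mulVec_mulVec]; exact hb _

end Spectral

/-! ### Relative entropy, distance and dissipation -/

section EnergyBounds

variable {d : ℕ}

/-- The relative entropy in terms of the eigenvalues `ev` of `Q^{-1/2} S Q^{-1/2}`. -/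
lemma energy_eq_sum (b m : Vec d) (Q S : Mat d) {ev : Fin d → ℝ} (hpos : ∀ i, 0 < ev i)
    (htr : (Q⁻¹ * S).trace = ∑ i, ev i) (hdet : (Q⁻¹ * S).det = ∏ i, ev i) :
    energy b Q m S = ∑ i, entropyFun (ev i) + (m - b).ofLp ⬝ᵥ (Q⁻¹ *ᵥ (m - b).ofLp) := by
  rw [energy, htr, hdet, Real.log_prod (fun i _ => (hpos i).ne')]
  simp only [entropyFun, Finset.sum_sub_distrib]
  simp

/-- The relative entropy controls the distance to the target. -/
lemma exists_energy_lower (b : Vec d) {Q : Mat d} (hQ : Q.PosDef) :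
    ∃ C : ℝ, 0 < C ∧ ∀ (m : Vec d) (S : Mat d), S.PosDef →
      0 ≤ energy b Q m S ∧ ‖m - b‖ ^ 2 ≤ C * energy b Q m S ∧
      ‖S - Q‖ ^ 2 ≤ C * (2 + √(energy b Q m S)) ^ 2 * energy b Q m S := by
  obtain ⟨C₁, hC₁, h₁⟩ := exists_eigenvalues hQ
  obtain ⟨C₂, hC₂, h₂⟩ := exists_form_bound hQ
  refine ⟨C₁ + C₂, by positivity, fun m S hS => ?_⟩
  obtain ⟨ev, hpos, htr, hdet, htr2, hSQ⟩ := h₁ S hS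
  obtain ⟨hu0, hu1, hu2⟩ := h₂ (m - b).ofLp
  have hE := energy_eq_sum b m Q S hpos htr hdet
  have hf : ∀ i, 0 ≤ entropyFun (ev i) := fun i => entropyFun_nonneg (hpos i)
  have hs : 0 ≤ ∑ i, entropyFun (ev i) := Finset.sum_nonneg fun i _ => hf i
  have hE0 : 0 ≤ energy b Q m S := by rw [hE]; positivity
  refine ⟨hE0, ?_, ?_⟩
  · rw [norm_sq_vec]
    nlinarith
  · have hle : ∀ i, entropyFun (ev i) ≤ energy b Q m S := fun i => by
      rw [hE]
      have := Finset.single_le_sum (fun j _ => hf j) (Finset.mem_univ i)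
      linarith
    have h3 : ∑ i, (ev i - 1) ^ 2 ≤ (2 + √(energy b Q m S)) ^ 2 * energy b Q m S := by
      calc ∑ i, (ev i - 1) ^ 2 ≤ ∑ i, (2 + √(energy b Q m S)) ^ 2 * entropyFun (ev i) :=
            Finset.sum_le_sum fun i _ => sub_one_sq_le_of_entropyFun_le (hpos i) (hle i)
        _ = (2 + √(energy b Q m S)) ^ 2 * ∑ i, entropyFun (ev i) := by rw [Finset.mul_sum]
        _ ≤ _ := by
          refine mul_le_mul_of_nonneg_left ?_ (sq_nonneg _)
          rw [hE]; linarith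
    have h4 : 0 ≤ (2 + √(energy b Q m S)) ^ 2 * energy b Q m S := by positivity
    calc ‖S - Q‖ ^ 2 ≤ C₁ * ((2 + √(energy b Q m S)) ^ 2 * energy b Q m S) :=
          hSQ.trans (mul_le_mul_of_nonneg_left h3 hC₁.le)
      _ ≤ (C₁ + C₂) * ((2 + √(energy b Q m S)) ^ 2 * energy b Q m S) := by gcongr; linarith
      _ = _ := by ring

lemma dissipation_eq (b m : Vec d) (Q S : Mat d) :
    dissipation b Q m S = frobSq (driftMat b Q m S) +
      (Q⁻¹ *ᵥ (m - b).ofLp) ⬝ᵥ (Q⁻¹ *ᵥ (m - b).ofLp) := by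
  rw [dissipation, trace_transpose_mul_self, driftVec]
  simp

/-- On sublevel sets of the relative entropy, the dissipation dominates it. -/
lemma exists_energy_le_dissipation (b : Vec d) {Q : Mat d} (hQ : Q.PosDef) (H₀ : ℝ) :
    ∃ C : ℝ, 0 < C ∧ ∀ (m : Vec d) (S : Mat d), S.PosDef → energy b Q m S ≤ H₀ →
      energy b Q m S ≤ C * dissipation b Q m S := by
  obtain ⟨C₁, hC₁, h₁⟩ := exists_eigenvalues hQ
  obtain ⟨C₂, hC₂, h₂⟩ := exists_form_bound hQ
  obtain ⟨C₃, hC₃, h₃⟩ := exists_energy_lower b hQ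
  refine ⟨Real.exp (1 + H₀) * (2 * (1 + (√(C₃ * |H₀|) + ‖b‖) ^ 2)) + C₂, by positivity,
    fun m S hS hH => ?_⟩
  obtain ⟨ev, hpos, htr, hdet, htr2, -⟩ := h₁ S hS
  obtain ⟨hu0, hu1, hu2⟩ := h₂ (m - b).ofLp
  obtain ⟨hE0, hm, -⟩ := h₃ m S hS
  have hE := energy_eq_sum b m Q S hpos htr hdet
  set w := Q⁻¹ *ᵥ (m - b).ofLp with hw
  have hw0 : 0 ≤ w ⬝ᵥ w := Finset.sum_nonneg fun i _ => mul_self_nonneg _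
  have hD := dissipation_eq b m Q S
  rw [← hw] at hD
  set A := driftMat b Q m S with hA
  have hA0 := frobSq_nonneg A
  have hX : Q⁻¹ * S - 1 = -A + -Matrix.vecMulVec w m.ofLp := by
    rw [hA, driftMat, hw, Matrix.mul_add, Matrix.mul_vecMulVec]; abel
  have hmn : m.ofLp ⬝ᵥ m.ofLp ≤ (√(C₃ * |H₀|) + ‖b‖) ^ 2 := by
    rw [← norm_sq_vec]
    refine pow_le_pow_left₀ (norm_nonneg _) ?_ 2
    have : ‖m - b‖ ≤ √(C₃ * |H₀|) := by
      refine Real.le_sqrt_of_sq_le (hm.trans ?_)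
      exact mul_le_mul_of_nonneg_left (hH.trans (le_abs_self _)) hC₃.le
    calc ‖m‖ = ‖(m - b) + b‖ := by rw [sub_add_cancel]
      _ ≤ _ := (norm_add_le _ _).trans (by linarith)
  have hsum : ∑ i, (ev i - 1) ^ 2 ≤
      2 * (1 + (√(C₃ * |H₀|) + ‖b‖) ^ 2) * dissipation b Q m S := by
    rw [← htr2]
    refine (trace_mul_self_le _).trans ?_
    rw [hX]
    refine (frobSq_add_le _ _ one_pos).trans ?_
    rw [frobSq_neg, frobSq_neg, frobSq_vecMulVec, hD]
    have h5 := mul_le_mul_of_nonneg_left hmn hw0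
    have h6 : 0 ≤ (√(C₃ * |H₀|) + ‖b‖) ^ 2 := sq_nonneg _
    nlinarith [mul_nonneg h6 hA0]
  have hsumf : ∑ i, entropyFun (ev i) ≤ Real.exp (1 + H₀) * ∑ i, (ev i - 1) ^ 2 := by
    rw [Finset.mul_sum]
    refine Finset.sum_le_sum fun i _ => ?_
    have hle : entropyFun (ev i) ≤ H₀ := by
      have := Finset.single_le_sum (fun j _ => entropyFun_nonneg (hpos j)) (Finset.mem_univ i)
      linarith
    refine (entropyFun_upper (hpos i)).trans ?_
    rw [div_le_iff₀ (hpos i)]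
    have h7 := exp_neg_le_of_entropyFun_le (hpos i) hle
    rw [Real.exp_neg] at h7
    have h8 : 1 ≤ Real.exp (1 + H₀) * ev i := by
      have := mul_le_mul_of_nonneg_left h7 (Real.exp_pos (1 + H₀)).le
      rwa [mul_inv_cancel₀ (Real.exp_pos _).ne'] at this
    nlinarith [sq_nonneg (ev i - 1)]
  have hwD : w ⬝ᵥ w ≤ dissipation b Q m S := by rw [hD]; linarith
  calc energy b Q m S ≤ Real.exp (1 + H₀) *
        (2 * (1 + (√(C₃ * |H₀|) + ‖b‖) ^ 2) * dissipation b Q m S) + C₂ * dissipation b Q m S := by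
        rw [hE]
        refine add_le_add (hsumf.trans ?_) (hu2.trans ?_)
        · exact mul_le_mul_of_nonneg_left hsum (Real.exp_pos _).le
        · exact mul_le_mul_of_nonneg_left hwD hC₂.le
    _ = _ := by ring

/-- Near the target, the ratio of `dissipation` to `energy` is almost at least `2 γ`, for any lower
bound `γ` of the linearised form. -/
lemma exists_energy_le_dissipation_near (b : Vec d) {Q : Mat d} (hQ : Q.PosDef) {γ : ℝ}
    (hγ0 : 0 ≤ γ)
    (hγ : ∀ (X : Mat d) (u : Fin d → ℝ), γ * (frobSq X + 2 * (u ⬝ᵥ (Q⁻¹ *ᵥ u))) ≤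
      frobSq (X + Matrix.vecMulVec (Q⁻¹ *ᵥ u) b.ofLp) + (Q⁻¹ *ᵥ u) ⬝ᵥ (Q⁻¹ *ᵥ u))
    {η : ℝ} (hη : 0 < η) (hη1 : η ≤ 1) :
    ∃ h : ℝ, 0 < h ∧ ∀ (m : Vec d) (S : Mat d), S.PosDef → energy b Q m S ≤ h →
      2 * γ * energy b Q m S ≤ (1 + η) ^ 2 * dissipation b Q m S := by
  obtain ⟨C₁, hC₁, h₁⟩ := exists_eigenvalues hQ
  obtain ⟨C₂, hC₂, h₂⟩ := exists_form_bound hQ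
  obtain ⟨C₃, hC₃, h₃⟩ := exists_energy_lower b hQ
  -- the first bound on the entropy makes the eigenvalues `η / 4`-close to `1`, and the second gives
  -- `(1 + 1 / η) ‖m - b‖² ≤ η`
  refine ⟨min (η ^ 2 / 144) (η / (C₃ * (1 + 1 / η))), by positivity, fun m S hS hH => ?_⟩
  have hH1 := hH.trans (min_le_left _ _)
  have hH2 := hH.trans (min_le_right _ _)
  obtain ⟨ev, hpos, htr, hdet, htr2, -⟩ := h₁ S hS
  obtain ⟨hu0, -, -⟩ := h₂ (m - b).ofLp
  obtain ⟨hE0, hm, -⟩ := h₃ m S hS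
  have hE := energy_eq_sum b m Q S hpos htr hdet
  have hγ' := hγ (Q⁻¹ * S - 1) (m - b).ofLp
  set w := Q⁻¹ *ᵥ (m - b).ofLp with hw
  have hw0 : 0 ≤ w ⬝ᵥ w := Finset.sum_nonneg fun i _ => mul_self_nonneg _
  have hD := dissipation_eq b m Q S
  rw [← hw] at hD
  set A := driftMat b Q m S with hA
  have hA0 := frobSq_nonneg A
  -- the linearised form is evaluated at `-A`, up to the quadratic error `w (m - b)ᵀ`
  have hX : Q⁻¹ * S - 1 + Matrix.vecMulVec w b.ofLp =
      -A + -Matrix.vecMulVec w (m - b).ofLp := by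
    rw [hA, driftMat, hw, Matrix.mul_add, Matrix.mul_vecMulVec, WithLp.ofLp_sub,
      Matrix.vecMulVec_sub]
    abel
  rw [hX] at hγ'
  have h4 := frobSq_add_le (-A) (-Matrix.vecMulVec w (m - b).ofLp) hη
  rw [frobSq_neg A, frobSq_neg (Matrix.vecMulVec _ _), frobSq_vecMulVec, ← norm_sq_vec (m - b)] at h4
  have hu : (1 + 1 / η) * ‖m - b‖ ^ 2 ≤ η := by
    have h5 : ‖m - b‖ ^ 2 ≤ C₃ * (η / (C₃ * (1 + 1 / η))) :=
      hm.trans (mul_le_mul_of_nonneg_left hH2 hC₃.le)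
    calc (1 + 1 / η) * ‖m - b‖ ^ 2 ≤ (1 + 1 / η) * (C₃ * (η / (C₃ * (1 + 1 / η)))) := by gcongr
      _ = η := by field_simp
  have hstep : γ * (frobSq (Q⁻¹ * S - 1) + 2 * ((m - b).ofLp ⬝ᵥ w)) ≤
      (1 + η) * dissipation b Q m S := by
    rw [hD]
    have := mul_le_mul_of_nonneg_left hu hw0
    linarith
  have hev : ∑ i, entropyFun (ev i) ≤ (1 + η) / 2 * ∑ i, (ev i - 1) ^ 2 := by
    rw [Finset.mul_sum]
    refine Finset.sum_le_sum fun i _ => entropyFun_upper_near hη hη1 ?_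
    have hle : entropyFun (ev i) ≤ η ^ 2 / 144 := by
      have := Finset.single_le_sum (fun j _ => entropyFun_nonneg (hpos j)) (Finset.mem_univ i)
      linarith
    have h6 := sub_one_sq_le_of_entropyFun_le (hpos i) hle
    have h7 : √(η ^ 2 / 144) ≤ 1 := by
      rw [Real.sqrt_le_one]
      nlinarith
    have h8 : (2 + √(η ^ 2 / 144)) ^ 2 ≤ 9 := by
      nlinarith [Real.sqrt_nonneg (η ^ 2 / 144)]
    have h9 : (ev i - 1) ^ 2 ≤ (η / 4) ^ 2 := by
      have := mul_le_mul h8 hle (entropyFun_nonneg (hpos i)) (by norm_num)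
      nlinarith
    exact abs_le_of_sq_le_sq h9 (by positivity)
  have hfX : ∑ i, (ev i - 1) ^ 2 ≤ frobSq (Q⁻¹ * S - 1) := by
    rw [← htr2]; exact trace_mul_self_le _
  have h2E : 2 * energy b Q m S ≤ (1 + η) * (frobSq (Q⁻¹ * S - 1) + 2 * ((m - b).ofLp ⬝ᵥ w)) := by
    rw [hE]
    nlinarith
  calc 2 * γ * energy b Q m S = γ * (2 * energy b Q m S) := by ring
    _ ≤ γ * ((1 + η) * (frobSq (Q⁻¹ * S - 1) + 2 * ((m - b).ofLp ⬝ᵥ w))) := by gcongr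
    _ = (1 + η) * (γ * (frobSq (Q⁻¹ * S - 1) + 2 * ((m - b).ofLp ⬝ᵥ w))) := by ring
    _ ≤ (1 + η) * ((1 + η) * dissipation b Q m S) := by gcongr
    _ = _ := by ring

end EnergyBounds

/-! ### The spectrum of the rate matrix -/

section Rate

variable {d : ℕ}

/-- The least eigenvalue of a symmetric matrix, and the Rayleigh bound that it gives. -/
lemma exists_isLeast_spectrum {n : Type*} [Fintype n] [DecidableEq n] [Nonempty n]
    {M : Matrix n n ℝ} (hM : M.IsHermitian) :
    ∃ γ : ℝ, IsLeast (spectrum ℝ M) γ ∧ (∀ v : n → ℝ, γ * (v ⬝ᵥ v) ≤ v ⬝ᵥ (M *ᵥ v)) ∧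
      ∃ v : n → ℝ, v ≠ 0 ∧ M *ᵥ v = γ • v := by
  obtain ⟨i, hi⟩ := Finite.exists_min hM.eigenvalues
  have hleast : IsLeast (spectrum ℝ M) (hM.eigenvalues i) := by
    rw [hM.spectrum_real_eq_range_eigenvalues]
    exact ⟨⟨i, rfl⟩, by rintro _ ⟨j, rfl⟩; exact hi j⟩
  refine ⟨hM.eigenvalues i, hleast, fun v => ?_, (hM.eigenvectorBasis i).ofLp, ?_,
    hM.mulVec_eigenvectorBasis i⟩
  · have hps : (M - algebraMap ℝ (Matrix n n ℝ) (hM.eigenvalues i)).PosSemidef := by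
      rw [Matrix.posSemidef_iff_isHermitian_and_spectrum_nonneg]
      refine ⟨hM.sub ?_, ?_⟩
      · rw [Matrix.algebraMap_eq_diagonal]
        exact Matrix.isHermitian_diagonal _
      · rw [← spectrum.sub_singleton_eq]
        rintro _ ⟨x, hx, y, rfl, rfl⟩
        exact sub_nonneg.2 (hleast.2 hx)
    have h := hps.dotProduct_mulVec_nonneg v
    rw [Matrix.sub_mulVec, Algebra.algebraMap_eq_smul_one, Matrix.smul_mulVec, Matrix.one_mulVec,
      dotProduct_sub, dotProduct_smul, star_trivial, smul_eq_mul] at h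
    linarith
  · exact (WithLp.ofLp_eq_zero 2).ne.2 (hM.eigenvectorBasis.orthonormal.ne_zero i)

/-- The greatest eigenvalue of a positive definite matrix, and the Rayleigh bound that it gives. -/
lemma exists_isGreatest_spectrum (hd : 0 < d) {Q : Mat d} (hQ : Q.PosDef) :
    ∃ lam : ℝ, 0 < lam ∧ IsGreatest (spectrum ℝ Q) lam ∧
      ∀ v : Fin d → ℝ, v ⬝ᵥ (Q *ᵥ v) ≤ lam * (v ⬝ᵥ v) := by
  have : Nonempty (Fin d) := ⟨⟨0, hd⟩⟩
  obtain ⟨γ, hγ, hR, v, hv0, hv⟩ := exists_isLeast_spectrum hQ.isHermitian.neg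
  refine ⟨-γ, ?_, ?_, fun w => ?_⟩
  · have h1 := hQ.dotProduct_mulVec_pos hv0
    rw [star_trivial] at h1
    have h2 : v ⬝ᵥ (Q *ᵥ v) = -γ * (v ⬝ᵥ v) := by
      rw [Matrix.neg_mulVec] at hv
      rw [neg_eq_iff_eq_neg.1 hv, dotProduct_neg, dotProduct_smul, smul_eq_mul, neg_mul]
    rw [h2] at h1
    exact pos_of_mul_pos_left h1 (Finset.sum_nonneg fun i _ => mul_self_nonneg _)
  · rw [← spectrum.neg_eq] at hγ
    refine ⟨Set.mem_neg.1 hγ.1, fun x hx => ?_⟩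
    have := hγ.2 (show -x ∈ -spectrum ℝ Q by simpa using hx)
    linarith
  · have := hR w
    rw [Matrix.neg_mulVec, dotProduct_neg] at this
    linarith

lemma rateMatrix_isHermitian (b : Vec d) {Q : Mat d} (hQ : Q.PosDef) :
    (rateMatrix b Q).IsHermitian := by
  obtain ⟨-, hPt, -⟩ := sqrt_spec hQ.inv
  rw [Matrix.IsHermitian, Matrix.conjTranspose_eq_transpose_of_trivial, rateMatrix,
    Matrix.fromBlocks_transpose, Matrix.transpose_one, Matrix.transpose_smul,
    Matrix.transpose_smul, Matrix.transpose_smul, transpose_inv_of_posDef hQ]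
  have h : (kronBlock b Q)ᵀ = kronBlockRow b Q := by
    ext j ⟨i, k⟩
    simp only [kronBlock, kronBlockRow, Matrix.transpose_apply, Matrix.submatrix_apply,
      Matrix.kroneckerMap_apply, id, Matrix.replicateCol_apply, Matrix.replicateRow_apply]
    rw [← Matrix.transpose_apply (CFC.sqrt Q⁻¹), hPt]
  rw [← h, Matrix.transpose_transpose]

/-- The quadratic form of the rate matrix. The first block of the vector is the column-by-column
vectorisation of the matrix `X`. -/
lemma rateMatrix_form (b : Vec d) {Q : Mat d} (hQ : Q.PosDef) (X : Mat d) (y : Fin d → ℝ) :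
    (Sum.elim (fun p : Fin d × Fin d => X p.2 p.1) y) ⬝ᵥ
        (rateMatrix b Q *ᵥ Sum.elim (fun p : Fin d × Fin d => X p.2 p.1) y) =
      frobSq (X + Matrix.vecMulVec ((1 / √2) • (CFC.sqrt Q⁻¹ *ᵥ y)) b.ofLp) +
        1 / 2 * ((CFC.sqrt Q⁻¹ *ᵥ y) ⬝ᵥ (CFC.sqrt Q⁻¹ *ᵥ y)) := by
  obtain ⟨hPP, hPt, -⟩ := sqrt_spec hQ.inv
  set P := CFC.sqrt Q⁻¹ with hP
  set z := P *ᵥ y with hz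
  have hcol : kronBlock b Q *ᵥ y = fun p => b p.1 * z p.2 := by
    ext ⟨i, k⟩
    simp only [kronBlock, Matrix.mulVec, dotProduct, Matrix.submatrix_apply, id,
      Matrix.kroneckerMap_apply, Matrix.replicateCol_apply, hz, Finset.mul_sum, ← hP]
    exact Finset.sum_congr rfl fun j _ => by ring
  have hrow : y ⬝ᵥ (kronBlockRow b Q *ᵥ fun p : Fin d × Fin d => X p.2 p.1) =
      ∑ i, ∑ k, X k i * (b i * z k) := by
    have hk : kronBlockRow b Q = (kronBlock b Q)ᵀ := by
      ext j ⟨i, k⟩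
      simp only [kronBlock, kronBlockRow, Matrix.transpose_apply, Matrix.submatrix_apply,
        Matrix.kroneckerMap_apply, id, Matrix.replicateCol_apply, Matrix.replicateRow_apply]
      rw [← hP, ← Matrix.transpose_apply P, hPt]
    rw [hk, Matrix.mulVec_transpose, dotProduct_comm, ← Matrix.dotProduct_mulVec, hcol]
    simp only [dotProduct, Fintype.sum_prod_type]
  have hyy : y ⬝ᵥ (Q⁻¹ *ᵥ y) = z ⬝ᵥ z := by
    rw [hz, ← hPP, ← Matrix.mulVec_mulVec, Matrix.dotProduct_mulVec, ← Matrix.mulVec_transpose, hPt]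
  have h2 : (1 / √2) ^ 2 = (1 / 2 : ℝ) := by
    rw [div_pow, Real.sq_sqrt (by norm_num)]; norm_num
  rw [rateMatrix, Matrix.fromBlocks_mulVec, sumElim_dotProduct_sumElim]
  simp only [Sum.elim_comp_inl, Sum.elim_comp_inr, Matrix.one_mulVec, Matrix.smul_mulVec,
    dotProduct_add, dotProduct_smul, hrow, hyy, smul_eq_mul, hcol]
  have hfr : frobSq (X + Matrix.vecMulVec ((1 / √2) • z) b.ofLp) =
      ∑ i, ∑ k, X k i ^ 2 + 2 * (1 / √2) * ∑ i, ∑ k, X k i * (b i * z k) +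
        1 / 2 * ((b.ofLp ⬝ᵥ b.ofLp) * (z ⬝ᵥ z)) := by
    rw [frobSq, Finset.sum_comm, dotProduct, dotProduct, Finset.sum_mul_sum, ← h2]
    simp only [Finset.mul_sum, ← Finset.sum_add_distrib]
    refine Finset.sum_congr rfl fun i _ => Finset.sum_congr rfl fun k _ => ?_
    simp only [Matrix.add_apply, Matrix.vecMulVec_apply, Pi.smul_apply, smul_eq_mul]
    ring
  rw [hfr]
  simp only [dotProduct, Fintype.sum_prod_type, ← sq]
  ring

lemma sum_elim_dotProduct_self (X : Mat d) (y : Fin d → ℝ) :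
    (Sum.elim (fun p : Fin d × Fin d => X p.2 p.1) y) ⬝ᵥ
      (Sum.elim (fun p : Fin d × Fin d => X p.2 p.1) y) = frobSq X + y ⬝ᵥ y := by
  rw [sumElim_dotProduct_sumElim, frobSq, Finset.sum_comm]
  simp only [dotProduct, Fintype.sum_prod_type, sq]

/-- The explicit lower bound for the quadratic form of the rate matrix. -/
lemma rateMatrix_form_gt (b : Vec d) {Q : Mat d} (hQ : Q.PosDef) {lam : ℝ} (hlam : 0 < lam)
    (hR : ∀ v : Fin d → ℝ, v ⬝ᵥ (Q *ᵥ v) ≤ lam * (v ⬝ᵥ v)) (X : Mat d) (y : Fin d → ℝ)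
    (hpos : 0 < frobSq X + y ⬝ᵥ y) :
    frobSq X + y ⬝ᵥ y < (1 + b.ofLp ⬝ᵥ b.ofLp + 2 * lam) *
      (frobSq (X + Matrix.vecMulVec ((1 / √2) • (CFC.sqrt Q⁻¹ *ᵥ y)) b.ofLp) +
        1 / 2 * ((CFC.sqrt Q⁻¹ *ᵥ y) ⬝ᵥ (CFC.sqrt Q⁻¹ *ᵥ y))) := by
  obtain ⟨hPP, hPt, hPd⟩ := sqrt_spec hQ.inv
  set P := CFC.sqrt Q⁻¹ with hP
  set ζ := (1 / √2) • (P *ᵥ y) with hζ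
  have h2 : (1 / √2) * (1 / √2) = (1 / 2 : ℝ) := by
    rw [← sq, div_pow, Real.sq_sqrt (by norm_num)]; norm_num
  have hr : 1 / 2 * ((P *ᵥ y) ⬝ᵥ (P *ᵥ y)) = ζ ⬝ᵥ ζ := by
    rw [hζ, smul_dotProduct, dotProduct_smul, smul_eq_mul, smul_eq_mul, ← mul_assoc, h2]
  have hy : y ⬝ᵥ y ≤ 2 * lam * (ζ ⬝ᵥ ζ) := by
    have h3 : (P *ᵥ y) ⬝ᵥ (Q *ᵥ (P *ᵥ y)) = y ⬝ᵥ y := by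
      have : Pᵀ * (Q * P) = 1 := by
        have hQQ : Q = P⁻¹ * P⁻¹ := by
          rw [← Matrix.mul_inv_rev, hPP, Matrix.nonsing_inv_nonsing_inv _ hQ.det_pos.ne'.isUnit]
        rw [hPt, hQQ, Matrix.mul_assoc, Matrix.nonsing_inv_mul _ hPd, Matrix.mul_one,
          Matrix.mul_nonsing_inv _ hPd]
      rw [Matrix.mulVec_mulVec, ← Matrix.vecMul_transpose, ← Matrix.dotProduct_mulVec,
        Matrix.mulVec_mulVec, this, Matrix.one_mulVec]
    have := hR (P *ᵥ y)
    rw [h3] at this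
    rw [← hr]
    linarith
  rw [hr]
  set Y := X + Matrix.vecMulVec ζ b.ofLp with hY
  have hX : X = Y + -Matrix.vecMulVec ζ b.ofLp := by rw [hY]; abel
  have hF0 := frobSq_nonneg Y
  have hr0 : 0 ≤ ζ ⬝ᵥ ζ := Finset.sum_nonneg fun i _ => mul_self_nonneg _
  have hb0 : 0 ≤ b.ofLp ⬝ᵥ b.ofLp := Finset.sum_nonneg fun i _ => mul_self_nonneg _
  rcases hF0.eq_or_lt with hF | hF
  · have hYz : Y = 0 := by
      have h4 := (Finset.sum_eq_zero_iff_of_nonneg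
        (fun _ _ => Finset.sum_nonneg fun _ _ => sq_nonneg _)).1 hF.symm
      ext i j
      have h5 := (Finset.sum_eq_zero_iff_of_nonneg
        (fun _ _ => sq_nonneg _)).1 (h4 i (Finset.mem_univ _)) j (Finset.mem_univ _)
      simpa using h5
    have hX2 : frobSq X = (ζ ⬝ᵥ ζ) * (b.ofLp ⬝ᵥ b.ofLp) := by
      rw [hX, hYz, zero_add, frobSq_neg, frobSq_vecMulVec]
    rw [← hF]
    have hrpos : 0 < ζ ⬝ᵥ ζ := by
      rcases hr0.eq_or_lt with h | h
      · rw [← h] at hX2 hy; linarith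
      · exact h
    rw [hX2]
    linarith
  · have hX2 : frobSq X ≤ (1 + b.ofLp ⬝ᵥ b.ofLp) * (frobSq Y + ζ ⬝ᵥ ζ) := by
      rcases hb0.eq_or_lt with h | h
      · have : frobSq (Matrix.vecMulVec ζ b.ofLp) = 0 := by rw [frobSq_vecMulVec, ← h, mul_zero]
        have hbz : b.ofLp = 0 := dotProduct_self_eq_zero.1 h.symm
        have hXY : X = Y := by rw [hX, hbz]; simp
        rw [hXY, ← h]; linarith
      · have := frobSq_add_le Y (-Matrix.vecMulVec ζ b.ofLp) h
        rw [← hX, frobSq_neg, frobSq_vecMulVec] at this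
        refine this.trans (le_of_eq ?_)
        field_simp
        ring
    nlinarith [mul_pos hlam hF]

/-- The least eigenvalue `γ` of the rate matrix: the bound on it, and the coercivity that it gives
for the linearised dissipation. -/
lemma exists_rate (hd : 0 < d) (b : Vec d) {Q : Mat d} (hQ : Q.PosDef) :
    ∃ γ lam : ℝ, 0 < γ ∧ IsLeast (spectrum ℝ (rateMatrix b Q)) γ ∧ IsGreatest (spectrum ℝ Q) lam ∧
      γ > 1 / (1 + b.ofLp ⬝ᵥ b.ofLp + 2 * lam) ∧
      ∀ (X : Mat d) (u : Fin d → ℝ), γ * (frobSq X + 2 * (u ⬝ᵥ (Q⁻¹ *ᵥ u))) ≤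
        frobSq (X + Matrix.vecMulVec (Q⁻¹ *ᵥ u) b.ofLp) + (Q⁻¹ *ᵥ u) ⬝ᵥ (Q⁻¹ *ᵥ u) := by
  have : Nonempty (Fin d) := ⟨⟨0, hd⟩⟩
  obtain ⟨γ, hγ, hRay, v, hv0, hv⟩ := exists_isLeast_spectrum (rateMatrix_isHermitian b hQ)
  obtain ⟨lam, hlam0, hlam, hR⟩ := exists_isGreatest_spectrum hd hQ
  have hb0 : 0 ≤ b.ofLp ⬝ᵥ b.ofLp := Finset.sum_nonneg fun i _ => mul_self_nonneg _
  have hκ : 0 < 1 + b.ofLp ⬝ᵥ b.ofLp + 2 * lam := by positivity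
  have hgt : γ > 1 / (1 + b.ofLp ⬝ᵥ b.ofLp + 2 * lam) := by
    obtain ⟨X, y, rfl⟩ : ∃ (X : Mat d) (y : Fin d → ℝ),
        v = Sum.elim (fun p : Fin d × Fin d => X p.2 p.1) y :=
      ⟨Matrix.of fun k i => v (Sum.inl (i, k)), fun j => v (Sum.inr j), by
        ext (⟨i, k⟩ | j) <;> rfl⟩
    have hvv : 0 < frobSq X + y ⬝ᵥ y := by
      rw [← sum_elim_dotProduct_self]
      refine lt_of_le_of_ne (Finset.sum_nonneg fun i _ => mul_self_nonneg _) fun h => hv0 ?_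
      exact dotProduct_self_eq_zero.1 h.symm
    have h1 := rateMatrix_form_gt b hQ hlam0 hR X y hvv
    rw [← rateMatrix_form b hQ, hv, dotProduct_smul, sum_elim_dotProduct_self, smul_eq_mul] at h1
    rw [gt_iff_lt, div_lt_iff₀ hκ]
    nlinarith
  refine ⟨γ, lam, lt_trans (by positivity) hgt, hγ, hlam, hgt, fun X u => ?_⟩
  obtain ⟨hPP, hPt, hPd⟩ := sqrt_spec hQ.inv
  -- at this vector, the form of the rate matrix is the linearised dissipation
  have h := hRay (Sum.elim (fun p : Fin d × Fin d => X p.2 p.1) (√2 • (CFC.sqrt Q⁻¹ *ᵥ u)))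
  rw [rateMatrix_form b hQ, sum_elim_dotProduct_self, Matrix.mulVec_smul, Matrix.mulVec_mulVec,
    hPP, smul_smul] at h
  have h2 : √2 * √2 = (2:ℝ) := Real.mul_self_sqrt (by norm_num)
  have h3 : (1 / √2) * √2 = (1:ℝ) := by
    rw [one_div, inv_mul_cancel₀]; positivity
  rw [h3, one_smul] at h
  simp only [smul_dotProduct, dotProduct_smul, smul_eq_mul, ← mul_assoc] at h
  rw [mul_assoc (1/2) √2 √2, h2] at h
  rw [← hPP, ← Matrix.mulVec_mulVec u, Matrix.dotProduct_mulVec u, ← Matrix.mulVec_transpose,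
    hPt, Matrix.mulVec_mulVec, hPP]
  linarith

end Rate

/-! ### The flow of the mean-covariance system -/

section Flow

variable {d : ℕ}

/-- The system `m' = A m + c`, `E' = A E` for the mean and a factor `E` of the covariance `E Eᵀ`. -/
def flowField (b : Vec d) (Q : Mat d) (z : Vec d × Mat d) : Vec d × Mat d :=
  (WithLp.toLp 2 (driftMat b Q z.1 (z.2 * z.2ᵀ) *ᵥ z.1.ofLp) + driftVec b Q z.1,
    driftMat b Q z.1 (z.2 * z.2ᵀ) * z.2)

lemma contDiff_driftMat {F : Type*} [NormedAddCommGroup F] [NormedSpace ℝ F] {n : WithTop ℕ∞}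
    (b : Vec d) (Q : Mat d) {f : F → Vec d} {g : F → Mat d} (hf : ContDiff ℝ n f)
    (hg : ContDiff ℝ n g) : ContDiff ℝ n (fun x => driftMat b Q (f x) (g x)) :=
  contDiff_const.sub (contDiff_const.mul (hg.add
    (contDiff_vecMulVec (hf.sub contDiff_const) hf)))

lemma contDiff_driftVec {F : Type*} [NormedAddCommGroup F] [NormedSpace ℝ F] {n : WithTop ℕ∞}
    (b : Vec d) (Q : Mat d) {f : F → Vec d} (hf : ContDiff ℝ n f) :
    ContDiff ℝ n (fun x => driftVec b Q (f x)) := by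
  have h : (fun x => driftVec b Q (f x)) =
      fun x => -(WithLp.toLp 2 (Q⁻¹ *ᵥ (f x - b).ofLp) : Vec d) := rfl
  rw [h]
  exact (contDiff_mulVec contDiff_const (hf.sub contDiff_const)).neg

lemma contDiff_flowField {n : WithTop ℕ∞} (b : Vec d) (Q : Mat d) :
    ContDiff ℝ n (flowField b Q) := by
  have hA : ContDiff ℝ n (fun z : Vec d × Mat d => driftMat b Q z.1 (z.2 * z.2ᵀ)) :=
    contDiff_driftMat b Q contDiff_fst (contDiff_snd.mul (contDiff_transpose.comp contDiff_snd))
  exact ((contDiff_mulVec hA contDiff_fst).add (contDiff_driftVec b Q contDiff_fst)).prodMk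
    (hA.mul contDiff_snd)

/-- A smooth curve in the space of invertible affine maps `x ↦ m t + E t x` which, for `t ≥ 0`, is
transported by the velocity field of the image of the standard Gaussian under these maps. -/
structure IsAffineFlow (b : Vec d) (Q : Mat d) (m : ℝ → Vec d) (E : ℝ → Mat d) : Prop where
  contDiff_mean : ContDiff ℝ ∞ m
  contDiff_factor : ContDiff ℝ ∞ E
  det_ne_zero : ∀ t, (E t).det ≠ 0
  hasDerivAt_mean : ∀ t, 0 ≤ t → HasDerivAt m
    (WithLp.toLp 2 (driftMat b Q (m t) (E t * (E t)ᵀ) *ᵥ (m t).ofLp) + driftVec b Q (m t)) t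
  hasDerivAt_factor : ∀ t, 0 ≤ t →
    HasDerivAt E (driftMat b Q (m t) (E t * (E t)ᵀ) * E t) t

/-- A matrix solution of a linear equation with bounded coefficients stays invertible: if `E t v = 0`,
then `s ↦ E s v vᵀ` solves the same equation and vanishes at `t`, hence at `0`. -/
lemma det_ne_zero_of_hasDerivAt {B E : ℝ → Mat d} {K : ℝ} (hB : ∀ t, ‖B t‖ ≤ K)
    (hE : ∀ t, HasDerivAt E (B t * E t) t) (h0 : (E 0).det ≠ 0) (t : ℝ) : (E t).det ≠ 0 := by
  intro ht
  obtain ⟨v, hv0, hv⟩ := Matrix.exists_mulVec_eq_zero_iff.2 ht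
  have hlip : ∀ s, LipschitzOnWith K.toNNReal (fun X : Mat d => B s * X) univ := fun s =>
    LipschitzOnWith.of_dist_le_mul fun X _ Y _ => by
      rw [dist_eq_norm, dist_eq_norm, ← mul_sub]
      refine (norm_mul_le _ _).trans ?_
      gcongr
      exact (hB s).trans (Real.le_coe_toNNReal K)
  have huniq : (fun s => E s * Matrix.vecMulVec v v) = fun _ => (0 : Mat d) := by
    refine ODE_solution_unique_univ (v := fun s X => B s * X) (s := fun _ => univ) (t₀ := t) hlip
      (fun s => ⟨?_, trivial⟩) (fun s => ⟨?_, trivial⟩) ?_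
    · have := (hE s).mul_const (Matrix.vecMulVec v v)
      rwa [mul_assoc] at this
    · simpa using hasDerivAt_const s (0 : Mat d)
    · change E t * Matrix.vecMulVec v v = 0
      rw [Matrix.mul_vecMulVec, hv, Matrix.zero_vecMulVec]
  have h := congrFun huniq 0
  simp only [Matrix.mul_vecMulVec] at h
  have h1 : E 0 *ᵥ v = 0 := by
    obtain ⟨j, hj⟩ := Function.ne_iff.1 hv0
    ext i
    have := congrFun (congrFun h i) j
    rw [Matrix.vecMulVec_apply] at this
    exact (mul_eq_zero.1 this).resolve_right hj
  exact h0 (Matrix.exists_mulVec_eq_zero_iff.1 ⟨v, hv0, h1⟩)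

lemma posDef_mul_transpose {E : Mat d} (hE : E.det ≠ 0) : (E * Eᵀ).PosDef := by
  rw [← Matrix.conjTranspose_eq_transpose_of_trivial]
  exact Matrix.PosDef.mul_conjTranspose_self _
    (Matrix.vecMul_injective_of_isUnit ((Matrix.isUnit_iff_isUnit_det _).2 hE.isUnit))

lemma transpose_mul_transpose_self (E : Mat d) : (E * Eᵀ)ᵀ = E * Eᵀ := by
  rw [Matrix.transpose_mul, Matrix.transpose_transpose]

lemma hasDerivWithinAt_mul_transpose {A : Mat d} {E : ℝ → Mat d} {κ t : ℝ} {s : Set ℝ}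
    (hE : HasDerivWithinAt E (κ • (A * E t)) s t) :
    HasDerivWithinAt (fun r => E r * (E r)ᵀ)
      (κ • (A * (E t * (E t)ᵀ) + E t * (E t)ᵀ * Aᵀ)) s t := by
  refine (hE.mul (hasDerivWithinAt_transpose hE)).congr_deriv ?_
  rw [Matrix.transpose_smul, Matrix.transpose_mul, Matrix.mul_smul, Matrix.smul_mul, smul_add]
  simp only [Matrix.mul_assoc]

/-- Global existence: the field is cut off outside a large ball, and the relative entropy, which
decreases along the solution, keeps the solution where the cut-off has no effect. -/
lemma exists_isAffineFlow (b : Vec d) {Q : Mat d} (hQ : Q.PosDef) (m₀ : Vec d) {E₀ : Mat d}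
    (hE₀ : E₀.det ≠ 0) :
    ∃ (m : ℝ → Vec d) (E : ℝ → Mat d), m 0 = m₀ ∧ E 0 = E₀ ∧ IsAffineFlow b Q m E := by
  obtain ⟨C, hC, hlow⟩ := exists_energy_lower b hQ
  set H₀ := energy b Q m₀ (E₀ * E₀ᵀ) with hH₀
  set R₁ := ‖b‖ + √(C * H₀) with hR₁
  set R₂ := √(‖Q‖ + √(C * (2 + √H₀) ^ 2 * H₀)) with hR₂
  have hR1' : 0 ≤ R₁ := by positivity
  have hR2' : 0 ≤ R₂ := by positivity
  let χ : ContDiffBump (0 : Vec d × Mat d) := ⟨R₁ + R₂ + 1, R₁ + R₂ + 2, by positivity, by linarith⟩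
  have hχs : ContDiff ℝ ∞ (χ : Vec d × Mat d → ℝ) := χ.contDiff
  have hF : ContDiff ℝ ∞ (fun z => χ z • flowField b Q z) := hχs.smul (contDiff_flowField b Q)
  have hFc : HasCompactSupport (fun z => χ z • flowField b Q z) := χ.hasCompactSupport.smul_right
  obtain ⟨K, hK⟩ := hF.lipschitzWith_of_hasCompactSupport hFc (by simp)
  obtain ⟨L, hL⟩ := hFc.exists_bound_of_continuous hF.continuous
  obtain ⟨z, hz0, hz⟩ := exists_global_solution (L := L.toNNReal) hK
    (fun x => (hL x).trans (Real.le_coe_toNNReal L)) (m₀, E₀)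
  have hzs : ContDiff ℝ ∞ z := contDiff_of_hasDerivAt hF hz
  set m : ℝ → Vec d := fun t => (z t).1 with hm
  set E : ℝ → Mat d := fun t => (z t).2 with hE
  set A : ℝ → Mat d := fun t => driftMat b Q (m t) (E t * (E t)ᵀ) with hA
  have hmd : ∀ t, HasDerivAt m (χ (z t) • (WithLp.toLp 2 (A t *ᵥ (m t).ofLp) + driftVec b Q (m t))) t :=
    fun t => (hasFDerivAt_fst (p := z t)).comp_hasDerivAt t (hz t)
  have hEd : ∀ t, HasDerivAt E (χ (z t) • (A t * E t)) t :=
    fun t => (hasFDerivAt_snd (p := z t)).comp_hasDerivAt t (hz t)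
  have hAs : ContDiff ℝ ∞ (fun z : Vec d × Mat d => driftMat b Q z.1 (z.2 * z.2ᵀ)) :=
    contDiff_driftMat b Q contDiff_fst (contDiff_snd.mul (contDiff_transpose.comp contDiff_snd))
  have hBc : HasCompactSupport
      (fun z : Vec d × Mat d => χ z • driftMat b Q z.1 (z.2 * z.2ᵀ)) :=
    χ.hasCompactSupport.smul_right
  obtain ⟨KB, hKB⟩ := hBc.exists_bound_of_continuous (hχs.smul hAs).continuous
  have hdet : ∀ t, (E t).det ≠ 0 := by
    refine det_ne_zero_of_hasDerivAt (B := fun t => χ (z t) • A t) (fun t => hKB (z t)) ?_ ?_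
    · intro t
      rw [Matrix.smul_mul]
      exact hEd t
    · simpa [hE, hz0] using hE₀
  have hen : ∀ t, HasDerivAt (fun r => energy b Q (m r) (E r * (E r)ᵀ))
      (-(2 * χ (z t) * dissipation b Q (m t) (E t * (E t)ᵀ))) t := fun t => by
    rw [← hasDerivWithinAt_univ]
    refine hasDerivWithinAt_energy b hQ (transpose_mul_transpose_self _)
      (posDef_mul_transpose (hdet t)).det_pos.ne' (hmd t).hasDerivWithinAt ?_
    exact hasDerivWithinAt_mul_transpose (hEd t).hasDerivWithinAt
  have hanti : Antitone (fun r => energy b Q (m r) (E r * (E r)ᵀ)) := by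
    refine antitone_of_hasDerivAt_nonpos hen fun t => ?_
    have := mul_nonneg (χ.nonneg (x := z t)) (dissipation_nonneg b Q (m t) (E t * (E t)ᵀ))
    simp only [Pi.zero_apply]
    linarith
  have hbound : ∀ t, 0 ≤ t → χ (z t) = 1 := by
    intro t ht
    have hHt : energy b Q (m t) (E t * (E t)ᵀ) ≤ H₀ := by
      have := hanti ht
      simpa [hm, hE, hz0] using this
    obtain ⟨h0, h1, h2⟩ := hlow (m t) _ (posDef_mul_transpose (hdet t))
    have hm1 : ‖m t‖ ≤ R₁ := by
      have : ‖m t - b‖ ≤ √(C * H₀) := by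
        refine Real.le_sqrt_of_sq_le (h1.trans ?_)
        gcongr
      calc ‖m t‖ = ‖b + (m t - b)‖ := by rw [add_sub_cancel]
        _ ≤ R₁ := (norm_add_le _ _).trans (by linarith)
    have hE1 : ‖E t‖ ≤ R₂ := by
      refine Real.le_sqrt_of_sq_le ?_
      have h3 : ‖E t * (E t)ᵀ - Q‖ ≤ √(C * (2 + √H₀) ^ 2 * H₀) := by
        refine Real.le_sqrt_of_sq_le (h2.trans ?_)
        gcongr
      have h4 : ‖E t‖ ^ 2 = ‖E t * (E t)ᵀ‖ := by
        rw [sq, ← CStarRing.norm_self_mul_star, Matrix.star_eq_conjTranspose,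
          Matrix.conjTranspose_eq_transpose_of_trivial]
      rw [h4]
      calc ‖E t * (E t)ᵀ‖ = ‖Q + (E t * (E t)ᵀ - Q)‖ := by rw [add_sub_cancel]
        _ ≤ _ := (norm_add_le _ _).trans (by linarith)
    refine χ.one_of_mem_closedBall ?_
    rw [mem_closedBall_zero_iff, Prod.norm_def]
    change max ‖m t‖ ‖E t‖ ≤ R₁ + R₂ + 1
    exact max_le (by linarith) (by linarith)
  refine ⟨m, E, by simp [hm, hz0], by simp [hE, hz0],
    ⟨contDiff_fst.comp hzs, contDiff_snd.comp hzs, hdet, fun t ht => ?_, fun t ht => ?_⟩⟩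
  · have := hmd t
    rwa [hbound t ht, one_smul] at this
  · have := hEd t
    rwa [hbound t ht, one_smul] at this

variable {b : Vec d} {Q : Mat d} {m : ℝ → Vec d} {E : ℝ → Mat d}

lemma IsAffineFlow.hasDerivWithinAt_cov (h : IsAffineFlow b Q m E) {t : ℝ} (ht : 0 ≤ t)
    (s : Set ℝ) :
    HasDerivWithinAt (fun r => E r * (E r)ᵀ) (driftMat b Q (m t) (E t * (E t)ᵀ) * (E t * (E t)ᵀ) +
      E t * (E t)ᵀ * (driftMat b Q (m t) (E t * (E t)ᵀ))ᵀ) s t := by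
  have h1 : HasDerivWithinAt E
      ((1 : ℝ) • (driftMat b Q (m t) (E t * (E t)ᵀ) * E t)) s t := by
    rw [one_smul]
    exact (h.hasDerivAt_factor t ht).hasDerivWithinAt
  have h2 := hasDerivWithinAt_mul_transpose h1
  rwa [one_smul] at h2

lemma IsAffineFlow.isODESolution (h : IsAffineFlow b Q m E) (hQ : Q.PosDef) :
    IsODESolution b Q (m 0) (E 0 * (E 0)ᵀ) m (fun t => E t * (E t)ᵀ) where
  mean_zero := rfl
  cov_zero := rfl
  mean_deriv t ht := by
    rw [meanField_eq]
    exact (h.hasDerivAt_mean t ht).hasDerivWithinAt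
  cov_deriv t ht := by
    rw [covField_eq b hQ _ (transpose_mul_transpose_self _)]
    exact h.hasDerivWithinAt_cov ht _

lemma isODESolution_unique {m₀ : Vec d} {S₀ : Mat d} {m m' : ℝ → Vec d} {S S' : ℝ → Mat d}
    (h : IsODESolution b Q m₀ S₀ m S) (h' : IsODESolution b Q m₀ S₀ m' S') :
    ∀ t, 0 ≤ t → m' t = m t ∧ S' t = S t := by
  have hF : ContDiff ℝ 1 (fun z : Vec d × Mat d => (meanField b Q z.1 z.2, covField b Q z.1 z.2)) := by
    refine ContDiff.prodMk ?_ ?_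
    · simp only [meanField_eq]
      exact (contDiff_mulVec (contDiff_driftMat b Q contDiff_fst contDiff_snd) contDiff_fst).add
        (contDiff_driftVec b Q contDiff_fst)
    · unfold covField
      have h1 : ContDiff ℝ 1 (fun z : Vec d × Mat d => Matrix.vecMulVec z.1.ofLp (z.1 - b).ofLp) :=
        contDiff_vecMulVec contDiff_fst (contDiff_fst.sub contDiff_const)
      have h2 : ContDiff ℝ 1 (fun z : Vec d × Mat d => Matrix.vecMulVec (z.1 - b).ofLp z.1.ofLp) :=
        contDiff_vecMulVec (contDiff_fst.sub contDiff_const) contDiff_fst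
      exact ((contDiff_snd.const_smul (2 : ℝ)).sub
        ((contDiff_snd.mul (contDiff_snd.add h1)).mul contDiff_const)).sub
        ((contDiff_const.mul (contDiff_snd.add h2)).mul contDiff_snd)
  intro t ht
  have := eq_of_hasDerivWithinAt hF (x := fun t => (m' t, S' t)) (y := fun t => (m t, S t))
    (fun t ht => (h'.mean_deriv t ht).prodMk (h'.cov_deriv t ht))
    (fun t ht => (h.mean_deriv t ht).prodMk (h.cov_deriv t ht))
    (by simp [h.mean_zero, h.cov_zero, h'.mean_zero, h'.cov_zero]) t ht
  exact Prod.mk.inj this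

end Flow

/-! ### Exponential convergence -/

section Convergence

variable {d : ℕ} {b : Vec d} {Q : Mat d} {m : ℝ → Vec d} {E : ℝ → Mat d}

/-- A Grönwall inequality for differential inequalities of decay. -/
lemma le_mul_exp_of_hasDerivWithinAt_le {f f' : ℝ → ℝ} {c T : ℝ}
    (hf : ∀ t, T ≤ t → HasDerivWithinAt f (f' t) (Ici T) t) (hle : ∀ t, T ≤ t → f' t ≤ -c * f t) :
    ∀ t, T ≤ t → f t ≤ f T * Real.exp (-c * (t - T)) := by
  have hg : ∀ t, T ≤ t → HasDerivWithinAt (fun s => f s * Real.exp (c * (s - T)))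
      (f' t * Real.exp (c * (t - T)) + f t * (Real.exp (c * (t - T)) * c)) (Ici T) t := by
    intro t ht
    refine (hf t ht).mul (HasDerivAt.hasDerivWithinAt ?_)
    simpa using (((hasDerivAt_id t).sub_const T).const_mul c).exp
  have hanti : AntitoneOn (fun s => f s * Real.exp (c * (s - T))) (Ici T) := by
    refine antitoneOn_of_hasDerivWithinAt_nonpos (convex_Ici T)
      (fun t ht => (hg t ht).continuousWithinAt)
      (fun t ht => (hg t (interior_subset ht)).mono interior_subset) fun t ht => ?_
    have h1 := hle t (interior_subset ht)
    have h2 := Real.exp_pos (c * (t - T))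
    nlinarith
  intro t ht
  have h := hanti (mem_Ici.2 le_rfl) ht ht
  simp only [sub_self, mul_zero, Real.exp_zero, mul_one] at h
  have h3 := mul_le_mul_of_nonneg_right h (Real.exp_pos (-c * (t - T))).le
  rwa [mul_assoc, ← Real.exp_add, show c * (t - T) + -c * (t - T) = 0 by ring, Real.exp_zero,
    mul_one] at h3

lemma IsAffineFlow.hasDerivWithinAt_energy (h : IsAffineFlow b Q m E) (hQ : Q.PosDef) {t : ℝ}
    (ht : 0 ≤ t) (s : Set ℝ) :
    HasDerivWithinAt (fun r => energy b Q (m r) (E r * (E r)ᵀ))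
      (-(2 * dissipation b Q (m t) (E t * (E t)ᵀ))) s t := by
  have := SVGD.hasDerivWithinAt_energy (κ := 1) (s := s) b hQ (m := m)
    (S := fun r => E r * (E r)ᵀ) (transpose_mul_transpose_self (E t))
    (posDef_mul_transpose (h.det_ne_zero t)).det_pos.ne'
    (by simpa using (h.hasDerivAt_mean t ht).hasDerivWithinAt)
    (by simpa using h.hasDerivWithinAt_cov ht s)
  simpa using this

/-- The entropy is nonincreasing, so it stays in a sublevel set, where the dissipation dominates it. -/
lemma IsAffineFlow.tendsto_energy (h : IsAffineFlow b Q m E) (hQ : Q.PosDef) :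
    Tendsto (fun t => energy b Q (m t) (E t * (E t)ᵀ)) atTop (𝓝 0) := by
  obtain ⟨C₀, hC₀, hlow⟩ := exists_energy_lower b hQ
  obtain ⟨C, hC, hdis⟩ := exists_energy_le_dissipation b hQ (energy b Q (m 0) (E 0 * (E 0)ᵀ))
  have hpd : ∀ t, (E t * (E t)ᵀ).PosDef := fun t => posDef_mul_transpose (h.det_ne_zero t)
  have hder : ∀ t : ℝ, 0 ≤ t → _ := fun t ht => h.hasDerivWithinAt_energy hQ ht (Ici 0)
  have hanti : ∀ t, 0 ≤ t → energy b Q (m t) (E t * (E t)ᵀ) ≤ energy b Q (m 0) (E 0 * (E 0)ᵀ) := by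
    intro t ht
    have := le_mul_exp_of_hasDerivWithinAt_le (c := 0) hder
      (fun t ht => by linarith [dissipation_nonneg b Q (m t) (E t * (E t)ᵀ)]) t ht
    simpa using this
  have hexp := le_mul_exp_of_hasDerivWithinAt_le (c := 2 / C) hder (fun t ht => by
    have := hdis (m t) _ (hpd t) (hanti t ht)
    have h2 : energy b Q (m t) (E t * (E t)ᵀ) / C ≤ dissipation b Q (m t) (E t * (E t)ᵀ) := by
      rwa [div_le_iff₀ hC, mul_comm]
    have h3 : -(2 / C) * energy b Q (m t) (E t * (E t)ᵀ) =
      -(2 * (energy b Q (m t) (E t * (E t)ᵀ) / C)) := by ring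
    rw [h3]; linarith)
  have hlim : Tendsto (fun t : ℝ => energy b Q (m 0) (E 0 * (E 0)ᵀ) * Real.exp (-(2 / C) * (t - 0)))
      atTop (𝓝 0) := by
    have hC2 : -(2 / C) < 0 := neg_neg_of_pos (by positivity)
    have h1 : Tendsto (fun t : ℝ => Real.exp (-(2 / C) * (t - 0))) atTop (𝓝 0) := by
      refine Real.tendsto_exp_atBot.comp ?_
      simp only [sub_zero]
      exact tendsto_id.const_mul_atTop_of_neg hC2
    have h2 := h1.const_mul (energy b Q (m 0) (E 0 * (E 0)ᵀ))
    rwa [mul_zero] at h2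
  refine tendsto_of_tendsto_of_tendsto_of_le_of_le' tendsto_const_nhds hlim
    (Eventually.of_forall fun t => (hlow _ _ (hpd t)).1) ?_
  filter_upwards [eventually_ge_atTop 0] with t ht using hexp t ht

/-- The relative entropy decays at the rate `4 (γ - ε)`, twice the rate of the parameters, in which
it is quadratic. -/
lemma IsAffineFlow.exists_energy_decay (h : IsAffineFlow b Q m E) (hQ : Q.PosDef) {γ : ℝ}
    (hγ0 : 0 < γ)
    (hγ : ∀ (X : Mat d) (u : Fin d → ℝ), γ * (frobSq X + 2 * (u ⬝ᵥ (Q⁻¹ *ᵥ u))) ≤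
      frobSq (X + Matrix.vecMulVec (Q⁻¹ *ᵥ u) b.ofLp) + (Q⁻¹ *ᵥ u) ⬝ᵥ (Q⁻¹ *ᵥ u))
    {ε : ℝ} (hε : 0 < ε) :
    ∃ K : ℝ, 0 ≤ K ∧ ∀ᶠ t in atTop,
      energy b Q (m t) (E t * (E t)ᵀ) ≤ K * Real.exp (-2 * (γ - ε) * t) ^ 2 := by
  obtain ⟨C₀, hC₀, hlow⟩ := exists_energy_lower b hQ
  have hpd : ∀ t, (E t * (E t)ᵀ).PosDef := fun t => posDef_mul_transpose (h.det_ne_zero t)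
  obtain ⟨η, hη, hη1, hηε⟩ : ∃ η : ℝ, 0 < η ∧ η ≤ 1 ∧ γ * (3 * η) ≤ ε := by
    refine ⟨min 1 (ε / (3 * γ)), by positivity, min_le_left _ _, ?_⟩
    have := mul_le_mul_of_nonneg_left (min_le_right 1 (ε / (3 * γ))) (by positivity : 0 ≤ 3 * γ)
    rw [mul_div_cancel₀ _ (by positivity)] at this
    linarith
  obtain ⟨h₀, hh₀, hnear⟩ := exists_energy_le_dissipation_near b hQ hγ0.le hγ hη hη1
  obtain ⟨T, hT⟩ := eventually_atTop.1 (((h.tendsto_energy hQ).eventually (eventually_le_nhds hh₀)).and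
    (eventually_ge_atTop 0))
  have hT0 : 0 ≤ T := (hT T le_rfl).2
  have hdec := le_mul_exp_of_hasDerivWithinAt_le (c := 4 * (γ - ε)) (T := T)
    (fun t ht => h.hasDerivWithinAt_energy hQ (hT0.trans ht) (Ici T)) (fun t ht => by
      have h1 := hnear (m t) _ (hpd t) (hT t ht).1
      have h2 := (hlow (m t) _ (hpd t)).1
      have h3 := dissipation_nonneg b Q (m t) (E t * (E t)ᵀ)
      generalize energy b Q (m t) (E t * (E t)ᵀ) = H at *
      generalize dissipation b Q (m t) (E t * (E t)ᵀ) = D at *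
      have h4 : (1 + η) ^ 2 ≤ 1 + 3 * η := by nlinarith
      have h5 : 2 * γ * H ≤ (1 + 3 * η) * D := h1.trans (mul_le_mul_of_nonneg_right h4 h3)
      -- as `1 - 3η ≤ 1 / (1 + 3η)`
      have h6 : 2 * (γ - ε) * H ≤ D := by
        rcases le_or_gt (γ - ε) 0 with h7 | h7
        · nlinarith
        · have h8 : (γ - ε) * (1 + 3 * η) ≤ γ := by nlinarith
          have h9 : (1 + 3 * η) * (2 * (γ - ε) * H) ≤ (1 + 3 * η) * D := by
            nlinarith
          exact le_of_mul_le_mul_left h9 (by positivity)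
      linarith)
  refine ⟨energy b Q (m T) (E T * (E T)ᵀ) * Real.exp (4 * (γ - ε) * T),
    mul_nonneg (hlow _ _ (hpd T)).1 (Real.exp_pos _).le, ?_⟩
  filter_upwards [eventually_ge_atTop T] with t ht
  refine (hdec t ht).trans (le_of_eq ?_)
  rw [mul_assoc, ← Real.exp_nat_mul, ← Real.exp_add]
  congr 2
  push_cast
  ring

/-- Both the mean and the covariance converge at the rate given by the least eigenvalue. -/
lemma IsAffineFlow.isBigO (h : IsAffineFlow b Q m E) (hQ : Q.PosDef) {γ : ℝ}
    (hγ0 : 0 < γ)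
    (hγ : ∀ (X : Mat d) (u : Fin d → ℝ), γ * (frobSq X + 2 * (u ⬝ᵥ (Q⁻¹ *ᵥ u))) ≤
      frobSq (X + Matrix.vecMulVec (Q⁻¹ *ᵥ u) b.ofLp) + (Q⁻¹ *ᵥ u) ⬝ᵥ (Q⁻¹ *ᵥ u))
    {ε : ℝ} (hε : 0 < ε) :
    ((fun t => m t - b) =O[atTop] fun t : ℝ => Real.exp (-2 * (γ - ε) * t)) ∧
      ((fun t => E t * (E t)ᵀ - Q) =O[atTop] fun t : ℝ => Real.exp (-2 * (γ - ε) * t)) := by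
  obtain ⟨C, hC, hlow⟩ := exists_energy_lower b hQ
  obtain ⟨K, hK, hdec⟩ := h.exists_energy_decay hQ hγ0 hγ hε
  have hpd : ∀ t, (E t * (E t)ᵀ).PosDef := fun t => posDef_mul_transpose (h.det_ne_zero t)
  have key : ∀ {C' : ℝ}, 0 ≤ C' → ∀ {t x : ℝ}, x ^ 2 ≤ C' * energy b Q (m t) (E t * (E t)ᵀ) →
      energy b Q (m t) (E t * (E t)ᵀ) ≤ K * Real.exp (-2 * (γ - ε) * t) ^ 2 →
      x ≤ √(C' * K) * ‖Real.exp (-2 * (γ - ε) * t)‖ := by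
    intro C' hC' t x hx ht
    rw [Real.norm_of_nonneg (Real.exp_pos _).le]
    refine le_of_sq_le_sq ?_ (by positivity)
    rw [mul_pow, Real.sq_sqrt (by positivity)]
    refine hx.trans ?_
    rw [mul_assoc]
    exact mul_le_mul_of_nonneg_left ht hC'
  constructor
  · refine IsBigO.of_bound (√(C * K)) ?_
    filter_upwards [hdec] with t ht
    exact key hC.le (hlow (m t) _ (hpd t)).2.1 ht
  · refine IsBigO.of_bound (√(C * (2 + 1) ^ 2 * K)) ?_
    filter_upwards [hdec, (h.tendsto_energy hQ).eventually (eventually_le_nhds one_pos)] with t ht ht1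
    obtain ⟨h0, -, h2⟩ := hlow (m t) _ (hpd t)
    refine key (by positivity) (h2.trans ?_) ht
    have : √(energy b Q (m t) (E t * (E t)ᵀ)) ≤ 1 := by
      rw [Real.sqrt_le_one]
      exact ht1
    gcongr

lemma IsAffineFlow.tendsto (h : IsAffineFlow b Q m E) (hQ : Q.PosDef) :
    Tendsto m atTop (𝓝 b) ∧ Tendsto (fun t => E t * (E t)ᵀ) atTop (𝓝 Q) := by
  obtain ⟨C, hC, hlow⟩ := exists_energy_lower b hQ
  have hpd : ∀ t, (E t * (E t)ᵀ).PosDef := fun t => posDef_mul_transpose (h.det_ne_zero t)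
  have hE := h.tendsto_energy hQ
  constructor
  · rw [tendsto_iff_norm_sub_tendsto_zero]
    have h1 : Tendsto (fun t => √(C * energy b Q (m t) (E t * (E t)ᵀ))) atTop (𝓝 0) := by
      simpa using (hE.const_mul C).sqrt
    exact squeeze_zero (fun t => norm_nonneg _)
      (fun t => Real.le_sqrt_of_sq_le (hlow _ _ (hpd t)).2.1) h1
  · rw [tendsto_iff_norm_sub_tendsto_zero]
    have h1 : Tendsto (fun t => √(C * (2 + √(energy b Q (m t) (E t * (E t)ᵀ))) ^ 2 *
        energy b Q (m t) (E t * (E t)ᵀ))) atTop (𝓝 0) := by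
      have := ((((hE.sqrt.const_add 2).pow 2).const_mul C).mul hE).sqrt
      simpa using this
    exact squeeze_zero (fun t => norm_nonneg _)
      (fun t => Real.le_sqrt_of_sq_le (hlow _ _ (hpd t)).2.2) h1

end Convergence

/-! ### Gaussian laws -/

section Gaussian

variable {d : ℕ}

lemma sqrt_two_pi_pow (d : ℕ) : ((√((2 * Real.pi) ^ d) : ℝ) : ℂ) =
    (Real.pi / (1 / 2 : ℂ)) ^ ((d : ℂ) / 2) := by
  have h1 : √((2 * Real.pi) ^ d) = (2 * Real.pi) ^ ((d : ℝ) / 2) := by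
    rw [Real.sqrt_eq_rpow, ← Real.rpow_natCast_mul (by positivity)]
    congr 1; ring
  rw [h1, Complex.ofReal_cpow (by positivity)]
  push_cast
  congr 1
  ring

lemma integrable_exp_neg_norm_sq :
    Integrable (fun v : Vec d => Real.exp (-(1 / 2) * ‖v‖ ^ 2)) := by
  by_contra h
  have h1 := GaussianFourier.integral_rexp_neg_mul_sq_norm (V := Vec d) (b := 1 / 2) (by norm_num)
  rw [integral_undef h] at h1
  have : 0 < (Real.pi / (1 / 2)) ^ ((Module.finrank ℝ (Vec d) : ℝ) / 2) := by positivity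
  linarith

/-- The density of the standard Gaussian. -/
lemma stdGaussian_eq_withDensity : stdGaussian (Vec d) = volume.withDensity
    (fun v => ENNReal.ofReal ((√((2 * Real.pi) ^ d))⁻¹ * Real.exp (-(1 / 2) * ‖v‖ ^ 2))) := by
  have hint : Integrable (fun v : Vec d => (√((2 * Real.pi) ^ d))⁻¹ *
      Real.exp (-(1 / 2) * ‖v‖ ^ 2)) := integrable_exp_neg_norm_sq.const_mul _
  have hfin : IsFiniteMeasure (volume.withDensity (fun v : Vec d =>
      ENNReal.ofReal ((√((2 * Real.pi) ^ d))⁻¹ * Real.exp (-(1 / 2) * ‖v‖ ^ 2)))) :=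
    isFiniteMeasure_withDensity_ofReal hint.2
  refine Measure.ext_of_charFun (funext fun t => ?_)
  rw [charFun_stdGaussian, charFun_apply, integral_withDensity_eq_integral_toReal_smul
    (Measurable.ennreal_ofReal (by fun_prop)) (Eventually.of_forall fun _ => ENNReal.ofReal_lt_top)]
  have h1 := GaussianFourier.integral_cexp_neg_mul_sq_norm_add_of_euclideanSpace
    (b := 1 / 2) (by norm_num) Complex.I t
  have h2 : ∀ v : Vec d, (ENNReal.ofReal ((√((2 * Real.pi) ^ d))⁻¹ *
      Real.exp (-(1 / 2) * ‖v‖ ^ 2))).toReal • Complex.exp (inner ℝ v t * Complex.I) =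
      ((√((2 * Real.pi) ^ d) : ℝ) : ℂ)⁻¹ *
        Complex.exp (-(1 / 2) * (‖v‖ : ℂ) ^ 2 + Complex.I * inner ℝ t v) := by
    intro v
    rw [ENNReal.toReal_ofReal (by positivity), Complex.real_smul, Complex.exp_add]
    push_cast
    rw [real_inner_comm, mul_comm Complex.I, mul_assoc]
  simp only [h2]
  rw [integral_const_mul, h1, Fintype.card_fin, sqrt_two_pi_pow, ← mul_assoc, inv_mul_cancel₀, one_mul]
  · congr 1
    rw [Complex.I_sq]; ring
  · rw [← sqrt_two_pi_pow]
    exact_mod_cast (Real.sqrt_pos.2 (by positivity)).ne'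

/-- The affine map `z ↦ m + E z`. -/
def affineImage (m : Vec d) (E : Mat d) (z : Vec d) : Vec d :=
  m + Matrix.toEuclideanCLM (𝕜 := ℝ) E z

lemma continuous_affineImage (m : Vec d) (E : Mat d) : Continuous (affineImage m E) :=
  continuous_const.add (Matrix.toEuclideanCLM (𝕜 := ℝ) E).continuous

/-- `N(m, E Eᵀ)` is the law of `m + E z` for a standard Gaussian `z`. -/
lemma multivariateGaussian_eq_map (m : Vec d) (E : Mat d) :
    multivariateGaussian m (E * Eᵀ) = (stdGaussian (Vec d)).map (affineImage m E) := by
  have hps : (E * Eᵀ).PosSemidef := by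
    rw [← Matrix.conjTranspose_eq_transpose_of_trivial]
    exact Matrix.posSemidef_self_mul_conjTranspose E
  have hmeas := (continuous_affineImage m E).measurable
  have : IsProbabilityMeasure ((stdGaussian (Vec d)).map (affineImage m E)) :=
    Measure.isProbabilityMeasure_map hmeas.aemeasurable
  refine Measure.ext_of_charFun (funext fun t => ?_)
  rw [charFun_multivariateGaussian hps, charFun_apply, integral_map hmeas.aemeasurable (by fun_prop)]
  have h1 : ∀ z, Complex.exp (inner ℝ (affineImage m E z) t * Complex.I) =
      Complex.exp (inner ℝ t m * Complex.I) *
        Complex.exp (inner ℝ z (Matrix.toEuclideanCLM (𝕜 := ℝ) Eᵀ t) * Complex.I) := by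
    intro z
    rw [← Complex.exp_add, affineImage, inner_add_left, real_inner_comm m t,
      real_inner_comm t (Matrix.toEuclideanCLM (𝕜 := ℝ) E z), Matrix.inner_toEuclideanCLM,
      Matrix.inner_toEuclideanCLM, Matrix.mulVec_transpose, ← dotProduct_comm (_ ᵥ* _),
      ← Matrix.dotProduct_mulVec]
    push_cast
    rw [add_mul]
  simp only [h1]
  rw [integral_const_mul, ← charFun_apply, charFun_stdGaussian, ← Complex.exp_add]
  congr 1
  rw [sub_eq_add_neg, neg_div]
  congr 3
  have : ‖Matrix.toEuclideanCLM (𝕜 := ℝ) Eᵀ t‖ ^ 2 = t.ofLp ⬝ᵥ ((E * Eᵀ) *ᵥ t.ofLp) := by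
    rw [norm_sq_vec, Matrix.ofLp_toEuclideanCLM, ← Matrix.mulVec_mulVec, Matrix.dotProduct_mulVec t.ofLp,
      Matrix.mulVec_transpose]
  exact_mod_cast this.symm

lemma det_toEuclideanCLM (E : Mat d) : (Matrix.toEuclideanCLM (𝕜 := ℝ) E).det = E.det := by
  rw [ContinuousLinearMap.det, Matrix.coe_toEuclideanCLM_eq_toEuclideanLin,
    Matrix.toEuclideanLin_eq_toLin_orthonormal, LinearMap.det_toLin]

/-- The change of variables `x = m + E z` turns the Gaussian density into the standard one. -/
lemma gaussianDensity_affineImage (m : Vec d) {E : Mat d} (hE : E.det ≠ 0) (z : Vec d) :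
    |E.det| * gaussianDensity m (E * Eᵀ) (affineImage m E z) =
      (√((2 * Real.pi) ^ d))⁻¹ * Real.exp (-(1 / 2) * ‖z‖ ^ 2) := by
  have hu : IsUnit E.det := hE.isUnit
  have hut : IsUnit Eᵀ.det := by rwa [Matrix.det_transpose]
  have h1 : √((2 * Real.pi) ^ d * (E * Eᵀ).det) = √((2 * Real.pi) ^ d) * |E.det| := by
    rw [Matrix.det_mul, Matrix.det_transpose, Real.sqrt_mul (by positivity), ← sq, Real.sqrt_sq_eq_abs]
  have h2 : (affineImage m E z - m).ofLp = E *ᵥ z.ofLp := by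
    rw [affineImage, add_sub_cancel_left, Matrix.ofLp_toEuclideanCLM]
  have h3 : (E *ᵥ z.ofLp) ⬝ᵥ ((E * Eᵀ)⁻¹ *ᵥ (E *ᵥ z.ofLp)) = ‖z‖ ^ 2 := by
    rw [norm_sq_vec, Matrix.mul_inv_rev, Matrix.mulVec_mulVec, Matrix.mul_assoc,
      Matrix.nonsing_inv_mul _ hu, Matrix.mul_one, ← Matrix.vecMul_transpose,
      ← Matrix.dotProduct_mulVec, Matrix.mulVec_mulVec, Matrix.mul_nonsing_inv _ hut,
      Matrix.one_mulVec]
  rw [gaussianDensity, h1, h2, h3, mul_inv, mul_comm (√((2 * Real.pi) ^ d))⁻¹, ← mul_assoc,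
    ← mul_assoc, mul_inv_cancel₀ (abs_ne_zero.2 hE), one_mul]

lemma continuous_gaussianDensity (m : Vec d) (S : Mat d) : Continuous (gaussianDensity m S) := by
  unfold gaussianDensity
  have : Continuous fun x : Vec d => (x - m).ofLp ⬝ᵥ (S⁻¹ *ᵥ (x - m).ofLp) := by
    refine Continuous.dotProduct (by fun_prop) (Continuous.matrix_mulVec continuous_const (by fun_prop))
  exact continuous_const.mul (Real.continuous_exp.comp (continuous_const.mul this))

lemma multivariateGaussian_eq_withDensity (m : Vec d) {S : Mat d} (hS : S.PosDef) :
    multivariateGaussian m S =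
      volume.withDensity (fun x => ENNReal.ofReal (gaussianDensity m S x)) := by
  obtain ⟨hEE, hEt, hEu⟩ := sqrt_spec hS
  set E := CFC.sqrt S with hE
  have hES : S = E * Eᵀ := by rw [hEt, hEE]
  have hmeas := (continuous_affineImage m E).measurable
  rw [hES, multivariateGaussian_eq_map]
  ext s hs
  have hs' : MeasurableSet (affineImage m E ⁻¹' s) := hmeas hs
  have hinj : Function.Injective (affineImage m E) := by
    intro x y hxy
    have h1 : E *ᵥ x.ofLp = E *ᵥ y.ofLp := by
      have := congrArg WithLp.ofLp (add_left_cancel hxy)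
      simpa using this
    have := Matrix.mulVec_injective_of_isUnit ((Matrix.isUnit_iff_isUnit_det _).2 hEu) h1
    exact (WithLp.equiv 2 _).injective this
  have hsurj : affineImage m E '' (affineImage m E ⁻¹' s) = s := by
    refine image_preimage_eq s fun x => ⟨WithLp.toLp 2 (E⁻¹ *ᵥ (x - m).ofLp), ?_⟩
    rw [affineImage, Matrix.toEuclideanCLM_toLp, Matrix.mulVec_mulVec, Matrix.mul_nonsing_inv _ hEu,
      Matrix.one_mulVec]
    simp
  rw [Measure.map_apply hmeas hs, stdGaussian_eq_withDensity, withDensity_apply _ hs',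
    withDensity_apply _ hs]
  nth_rw 2 [← hsurj]
  rw [lintegral_image_eq_lintegral_abs_det_fderiv_mul volume (f := affineImage m E) hs'
    (f' := fun _ => Matrix.toEuclideanCLM (𝕜 := ℝ) E)
    (fun x _ => ((Matrix.toEuclideanCLM (𝕜 := ℝ) E).hasFDerivAt.const_add m).hasFDerivWithinAt)
    hinj.injOn]
  refine lintegral_congr fun z => ?_
  rw [det_toEuclideanCLM, ← ENNReal.ofReal_mul (abs_nonneg _),
    gaussianDensity_affineImage m hEu.ne_zero]

lemma gaussianDensity_nonneg (m : Vec d) (S : Mat d) (x : Vec d) : 0 ≤ gaussianDensity m S x := by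
  unfold gaussianDensity; positivity

/-- Integrals against the Gaussian density are integrals against the Gaussian law. -/
lemma integral_gaussianDensity_smul {F : Type*} [NormedAddCommGroup F] [NormedSpace ℝ F]
    (m : Vec d) {S : Mat d} (hS : S.PosDef) (f : Vec d → F) :
    ∫ x, gaussianDensity m S x • f x = ∫ x, f x ∂(multivariateGaussian m S) := by
  rw [multivariateGaussian_eq_withDensity m hS, integral_withDensity_eq_integral_toReal_smul
    (continuous_gaussianDensity m S).measurable.ennreal_ofReal
    (Eventually.of_forall fun _ => ENNReal.ofReal_lt_top)]
  simp only [ENNReal.toReal_ofReal (gaussianDensity_nonneg m S _)]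

lemma integrable_gaussianDensity_smul {F : Type*} [NormedAddCommGroup F] [NormedSpace ℝ F]
    (m : Vec d) {S : Mat d} (hS : S.PosDef) {f : Vec d → F}
    (hf : Integrable f (multivariateGaussian m S)) :
    Integrable fun x => gaussianDensity m S x • f x := by
  rw [multivariateGaussian_eq_withDensity m hS, integrable_withDensity_iff_integrable_smul'
    (continuous_gaussianDensity m S).measurable.ennreal_ofReal
    (Eventually.of_forall fun _ => ENNReal.ofReal_lt_top)] at hf
  simpa only [ENNReal.toReal_ofReal (gaussianDensity_nonneg m S _)] using hf

lemma coe_gaussianLaw (m : Vec d) (S : Mat d) :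
    (gaussianLaw m S : Measure (Vec d)) = multivariateGaussian m S := rfl

lemma continuous_gaussian_charFun (t : Vec d) : Continuous fun p : Vec d × Mat d =>
    Complex.exp (inner ℝ t p.1 * Complex.I - (t.ofLp ⬝ᵥ (p.2 *ᵥ t.ofLp) : ℝ) / 2) := by
  have h1 : Continuous fun p : Vec d × Mat d => t.ofLp ⬝ᵥ (p.2 *ᵥ t.ofLp) :=
    continuous_const.dotProduct (Continuous.matrix_mulVec continuous_snd continuous_const)
  have h2 : Continuous fun p : Vec d × Mat d => (inner ℝ t p.1 : ℝ) :=
    continuous_const.inner continuous_fst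
  exact Complex.continuous_exp.comp (((Complex.continuous_ofReal.comp h2).mul continuous_const).sub
    ((Complex.continuous_ofReal.comp h1).div_const 2))

/-- Convergence of the parameters implies weak convergence of the Gaussian laws. -/
lemma tendsto_gaussianLaw {ι : Type*} {l : Filter ι} [l.IsCountablyGenerated] {m : ι → Vec d}
    {S : ι → Mat d} {m₀ : Vec d} {S₀ : Mat d} (hS : ∀ᶠ i in l, (S i).PosSemidef)
    (hS₀ : S₀.PosSemidef) (hm : Tendsto m l (𝓝 m₀)) (hST : Tendsto S l (𝓝 S₀)) :
    Tendsto (fun i => gaussianLaw (m i) (S i)) l (𝓝 (gaussianLaw m₀ S₀)) := by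
  refine tendsto_of_seq_tendsto fun u hu => ?_
  rw [ProbabilityMeasure.tendsto_iff_tendsto_charFun]
  intro t
  have hlim := ((continuous_gaussian_charFun t).tendsto (m₀, S₀)).comp
    ((hm.comp hu).prodMk_nhds (hST.comp hu))
  rw [coe_gaussianLaw, charFun_multivariateGaussian hS₀ t]
  refine hlim.congr' ?_
  filter_upwards [hu.eventually hS] with n hn
  simp only [Function.comp_apply]
  rw [coe_gaussianLaw, charFun_multivariateGaussian hn t]

end Gaussian

/-! ### The velocity field -/

section Velocity

variable {d : ℕ}

lemma hasGradientAt_quadForm (a : Vec d) {P : Mat d} (hP : Pᵀ = P) (x : Vec d) :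
    HasGradientAt (fun y : Vec d => (y - a).ofLp ⬝ᵥ (P *ᵥ (y - a).ofLp))
      ((2 : ℝ) • Matrix.toEuclideanCLM (𝕜 := ℝ) P (x - a)) x := by
  rw [hasGradientAt_iff_hasFDerivAt]
  have h1 : HasFDerivAt (fun y : Vec d => y - a) (ContinuousLinearMap.id ℝ (Vec d)) x :=
    (hasFDerivAt_id x).sub_const a
  have h2 : HasFDerivAt (fun y : Vec d => Matrix.toEuclideanCLM (𝕜 := ℝ) P (y - a))
      (Matrix.toEuclideanCLM (𝕜 := ℝ) P) x := by
    have := (Matrix.toEuclideanCLM (𝕜 := ℝ) P).hasFDerivAt.comp x h1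
    rwa [ContinuousLinearMap.comp_id] at this
  have h3 := h1.inner ℝ h2
  simp only [Matrix.inner_toEuclideanCLM] at h3
  refine h3.congr_fderiv ?_
  ext v
  simp only [ContinuousLinearMap.comp_apply, ContinuousLinearMap.prod_apply,
    fderivInnerCLM_apply, ContinuousLinearMap.id_apply, InnerProductSpace.toDual_apply_apply,
    inner_smul_left, Matrix.inner_toEuclideanCLM]
  rw [real_inner_comm, Matrix.inner_toEuclideanCLM, Matrix.dotProduct_mulVec,
    ← Matrix.mulVec_transpose, hP, dotProduct_comm]
  simp
  ring

lemma hasGradientAt_gaussianPotential (b : Vec d) {Q : Mat d} (hQ : Q.PosDef) (x : Vec d) :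
    HasGradientAt (gaussianPotential b Q) (Matrix.toEuclideanCLM (𝕜 := ℝ) Q⁻¹ (x - b)) x := by
  have hpos : 0 < (√((2 * Real.pi) ^ d * Q.det))⁻¹ := by
    have := hQ.det_pos
    positivity
  have h1 : gaussianPotential b Q = fun y => -Real.log (√((2 * Real.pi) ^ d * Q.det))⁻¹ +
      1 / 2 * ((y - b).ofLp ⬝ᵥ (Q⁻¹ *ᵥ (y - b).ofLp)) := by
    funext y
    rw [gaussianPotential, gaussianDensity, Real.log_mul hpos.ne' (Real.exp_pos _).ne', Real.log_exp]
    ring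
  rw [h1]
  have h2 := hasGradientAt_quadForm b (transpose_inv_of_posDef hQ) x
  rw [hasGradientAt_iff_hasFDerivAt] at h2 ⊢
  refine ((h2.const_mul (1 / 2)).const_add _).congr_fderiv ?_
  rw [map_smul, smul_smul]
  norm_num

lemma hasGradientAt_gaussianDensity (m : Vec d) {S : Mat d} (hS : S.PosDef) (x : Vec d) :
    HasGradientAt (gaussianDensity m S)
      (gaussianDensity m S x • -(Matrix.toEuclideanCLM (𝕜 := ℝ) S⁻¹ (x - m))) x := by
  have h2 := hasGradientAt_quadForm m (transpose_inv_of_posDef hS) x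
  rw [hasGradientAt_iff_hasFDerivAt] at h2 ⊢
  refine (((h2.const_mul (-(1 / 2))).exp).const_mul _).congr_fderiv ?_
  rw [gaussianDensity, map_smul, map_smul, map_neg, smul_smul, smul_smul, smul_smul, smul_neg, ← neg_smul]
  congr 1
  ring

lemma hasGradientAt_bilinearKernel (x y : Vec d) :
    HasGradientAt (fun z => bilinearKernel x z) x y := by
  rw [hasGradientAt_iff_hasFDerivAt]
  exact ((InnerProductSpace.toDual ℝ (Vec d) x).hasFDerivAt).add_const 1

/-- The mean of a measure. -/
def meanVec (μ : Measure (Vec d)) : Vec d := WithLp.toLp 2 fun i => ∫ y, y i ∂μ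

/-- The covariance matrix of a probability measure. -/
def covMat (μ : Measure (Vec d)) : Mat d :=
  Matrix.of fun i j => ∫ y, y i * y j ∂μ - (∫ y, y i ∂μ) * ∫ y, y j ∂μ

variable {μ : Measure (Vec d)}

lemma integrable_coord_mul (h2 : Integrable (fun y : Vec d => ‖y‖ ^ 2) μ) (i j : Fin d) :
    Integrable (fun y : Vec d => y i * y j) μ := by
  refine h2.mono' (by fun_prop) (Eventually.of_forall fun y => ?_)
  rw [norm_mul, sq]
  exact mul_le_mul (PiLp.norm_apply_le y i) (PiLp.norm_apply_le y j) (norm_nonneg _) (norm_nonneg _)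

lemma integrable_coord [IsProbabilityMeasure μ] (h2 : Integrable (fun y : Vec d => ‖y‖ ^ 2) μ)
    (i : Fin d) : Integrable (fun y : Vec d => y i) μ := by
  refine (h2.add (integrable_const (1 : ℝ))).mono' (by fun_prop) (Eventually.of_forall fun y => ?_)
  have := PiLp.norm_apply_le y i
  simp only [Pi.add_apply]
  nlinarith [sq_nonneg (‖y‖ - 1), norm_nonneg (y i)]

lemma integral_kernel_smul_sub [IsProbabilityMeasure μ]
    (h2 : Integrable (fun y : Vec d => ‖y‖ ^ 2) μ) (a x : Vec d) :
    Integrable (fun y => bilinearKernel x y • (y - a)) μ ∧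
    ∫ y, bilinearKernel x y • (y - a) ∂μ = affineImage (meanVec μ - a)
      (covMat μ + Matrix.vecMulVec (meanVec μ - a).ofLp (meanVec μ).ofLp) x := by
  have hcomp : ∀ i, (fun y : Vec d => (bilinearKernel x y • (y - a)) i) =
      fun y => (∑ k, x k * (y i * y k - a i * y k)) + (y i - a i) := by
    intro i
    funext y
    simp only [bilinearKernel, PiLp.smul_apply, PiLp.sub_apply, smul_eq_mul, PiLp.inner_apply,
      RCLike.inner_apply, conj_trivial, add_mul, one_mul, Finset.sum_mul]
    congr 1
    exact Finset.sum_congr rfl fun k _ => by ring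
  have hi1 : ∀ i k, Integrable (fun y : Vec d => x k * (y i * y k - a i * y k)) μ := fun i k =>
    ((integrable_coord_mul h2 i k).sub ((integrable_coord h2 k).const_mul _)).const_mul _
  have hi2 : ∀ i, Integrable (fun y : Vec d => y i - a i) μ := fun i =>
    (integrable_coord h2 i).sub (integrable_const _)
  have hint : ∀ i, Integrable (fun y : Vec d => (bilinearKernel x y • (y - a)) i) μ := by
    intro i
    rw [hcomp]
    exact (integrable_finsetSum _ fun k _ => hi1 i k).add (hi2 i)
  refine ⟨Integrable.of_eval_piLp hint, ?_⟩
  ext i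
  rw [eval_integral_piLp hint, hcomp, integral_add (integrable_finsetSum _ fun k _ => hi1 i k) (hi2 i),
    integral_finsetSum _ fun k _ => hi1 i k, integral_sub (integrable_coord h2 i) (integrable_const _)]
  simp only [integral_const_mul]
  have h3 : ∀ k, ∫ y : Vec d, (y i * y k - a i * y k) ∂μ =
      ∫ y : Vec d, y i * y k ∂μ - a i * ∫ y : Vec d, y k ∂μ := fun k => by
    rw [integral_sub (integrable_coord_mul h2 i k) ((integrable_coord h2 k).const_mul _),
      integral_const_mul]
  simp only [h3, affineImage, PiLp.add_apply, PiLp.sub_apply, Matrix.ofLp_toEuclideanCLM,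
    Matrix.mulVec, dotProduct, Matrix.add_apply, Matrix.vecMulVec_apply, covMat, meanVec,
    Matrix.of_apply, integral_const, probReal_univ, one_smul]
  rw [add_comm]
  congr 1
  exact Finset.sum_congr rfl fun k _ => by ring

/-- The velocity field of the bilinear kernel is affine, and is determined by the first two moments
of the measure. -/
lemma velocity_eq [IsProbabilityMeasure μ] (h2 : Integrable (fun y : Vec d => ‖y‖ ^ 2) μ)
    (b : Vec d) {Q : Mat d} (hQ : Q.PosDef) (x : Vec d) :
    velocity bilinearKernel (gaussianPotential b Q) μ x =
      affineImage (driftVec b Q (meanVec μ)) (driftMat b Q (meanVec μ) (covMat μ)) x := by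
  obtain ⟨hint, hval⟩ := integral_kernel_smul_sub h2 b x
  have h1 : ∀ y, gradient (fun z => bilinearKernel x z) y -
      bilinearKernel x y • gradient (gaussianPotential b Q) y =
      x - Matrix.toEuclideanCLM (𝕜 := ℝ) Q⁻¹ (bilinearKernel x y • (y - b)) := by
    intro y
    rw [(hasGradientAt_bilinearKernel x y).gradient,
      (hasGradientAt_gaussianPotential b hQ y).gradient, map_smul]
  simp only [velocity, h1]
  rw [integral_sub (integrable_const _) (ContinuousLinearMap.integrable_comp _ hint),
    ContinuousLinearMap.integral_comp_comm _ hint, hval, integral_const, probReal_univ, one_smul,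
    affineImage, affineImage, map_add (Matrix.toEuclideanCLM (𝕜 := ℝ) Q⁻¹) (meanVec μ - b)]
  ext i
  simp only [driftVec, driftMat, PiLp.sub_apply, PiLp.add_apply,
    Matrix.ofLp_toEuclideanCLM, Matrix.mulVec_mulVec, Matrix.sub_mulVec, Matrix.one_mulVec,
    Pi.sub_apply, Pi.neg_apply]
  ring

section GaussianMoments

variable (m : Vec d) {S : Mat d}

lemma integrable_norm_sq_gaussian (S : Mat d) :
    Integrable (fun y : Vec d => ‖y‖ ^ 2) (multivariateGaussian m S) :=
  (IsGaussian.memLp_two_id (μ := multivariateGaussian m S)).integrable_norm_pow two_ne_zero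

lemma meanVec_gaussian (S : Mat d) : meanVec (multivariateGaussian m S) = m := by
  have h := integral_id_multivariateGaussian (μ := m) (S := S)
  ext i
  rw [meanVec]
  simp only
  rw [← eval_integral_piLp (fun i => integrable_coord (integrable_norm_sq_gaussian m S) i), h]

lemma covMat_gaussian (hS : S.PosSemidef) : covMat (multivariateGaussian m S) = S := by
  have hL : ∀ i, MemLp (fun y : Vec d => y i) 2 (multivariateGaussian m S) := fun i =>
    (memLp_two_iff_integrable_sq (by fun_prop)).2 (by
      simpa only [sq] using integrable_coord_mul (integrable_norm_sq_gaussian m S) i i)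
  ext i j
  rw [← covariance_eval_multivariateGaussian (μ := m) hS i j, covariance_eq_sub (hL i) (hL j)]
  rfl

end GaussianMoments

end Velocity

/-! ### The Gaussian curve is a classical solution -/

section Classical

variable {d : ℕ}

lemma contDiff_gaussianDensity {n : WithTop ℕ∞} (m : Vec d) (S : Mat d) :
    ContDiff ℝ n (gaussianDensity m S) := by
  have h : ContDiff ℝ n fun x : Vec d => (x - m).ofLp ⬝ᵥ (S⁻¹ *ᵥ (x - m).ofLp) := by
    simp only [← Matrix.inner_toEuclideanCLM]
    have h1 : ContDiff ℝ n fun x : Vec d => x - m := contDiff_id.sub contDiff_const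
    exact h1.inner ℝ ((Matrix.toEuclideanCLM (𝕜 := ℝ) S⁻¹).contDiff.comp h1)
  exact contDiff_const.mul (Real.contDiff_exp.comp (contDiff_const.mul h))

lemma integrable_gaussianDensity (m : Vec d) {S : Mat d} (hS : S.PosDef) :
    Integrable (gaussianDensity m S) := by
  simpa using integrable_gaussianDensity_smul m hS (integrable_const (1 : ℝ))

lemma integral_gaussianDensity (m : Vec d) {S : Mat d} (hS : S.PosDef) :
    ∫ x, gaussianDensity m S x = 1 := by
  simpa using integral_gaussianDensity_smul m hS (fun _ => (1 : ℝ))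

lemma flux_integrand_eq (b m : Vec d) {Q S : Mat d} (hQ : Q.PosDef) (hS : S.PosDef) (x : Vec d) :
    (fun y => bilinearKernel x y • (gradient (gaussianDensity m S) y +
      gaussianDensity m S y • gradient (gaussianPotential b Q) y)) =
    fun y => gaussianDensity m S y •
      (Matrix.toEuclideanCLM (𝕜 := ℝ) Q⁻¹ (bilinearKernel x y • (y - b)) -
        Matrix.toEuclideanCLM (𝕜 := ℝ) S⁻¹ (bilinearKernel x y • (y - m))) := by
  funext y
  rw [(hasGradientAt_gaussianDensity m hS y).gradient,
    (hasGradientAt_gaussianPotential b hQ y).gradient, map_smul, map_smul]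
  module

lemma integrable_flux_integrand (b m : Vec d) {Q S : Mat d} (hQ : Q.PosDef) (hS : S.PosDef)
    (x : Vec d) :
    Integrable fun y => bilinearKernel x y • (gradient (gaussianDensity m S) y +
      gaussianDensity m S y • gradient (gaussianPotential b Q) y) := by
  have h2 := integrable_norm_sq_gaussian m S
  rw [flux_integrand_eq b m hQ hS]
  exact integrable_gaussianDensity_smul m hS
    ((ContinuousLinearMap.integrable_comp _ (integral_kernel_smul_sub h2 b x).1).sub
      (ContinuousLinearMap.integrable_comp _ (integral_kernel_smul_sub h2 m x).1))

/-- The flux of a Gaussian density is that of its velocity field. -/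
lemma flux_gaussianDensity (b m : Vec d) {Q S : Mat d} (hQ : Q.PosDef) (hS : S.PosDef) :
    flux bilinearKernel (gaussianPotential b Q) (gaussianDensity m S) = fun x =>
      -(gaussianDensity m S x • affineImage (driftVec b Q m) (driftMat b Q m S) x) := by
  funext x
  have h2 := integrable_norm_sq_gaussian m S
  obtain ⟨i1, v1⟩ := integral_kernel_smul_sub h2 b x
  obtain ⟨i2, v2⟩ := integral_kernel_smul_sub h2 m x
  rw [flux, flux_integrand_eq b m hQ hS, integral_gaussianDensity_smul m hS,
    integral_sub (ContinuousLinearMap.integrable_comp _ i1) (ContinuousLinearMap.integrable_comp _ i2),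
    ContinuousLinearMap.integral_comp_comm _ i1, ContinuousLinearMap.integral_comp_comm _ i2, v1, v2,
    meanVec_gaussian, covMat_gaussian m hS.posSemidef, ← smul_neg]
  congr 1
  rw [affineImage, affineImage, affineImage, sub_self,
    map_add (Matrix.toEuclideanCLM (𝕜 := ℝ) Q⁻¹) (m - b)]
  ext i
  simp only [driftVec, driftMat, PiLp.sub_apply, PiLp.add_apply, PiLp.neg_apply,
    Matrix.ofLp_toEuclideanCLM, Matrix.mulVec_mulVec, Matrix.sub_mulVec, Matrix.one_mulVec,
    Pi.sub_apply, Pi.neg_apply, zero_add, WithLp.ofLp_zero, Matrix.zero_vecMulVec, add_zero,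
    Matrix.nonsing_inv_mul _ hS.det_pos.ne'.isUnit]
  ring

lemma hasFDerivAt_affineImage (c : Vec d) (A : Mat d) (x : Vec d) :
    HasFDerivAt (affineImage c A) (Matrix.toEuclideanCLM (𝕜 := ℝ) A) x :=
  (Matrix.toEuclideanCLM (𝕜 := ℝ) A).hasFDerivAt.const_add c

/-- The divergence of `x ↦ -ρ(x) (A x + c)` for a Gaussian density `ρ`. -/
lemma divergence_gaussianDensity_smul (m c : Vec d) {S : Mat d} (A : Mat d) (hS : S.PosDef)
    (x : Vec d) :
    divergence (fun x => -(gaussianDensity m S x • affineImage c A x)) x =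
      gaussianDensity m S x * ((S⁻¹ *ᵥ (x - m).ofLp) ⬝ᵥ (affineImage c A x).ofLp - A.trace) := by
  have h1 := hasGradientAt_gaussianDensity m hS x
  rw [hasGradientAt_iff_hasFDerivAt] at h1
  have h2 : HasFDerivAt (fun x => -(gaussianDensity m S x • affineImage c A x)) _ x :=
    (h1.smul (hasFDerivAt_affineImage c A x)).neg
  rw [divergence, h2.fderiv]
  simp only [neg_apply, add_apply, smul_apply, ContinuousLinearMap.smulRight_apply,
    InnerProductSpace.toDual_apply_apply, PiLp.neg_apply, PiLp.add_apply, PiLp.smul_apply,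
    Matrix.ofLp_toEuclideanCLM, smul_eq_mul,
    EuclideanSpace.inner_single_right, dotProduct, Matrix.trace, Matrix.diag, mul_sub,
    Finset.mul_sum, ← Finset.sum_sub_distrib]
  refine Finset.sum_congr rfl fun i _ => ?_
  have h3 : (A *ᵥ (EuclideanSpace.single i (1 : ℝ)).ofLp) i = A i i := by
    simp
  rw [h3]
  simp
  ring

/-- The derivative of the matrix inverse. -/
lemma hasDerivWithinAt_inv {S : ℝ → Mat d} {S' : Mat d} {s : Set ℝ} {t : ℝ}
    (hS : HasDerivWithinAt S S' s t) (h0 : IsUnit (S t).det) :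
    HasDerivWithinAt (fun r => (S r)⁻¹) (-((S t)⁻¹ * S' * (S t)⁻¹)) s t := by
  obtain ⟨u, hu⟩ := (Matrix.isUnit_iff_isUnit_det _).2 h0
  have h1 := hasFDerivAt_ringInverse (𝕜 := ℝ) u
  rw [hu] at h1
  have h2 := h1.comp_hasDerivWithinAt t hS
  have h3 : ((u⁻¹ : (Mat d)ˣ) : Mat d) = (S t)⁻¹ := by rw [← hu, Matrix.coe_units_inv]
  simp only [h3] at h2
  refine (h2.congr_deriv ?_).congr_of_eventuallyEq ?_ ?_
  · simp [mul_assoc]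
  · exact Eventually.of_forall fun r => Matrix.nonsing_inv_eq_ringInverse _
  · exact Matrix.nonsing_inv_eq_ringInverse _

/-- The time derivative of a Gaussian density whose parameters are transported by the affine vector
field `x ↦ A x + c`. -/
lemma hasDerivWithinAt_gaussianDensity {m : ℝ → Vec d} {S : ℝ → Mat d} {A : Mat d} {c : Vec d}
    {t : ℝ} {s : Set ℝ} (hS : (S t).PosDef)
    (hm : HasDerivWithinAt m (affineImage c A (m t)) s t)
    (hSd : HasDerivWithinAt S (A * S t + S t * Aᵀ) s t) (x : Vec d) :
    HasDerivWithinAt (fun r => gaussianDensity (m r) (S r) x)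
      (gaussianDensity (m t) (S t) x *
        (((S t)⁻¹ *ᵥ (x - m t).ofLp) ⬝ᵥ (affineImage c A x).ofLp - A.trace)) s t := by
  have hdet := hS.det_pos
  have hu : IsUnit (S t).det := hdet.ne'.isUnit
  have hSt := transpose_inv_of_posDef hS
  set u : Vec d := x - m t with hux
  set w := (S t)⁻¹ *ᵥ u.ofLp with hw
  have hSw : S t *ᵥ w = u.ofLp := by
    rw [hw, Matrix.mulVec_mulVec, Matrix.mul_nonsing_inv _ hu, Matrix.one_mulVec]
  have hpos : 0 < (2 * Real.pi) ^ d * (S t).det := by positivity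
  have h1 := (((hasDerivWithinAt_det hSd hdet.ne').const_mul ((2 * Real.pi) ^ d)).sqrt hpos.ne').inv
    (Real.sqrt_pos.2 hpos).ne'
  have htr : ((S t)⁻¹ * (A * S t + S t * Aᵀ)).trace = 2 * A.trace := by
    rw [Matrix.mul_add, Matrix.trace_add, Matrix.nonsing_inv_mul_cancel_left _ _ hu,
      Matrix.trace_transpose, ← Matrix.mul_assoc, Matrix.trace_mul_comm,
      Matrix.mul_nonsing_inv_cancel_left _ _ hu]
    ring
  have hm' : HasDerivWithinAt (fun r => x - m r) (-affineImage c A (m t)) s t := hm.const_sub x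
  have h2 := hasDerivWithinAt_dotProduct hm'
    (hasDerivWithinAt_mulVec (hasDerivWithinAt_inv hSd hu) hm')
  have h3 := h1.mul ((h2.const_mul (-(1 / 2))).exp)
  refine h3.congr_deriv ?_
  rw [htr]
  simp only [← hux]
  have e1 : ∀ v : Fin d → ℝ, u.ofLp ⬝ᵥ ((S t)⁻¹ *ᵥ v) = w ⬝ᵥ v := fun v => by
    rw [Matrix.dotProduct_mulVec, ← Matrix.mulVec_transpose, hSt]
  have e2 : w ⬝ᵥ ((A * S t + S t * Aᵀ) *ᵥ w) = 2 * (w ⬝ᵥ (A *ᵥ u.ofLp)) := by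
    rw [Matrix.add_mulVec, dotProduct_add, ← Matrix.mulVec_mulVec, hSw, ← Matrix.mulVec_mulVec,
      Matrix.dotProduct_mulVec w (S t), ← Matrix.mulVec_transpose, transpose_of_posDef hS, hSw,
      Matrix.mulVec_transpose, ← dotProduct_comm (w ᵥ* A), ← Matrix.dotProduct_mulVec]
    ring
  have e3 : (affineImage c A x).ofLp = (affineImage c A (m t)).ofLp + A *ᵥ u.ofLp := by
    rw [affineImage, affineImage, hux]
    ext i
    simp only [PiLp.add_apply, Pi.add_apply, Matrix.ofLp_toEuclideanCLM, WithLp.ofLp_sub,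
      Matrix.mulVec_sub, Pi.sub_apply]
    ring
  have e4 : -((S t)⁻¹ * (A * S t + S t * Aᵀ) * (S t)⁻¹) *ᵥ u.ofLp =
      -((S t)⁻¹ *ᵥ ((A * S t + S t * Aᵀ) *ᵥ w)) := by
    rw [Matrix.neg_mulVec, ← Matrix.mulVec_mulVec, ← Matrix.mulVec_mulVec]
  rw [gaussianDensity]
  simp only [Pi.inv_apply, ← hux, e4, WithLp.ofLp_neg, neg_dotProduct, dotProduct_neg, Matrix.mulVec_neg,
    dotProduct_add, e1, e2, e3]
  rw [dotProduct_comm ((affineImage c A (m t)).ofLp) ((S t)⁻¹ *ᵥ u.ofLp), ← hw]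
  have hs := Real.sq_sqrt hpos.le
  have hs0 := (Real.sqrt_pos.2 hpos).ne'
  set σ := √((2 * Real.pi) ^ d * (S t).det) with hσ
  have e5 : -((2 * Real.pi) ^ d * ((S t).det * (2 * A.trace)) / (2 * σ)) / σ ^ 2 =
      -(σ⁻¹ * A.trace) := by
    have : (2 * Real.pi) ^ d * ((S t).det * (2 * A.trace)) = σ ^ 2 * (2 * A.trace) := by
      rw [hs]; ring
    rw [this]
    field_simp
  rw [e5]
  ring

variable {b : Vec d} {Q : Mat d} {m : ℝ → Vec d} {E : ℝ → Mat d}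

/-- Both sides of the equation are `-(div (A x + c) + ⟪A x + c, ∇ log ρ⟫) ρ`. -/
lemma IsAffineFlow.isClassicalSolution (h : IsAffineFlow b Q m E) (hQ : Q.PosDef) :
    IsClassicalSolution bilinearKernel (gaussianPotential b Q)
      (gaussianDensity (m 0) (E 0 * (E 0)ᵀ)) (fun t => gaussianDensity (m t) (E t * (E t)ᵀ)) := by
  have hpd : ∀ t, (E t * (E t)ᵀ).PosDef := fun t => posDef_mul_transpose (h.det_ne_zero t)
  refine ⟨rfl, fun t _ => contDiff_gaussianDensity _ _, fun t _ => gaussianDensity_nonneg _ _,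
    fun t _ => integrable_gaussianDensity _ (hpd t), fun t _ => integral_gaussianDensity _ (hpd t),
    fun t _ => integrable_flux_integrand b _ hQ (hpd t), fun t _ => ?_, fun t ht x => ?_⟩
  · rw [flux_gaussianDensity b _ hQ (hpd t)]
    exact (((contDiff_gaussianDensity (n := 1) _ _).differentiable one_ne_zero).smul
      fun x => (hasFDerivAt_affineImage _ _ x).differentiableAt).neg
  · rw [flux_gaussianDensity b _ hQ (hpd t), divergence_gaussianDensity_smul _ _ _ (hpd t)]
    refine hasDerivWithinAt_gaussianDensity (S := fun r => E r * (E r)ᵀ) (hpd t) ?_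
      (h.hasDerivWithinAt_cov ht _) x
    have := (h.hasDerivAt_mean t ht).hasDerivWithinAt (s := Ici 0)
    rwa [add_comm] at this

end Classical

/-! ### The Gaussian curve is a weak solution -/

section WeakGaussian

variable {d : ℕ}

/-- The potential is comparable to `‖y‖²`, up to additive constants. -/
lemma exists_potential_bounds (b : Vec d) {Q : Mat d} (hQ : Q.PosDef) :
    ∃ K : ℝ, 0 < K ∧ ∀ y : Vec d, |1 + gaussianPotential b Q y| ≤ K * (1 + ‖y‖ ^ 2) ∧
      ‖y‖ ^ 2 ≤ K * (1 + |1 + gaussianPotential b Q y|) := by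
  obtain ⟨C, hC, hform⟩ := exists_form_bound hQ
  have hpos : 0 < (√((2 * Real.pi) ^ d * Q.det))⁻¹ := by
    have := hQ.det_pos
    positivity
  set a := 1 + -Real.log (√((2 * Real.pi) ^ d * Q.det))⁻¹ with ha
  have hV : ∀ y, 1 + gaussianPotential b Q y =
      a + 1 / 2 * ((y - b).ofLp ⬝ᵥ (Q⁻¹ *ᵥ (y - b).ofLp)) := by
    intro y
    rw [gaussianPotential, gaussianDensity, Real.log_mul hpos.ne' (Real.exp_pos _).ne', Real.log_exp,
      ha]
    ring
  have hq : ∀ v : Vec d, v.ofLp ⬝ᵥ (Q⁻¹ *ᵥ v.ofLp) ≤ ‖Q⁻¹‖ * ‖v‖ ^ 2 := by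
    intro v
    rw [← Matrix.inner_toEuclideanCLM]
    have h1 := ContinuousLinearMap.le_opNorm (Matrix.toEuclideanCLM (𝕜 := ℝ) Q⁻¹) v
    rw [Matrix.l2_opNorm_toEuclideanCLM] at h1
    have h2 := real_inner_le_norm v (Matrix.toEuclideanCLM (𝕜 := ℝ) Q⁻¹ v)
    nlinarith [norm_nonneg v]
  have hsq : ∀ x y : Vec d, ‖x - y‖ ^ 2 ≤ 2 * (‖x‖ ^ 2 + ‖y‖ ^ 2) := fun x y => by
    have h1 := norm_sub_le x y
    nlinarith [sq_nonneg (‖x‖ - ‖y‖), norm_nonneg (x - y), norm_nonneg x, norm_nonneg y]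
  refine ⟨|a| + ‖Q⁻¹‖ * (1 + ‖b‖ ^ 2) + 4 * C * (1 + |a|) + 2 * ‖b‖ ^ 2, by positivity, fun y => ?_⟩
  obtain ⟨h0, h1, -⟩ := hform (y - b).ofLp
  rw [← norm_sq_vec] at h1
  have h2 := hq (y - b)
  rw [hV]
  set q := (y - b).ofLp ⬝ᵥ (Q⁻¹ *ᵥ (y - b).ofLp) with hqdef
  have h3 := hsq y b
  have ha0 := abs_nonneg a
  have hy0 := sq_nonneg ‖y‖
  have hb0 := sq_nonneg ‖b‖
  have hQ0 := norm_nonneg Q⁻¹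
  constructor
  · have h4 : |a + 1 / 2 * q| ≤ |a| + ‖Q⁻¹‖ * (‖y‖ ^ 2 + ‖b‖ ^ 2) := by
      refine (abs_add_le _ _).trans (add_le_add le_rfl ?_)
      rw [abs_of_nonneg (by positivity)]
      nlinarith [mul_le_mul_of_nonneg_left h3 hQ0]
    refine h4.trans ?_
    have h5 : 0 ≤ 4 * C * (1 + |a|) := by positivity
    nlinarith [mul_nonneg hQ0 hb0, mul_nonneg ha0 hy0, mul_nonneg (mul_nonneg hQ0 hb0) hy0,
      mul_nonneg hb0 hy0, mul_nonneg h5 hy0]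
  · have h6 : q ≤ 2 * (|a + 1 / 2 * q| + |a|) := by
      have := le_abs_self (a + 1 / 2 * q)
      have := neg_abs_le a
      linarith
    have h7 := hsq (y - b) (-b)
    rw [sub_neg_eq_add, sub_add_cancel, norm_neg] at h7
    have hp := abs_nonneg (a + 1 / 2 * q)
    have h8 : ‖y - b‖ ^ 2 ≤ C * (2 * (|a + 1 / 2 * q| + |a|)) :=
      h1.trans (mul_le_mul_of_nonneg_left h6 hC.le)
    have h9 : ‖y‖ ^ 2 ≤ 4 * C * (|a + 1 / 2 * q| + |a|) + 2 * ‖b‖ ^ 2 := by linarith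
    refine h9.trans ?_
    nlinarith [mul_nonneg ha0 hp, mul_nonneg (mul_nonneg hC.le ha0) hp, mul_nonneg hb0 hp,
      mul_nonneg hQ0 hb0, mul_nonneg (mul_nonneg hQ0 hb0) hp, mul_nonneg hQ0 hp, mul_nonneg hC.le ha0]

/-- The full derivative of a function of time and space in the direction `(1, v)`. -/
lemma deriv_add_inner_gradient {φ : ℝ × Vec d → ℝ} (hφ : Differentiable ℝ φ) (t : ℝ) (x v : Vec d) :
    deriv (fun s => φ (s, x)) t + inner ℝ (gradient (fun z => φ (t, z)) x) v =
      fderiv ℝ φ (t, x) (1, v) := by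
  have h1 : HasDerivAt (fun s => φ (s, x)) (fderiv ℝ φ (t, x) (1, 0)) t :=
    (hφ (t, x)).hasFDerivAt.comp_hasDerivAt t ((hasDerivAt_id t).prodMk (hasDerivAt_const t x))
  have h2 : HasFDerivAt (fun z => φ (t, z))
      ((fderiv ℝ φ (t, x)).comp (ContinuousLinearMap.inr ℝ ℝ (Vec d))) x :=
    (hφ (t, x)).hasFDerivAt.comp x (hasFDerivAt_prodMk_right t x)
  have h3 : inner ℝ (gradient (fun z => φ (t, z)) x) v = fderiv ℝ φ (t, x) (0, v) := by
    rw [← InnerProductSpace.toDual_apply_apply (𝕜 := ℝ), toDual_gradient, h2.fderiv]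
    simp
  rw [h1.deriv, h3, ← map_add]
  simp

lemma continuous_affineImage_uncurry {X : Type*} [TopologicalSpace X] {c : X → Vec d} {A : X → Mat d}
    {x : X → Vec d} (hc : Continuous c) (hA : Continuous A) (hx : Continuous x) :
    Continuous fun p => affineImage (c p) (A p) (x p) := by
  refine hc.add ?_
  have : (fun p => Matrix.toEuclideanCLM (𝕜 := ℝ) (A p) (x p)) =
    fun p => WithLp.toLp 2 (A p *ᵥ (x p).ofLp) := rfl
  rw [this]
  refine (PiLp.continuous_toLp 2 _).comp (Continuous.matrix_mulVec hA ?_)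
  exact (PiLp.continuous_ofLp 2 _).comp hx

variable {b : Vec d} {Q : Mat d} {m : ℝ → Vec d} {E : ℝ → Mat d}

/-- The points `m t + E t z` are transported by the velocity field. -/
lemma IsAffineFlow.hasDerivAt_affineImage (h : IsAffineFlow b Q m E) {t : ℝ} (ht : 0 ≤ t)
    (z : Vec d) :
    HasDerivAt (fun s => affineImage (m s) (E s) z)
      (affineImage (driftVec b Q (m t)) (driftMat b Q (m t) (E t * (E t)ᵀ))
        (affineImage (m t) (E t) z)) t := by
  have h1 := (h.hasDerivAt_mean t ht)
  have h2 := hasDerivWithinAt_univ.1 (hasDerivWithinAt_mulVec (s := univ)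
    (h.hasDerivAt_factor t ht).hasDerivWithinAt (hasDerivWithinAt_const t univ z))
  refine (h1.add h2).congr_deriv ?_
  rw [affineImage, affineImage, map_add]
  ext i
  simp only [PiLp.add_apply, Matrix.ofLp_toEuclideanCLM, WithLp.ofLp_zero, Matrix.mulVec_zero,
    add_zero, Matrix.mulVec_mulVec]
  ring

lemma IsAffineFlow.continuous_drift (h : IsAffineFlow b Q m E) :
    Continuous (fun t => driftVec b Q (m t)) ∧
      Continuous (fun t => driftMat b Q (m t) (E t * (E t)ᵀ)) := by
  constructor
  · exact (contDiff_driftVec (n := ∞) b Q h.contDiff_mean).continuous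
  · exact (contDiff_driftMat (n := ∞) b Q h.contDiff_mean
      (h.contDiff_factor.mul (contDiff_transpose.comp h.contDiff_factor))).continuous

/-- The weak formulation along the flow: differentiate a test function along the trajectories of
`z ↦ m t + E t z`, and integrate over time and over the standard Gaussian. -/
lemma IsAffineFlow.weak_eq (h : IsAffineFlow b Q m E) (hQ : Q.PosDef) {φ : ℝ × Vec d → ℝ}
    (hφ : ContDiff ℝ ∞ φ) (hφc : HasCompactSupport φ) :
    (∫ t in Ioi (0 : ℝ), ∫ x,
        (deriv (fun s => φ (s, x)) t +
          inner ℝ (gradient (fun z => φ (t, z)) x) (velocity bilinearKernel (gaussianPotential b Q)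
            (multivariateGaussian (m t) (E t * (E t)ᵀ)) x))
        ∂(multivariateGaussian (m t) (E t * (E t)ᵀ))) +
      ∫ x, φ (0, x) ∂(multivariateGaussian (m 0) (E 0 * (E 0)ᵀ)) = 0 := by
  have hpd : ∀ t, (E t * (E t)ᵀ).PosDef := fun t => posDef_mul_transpose (h.det_ne_zero t)
  have hφd : Differentiable ℝ φ := hφ.differentiable (by simp)
  set γ := stdGaussian (Vec d) with hγ
  set X : ℝ → Vec d → Vec d := fun t z => affineImage (m t) (E t) z with hX
  set U : ℝ → Vec d → Vec d := fun t x =>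
    affineImage (driftVec b Q (m t)) (driftMat b Q (m t) (E t * (E t)ᵀ)) x with hU
  set H : ℝ × Vec d → ℝ := fun p => fderiv ℝ φ p (1, U p.1 p.2) with hH
  have hUc : Continuous fun p : ℝ × Vec d => U p.1 p.2 :=
    continuous_affineImage_uncurry (h.continuous_drift.1.comp continuous_fst)
      (h.continuous_drift.2.comp continuous_fst) continuous_snd
  have hXc : Continuous fun p : ℝ × Vec d => X p.1 p.2 :=
    continuous_affineImage_uncurry (h.contDiff_mean.continuous.comp continuous_fst)
      (h.contDiff_factor.continuous.comp continuous_fst) continuous_snd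
  have hHc : Continuous H :=
    (hφ.continuous_fderiv (by simp)).clm_apply (continuous_const.prodMk hUc)
  have hHs : HasCompactSupport H := by
    refine (hφc.fderiv (𝕜 := ℝ)).mono fun p hp => ?_
    rw [Function.mem_support] at hp ⊢
    intro h0
    exact hp (by rw [hH]; simp [h0])
  obtain ⟨M, hM⟩ := hHs.exists_bound_of_continuous hHc
  obtain ⟨T, hT⟩ : ∃ T : ℝ, ∀ p : ℝ × Vec d, T < p.1 → φ p = 0 ∧ H p = 0 := by
    obtain ⟨T, hT⟩ := (hφc.isCompact.image continuous_fst).bddAbove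
    refine ⟨T, fun p hp => ?_⟩
    have hnot : p ∉ tsupport φ := fun hmem => absurd (hT ⟨p, hmem, rfl⟩) (not_le.2 hp)
    refine ⟨image_eq_zero_of_notMem_tsupport hnot, ?_⟩
    have h0 : fderiv ℝ φ p = 0 :=
      image_eq_zero_of_notMem_tsupport fun hmem => hnot (tsupport_fderiv_subset ℝ hmem)
    rw [hH]; simp [h0]
  -- the space integral, transported to the standard Gaussian
  have hinner : ∀ t ∈ Ioi (0 : ℝ), ∫ x, (deriv (fun s => φ (s, x)) t +
      inner ℝ (gradient (fun z => φ (t, z)) x) (velocity bilinearKernel (gaussianPotential b Q)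
        (multivariateGaussian (m t) (E t * (E t)ᵀ)) x)) ∂(multivariateGaussian (m t) (E t * (E t)ᵀ)) =
      ∫ z, H (t, X t z) ∂γ := by
    intro t _
    have h1 : ∀ x, deriv (fun s => φ (s, x)) t +
      inner ℝ (gradient (fun z => φ (t, z)) x) (velocity bilinearKernel (gaussianPotential b Q)
        (multivariateGaussian (m t) (E t * (E t)ᵀ)) x) = H (t, x) := fun x => by
      rw [deriv_add_inner_gradient hφd, velocity_eq (integrable_norm_sq_gaussian _ _) b hQ,
        meanVec_gaussian, covMat_gaussian _ (hpd t).posSemidef]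
    have hc : Continuous fun x => H (t, x) := hHc.comp (continuous_const.prodMk continuous_id)
    simp only [h1]
    rw [multivariateGaussian_eq_map, integral_map
      (continuous_affineImage _ _).measurable.aemeasurable hc.aestronglyMeasurable]
  have hGc : Continuous (Function.uncurry fun t z => H (t, X t z)) :=
    hHc.comp (continuous_fst.prodMk hXc)
  have hGint : Integrable (Function.uncurry fun t z => H (t, X t z))
      ((volume.restrict (Ioi (0 : ℝ))).prod γ) := by
    have hdom : Integrable ((Icc 0 T ×ˢ univ).indicator fun _ : ℝ × Vec d => M)
        ((volume.restrict (Ioi (0 : ℝ))).prod γ) := by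
      refine (integrable_indicator_iff (measurableSet_Icc.prod MeasurableSet.univ)).2 ?_
      refine integrableOn_const (ne_of_lt ?_)
      rw [Measure.prod_prod]
      refine ENNReal.mul_lt_top ?_ (measure_lt_top _ _)
      exact (Measure.restrict_apply_le _ _).trans_lt (by simp)
    have hae : ∀ᵐ p ∂((volume.restrict (Ioi (0 : ℝ))).prod γ), p.1 ∈ Ioi (0 : ℝ) :=
      Measure.quasiMeasurePreserving_fst.ae (ae_restrict_mem measurableSet_Ioi)
    refine hdom.mono' hGc.aestronglyMeasurable ?_
    filter_upwards [hae] with p hp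
    by_cases hpT : p.1 ≤ T
    · rw [indicator_of_mem (by exact ⟨⟨le_of_lt hp, hpT⟩, trivial⟩)]
      exact hM _
    · rw [show Function.uncurry (fun t z => H (t, X t z)) p = 0 from (hT (p.1, X p.1 p.2) (not_le.1 hpT)).2, norm_zero]
      exact indicator_nonneg (fun _ _ => (norm_nonneg _).trans (hM 0)) _
  have htime : ∀ z, Integrable (fun t => H (t, X t z)) (volume.restrict (Ioi (0 : ℝ))) →
      ∫ t in Ioi (0 : ℝ), H (t, X t z) = -φ (0, X 0 z) := by
    intro z hz
    have hd : ∀ t ∈ Ici (0 : ℝ), HasDerivAt (fun s => φ (s, X s z)) (H (t, X t z)) t := fun t ht =>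
      (hφd (t, X t z)).hasFDerivAt.comp_hasDerivAt t
        ((hasDerivAt_id t).prodMk (h.hasDerivAt_affineImage ht z))
    have hlim : Tendsto (fun s => φ (s, X s z)) atTop (𝓝 0) := by
      refine tendsto_const_nhds.congr' ?_
      filter_upwards [eventually_gt_atTop T] with s hs using ((hT (s, X s z) hs).1).symm
    rw [integral_Ioi_of_hasDerivAt_of_tendsto' hd hz hlim, zero_sub]
  have hc0 : Continuous fun x => φ (0, x) :=
    hφ.continuous.comp (continuous_const.prodMk continuous_id)
  rw [setIntegral_congr_fun measurableSet_Ioi hinner, integral_integral_swap hGint,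
    integral_congr_ae (hGint.prod_left_ae.mono fun z hz => htime z hz), integral_neg,
    multivariateGaussian_eq_map, integral_map
      (continuous_affineImage _ _).measurable.aemeasurable hc0.aestronglyMeasurable]
  exact neg_add_cancel _

lemma IsAffineFlow.isWeakSolution (h : IsAffineFlow b Q m E) (hQ : Q.PosDef) :
    IsWeakSolution bilinearKernel (gaussianPotential b Q)
      (gaussianLaw (m 0) (E 0 * (E 0)ᵀ)) (fun t => gaussianLaw (m t) (E t * (E t)ᵀ)) := by
  have hpd : ∀ t, (E t * (E t)ᵀ).PosDef := fun t => posDef_mul_transpose (h.det_ne_zero t)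
  have hSc : Continuous fun t => E t * (E t)ᵀ :=
    (h.contDiff_factor.mul (contDiff_transpose.comp h.contDiff_factor)).continuous
  refine ⟨?_, fun T => ?_, fun φ hφ hφc => h.weak_eq hQ hφ hφc⟩
  · refine Continuous.continuousOn (continuous_iff_continuousAt.2 fun t => ?_)
    exact tendsto_gaussianLaw (Eventually.of_forall fun s => (hpd s).posSemidef) (hpd t).posSemidef
      (h.contDiff_mean.continuous.tendsto t) (hSc.tendsto t)
  · obtain ⟨K, hK, hpot⟩ := exists_potential_bounds b hQ
    have hsm : ∀ t, ∫ y, ‖y‖ ^ 2 ∂(multivariateGaussian (m t) (E t * (E t)ᵀ)) =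
        ∑ i, ((E t * (E t)ᵀ) i i + m t i * m t i) := by
      intro t
      have hint := integrable_norm_sq_gaussian (m t) (E t * (E t)ᵀ)
      have hc := covMat_gaussian (m t) (hpd t).posSemidef
      have hm := meanVec_gaussian (m t) (E t * (E t)ᵀ)
      have h1 : ∀ y : Vec d, ‖y‖ ^ 2 = ∑ i, y i * y i := fun y => by
        rw [norm_sq_vec, dotProduct]
      simp only [h1]
      rw [integral_finsetSum _ fun i _ => integrable_coord_mul hint i i]
      refine Finset.sum_congr rfl fun i _ => ?_
      have h2 : ∫ y : Vec d, y i ∂(multivariateGaussian (m t) (E t * (E t)ᵀ)) = m t i :=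
        congrArg (fun v : Vec d => v i) hm
      have h3 := congrFun (congrFun hc i) i
      rw [covMat, Matrix.of_apply, h2] at h3
      linarith
    have hcont : Continuous fun t => K * (1 + ∑ i, ((E t * (E t)ᵀ) i i + m t i * m t i)) := by
      refine continuous_const.mul (continuous_const.add (continuous_finsetSum _ fun i _ => ?_))
      have h4 : Continuous fun t => m t i :=
        (EuclideanSpace.proj (𝕜 := ℝ) i).continuous.comp h.contDiff_mean.continuous
      exact ((continuous_mat_apply i i).comp hSc).add (h4.mul h4)
    obtain ⟨B, hB⟩ := (isCompact_Icc (a := (0 : ℝ)) (b := T)).bddAbove_image hcont.continuousOn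
    refine ⟨B.toNNReal, fun t ht => ?_⟩
    have hint := integrable_norm_sq_gaussian (m t) (E t * (E t)ᵀ)
    have hint2 : Integrable (fun y : Vec d => K * (1 + ‖y‖ ^ 2))
        (multivariateGaussian (m t) (E t * (E t)ᵀ)) :=
      ((integrable_const 1).add hint).const_mul K
    calc ∫⁻ y, ‖1 + gaussianPotential b Q y‖ₑ ∂(multivariateGaussian (m t) (E t * (E t)ᵀ))
        ≤ ∫⁻ y, ENNReal.ofReal (K * (1 + ‖y‖ ^ 2)) ∂(multivariateGaussian (m t) (E t * (E t)ᵀ)) := by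
          refine lintegral_mono fun y => ?_
          rw [Real.enorm_eq_ofReal_abs]
          exact ENNReal.ofReal_le_ofReal (hpot y).1
      _ = ENNReal.ofReal (∫ y, K * (1 + ‖y‖ ^ 2) ∂(multivariateGaussian (m t) (E t * (E t)ᵀ))) := by
          rw [ofReal_integral_eq_lintegral_ofReal hint2]
          exact Eventually.of_forall fun y => by positivity
      _ ≤ ENNReal.ofReal B := by
          refine ENNReal.ofReal_le_ofReal ?_
          rw [integral_const_mul, integral_add (integrable_const _) hint, hsm]
          have := hB ⟨t, ht, rfl⟩
          simpa using this
      _ = _ := rfl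

end WeakGaussian

/-! ### Distributional equations on a half-line -/

section HalfLine

/-- A distributional form, on `[0, ∞)`, of `g' = G` and `g 0 = g₀` gives the integral form, when
`g` is continuous and `G` is locally integrable. -/
lemma eq_add_integral_of_weak {g G : ℝ → ℝ} {g₀ : ℝ} (hg : ContinuousOn g (Ici 0))
    (hG : ∀ T : ℝ, IntegrableOn G (Ioc 0 T))
    (hw : ∀ χ : ℝ → ℝ, ContDiff ℝ ∞ χ → HasCompactSupport χ →
      (∫ t in Ioi (0 : ℝ), (deriv χ t * g t + χ t * G t)) + χ 0 * g₀ = 0)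
    {T : ℝ} (hT : 0 ≤ T) : g T = g₀ + ∫ t in 0..T, G t := by
  set σ := Real.smoothTransition with hσ
  have hσs : ContDiff ℝ ∞ σ := Real.smoothTransition.contDiff
  have hσd : ∀ x, HasDerivAt σ (deriv σ x) x := fun x =>
    (hσs.differentiable (by simp) x).hasDerivAt
  have hσc : Continuous (deriv σ) := hσs.continuous_deriv (by simp)
  have hσ0 : ∀ x, x ≤ 0 → deriv σ x = 0 := by
    intro x hx
    exact (uniqueDiffOn_Iic 0 x hx).eq_deriv _ (hσd x).hasDerivWithinAt
      ((hasDerivWithinAt_const x _ (0 : ℝ)).congr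
        (fun y hy => Real.smoothTransition.zero_of_nonpos hy) (Real.smoothTransition.zero_of_nonpos hx))
  have hσ1 : ∀ x, 1 ≤ x → deriv σ x = 0 := by
    intro x hx
    exact (uniqueDiffOn_Ici 1 x hx).eq_deriv _ (hσd x).hasDerivWithinAt
      ((hasDerivWithinAt_const x _ (1 : ℝ)).congr
        (fun y hy => Real.smoothTransition.one_of_one_le hy) (Real.smoothTransition.one_of_one_le hx))
  obtain ⟨M, hM⟩ := (isCompact_Icc (a := (0 : ℝ)) (b := 1)).exists_bound_of_continuousOn
    hσc.continuousOn
  have hM0 : 0 ≤ M := (norm_nonneg _).trans (hM 0 (by simp))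
  -- `h n` falls from `1` to `0` on `[T, T + 1 / (n + 1)]`, so that its derivative tends to minus the
  -- Dirac mass at `T`
  set h : ℕ → ℝ → ℝ := fun n t => σ (1 - (n + 1) * (t - T)) with hh
  set h' : ℕ → ℝ → ℝ := fun n t => -(n + 1) * deriv σ (1 - (n + 1) * (t - T)) with hh'
  have hd : ∀ n t, HasDerivAt (h n) (h' n t) t := by
    intro n t
    have h1 : HasDerivAt (fun t : ℝ => 1 - ((n : ℝ) + 1) * (t - T)) (-(n + 1)) t := by
      simpa using (((hasDerivAt_id t).sub_const T).const_mul ((n : ℝ) + 1)).const_sub 1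
    have h2 := (hσd _).comp t h1
    rwa [mul_comm] at h2
  have hn0 : ∀ n : ℕ, (0 : ℝ) < n + 1 := fun n => by positivity
  have hh1 : ∀ n t, t ≤ T → h n t = 1 := fun n t ht =>
    Real.smoothTransition.one_of_one_le (by nlinarith [hn0 n])
  have hh0 : ∀ (n : ℕ) t, T + 1 / ((n : ℝ) + 1) ≤ t → h n t = 0 := fun n t ht => by
    refine Real.smoothTransition.zero_of_nonpos ?_
    have : (n + 1) * (1 / ((n : ℝ) + 1)) = 1 := mul_one_div_cancel (hn0 n).ne'
    nlinarith [hn0 n, mul_le_mul_of_nonneg_left (sub_nonneg.2 ht) (hn0 n).le]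
  have hh'0 : ∀ (n : ℕ) t, t ∉ Ioc T (T + 1 / ((n : ℝ) + 1)) → h' n t = 0 := by
    intro n t ht
    have hone : (n + 1) * (1 / ((n : ℝ) + 1)) = 1 := mul_one_div_cancel (hn0 n).ne'
    rcases le_or_gt t T with h1 | h1
    · simp only [hh', hσ1 _ (show 1 ≤ 1 - (n + 1) * (t - T) by nlinarith [hn0 n]), mul_zero]
    · have h2 : T + 1 / (n + 1) < t := not_le.1 fun h3 => ht ⟨h1, h3⟩
      simp only [hh', hσ0 _ (show 1 - (n + 1) * (t - T) ≤ 0 by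
        nlinarith [hn0 n, mul_le_mul_of_nonneg_left (sub_nonneg.2 h2.le) (hn0 n).le]), mul_zero]
  have hh'c : ∀ n, Continuous (h' n) := fun n => by
    simp only [hh']; fun_prop
  have hh'b : ∀ n : ℕ, ∀ t ∈ Ioc T (T + 1 / ((n : ℝ) + 1)), |h' n t| ≤ (n + 1) * M := by
    intro n t ht
    have hone : (n + 1) * (1 / ((n : ℝ) + 1)) = 1 := mul_one_div_cancel (hn0 n).ne'
    simp only [hh']
    rw [abs_mul, abs_neg, abs_of_pos (hn0 n)]
    refine mul_le_mul_of_nonneg_left (hM _ ⟨?_, ?_⟩) (hn0 n).le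
    · nlinarith [hn0 n, mul_le_mul_of_nonneg_left (sub_nonneg.2 ht.2) (hn0 n).le]
    · nlinarith [hn0 n, ht.1]
  -- the test functions, cut off on the negative axis to have compact support
  have hkey : ∀ n : ℕ, (∫ t in Ioc T (T + 1 / ((n : ℝ) + 1)), h' n t * g t) +
      (∫ t in Ioc 0 (T + 1), h n t * G t) + g₀ = 0 := by
    intro n
    have hle : (1 : ℝ) / (n + 1) ≤ 1 := by
      rw [div_le_one (hn0 n)]; linarith [(Nat.cast_nonneg n : (0 : ℝ) ≤ n)]
    set χ : ℝ → ℝ := fun t => σ (t + 2) * h n t with hχ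
    have hχs : ContDiff ℝ ∞ χ := by
      refine (hσs.comp (contDiff_id.add contDiff_const)).mul (hσs.comp ?_)
      exact contDiff_const.sub (contDiff_const.mul (contDiff_id.sub contDiff_const))
    have hχc : HasCompactSupport χ := by
      refine HasCompactSupport.intro (isCompact_Icc (a := (-2 : ℝ)) (b := T + 1)) fun t ht => ?_
      rcases lt_or_ge t (-2) with h1 | h1
      · simp only [hχ]
        rw [hσ, Real.smoothTransition.zero_of_nonpos (by linarith), zero_mul]
      · have h2 : T + 1 < t := not_le.1 fun h3 => ht ⟨h1, h3⟩
        simp only [hχ]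
        rw [hh0 n t (by linarith), mul_zero]
    have hχe : ∀ t, 0 ≤ t → χ t = h n t := fun t ht => by
      simp only [hχ]
      rw [hσ, Real.smoothTransition.one_of_one_le (by linarith), one_mul]
    have hχd : ∀ t ∈ Ioi (0 : ℝ), deriv χ t = h' n t := fun t ht => by
      rw [← (hd n t).deriv]
      refine EventuallyEq.deriv_eq ?_
      filter_upwards [Ioi_mem_nhds ht] with s hs using hχe s (le_of_lt hs)
    have hw' := hw χ hχs hχc
    rw [hχe 0 le_rfl, hh1 n 0 hT, one_mul] at hw'
    refine Eq.trans ?_ hw'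
    congr 1
    have hc : ContinuousOn (fun t => h' n t * g t) (Icc T (T + 1 / ((n : ℝ) + 1))) :=
      (hh'c n).continuousOn.mul (hg.mono fun t ht => hT.trans ht.1)
    have hi1 : IntegrableOn (fun t => h' n t * g t) (Ioc T (T + 1 / ((n : ℝ) + 1))) :=
      hc.integrableOn_Icc.mono_set Ioc_subset_Icc_self
    have hi1' : IntegrableOn (fun t => h' n t * g t) (Ioi 0) :=
      hi1.of_forall_sdiff_eq_zero measurableSet_Ioi fun t ht => by rw [hh'0 n t ht.2, zero_mul]
    have hi2 : IntegrableOn (fun t => h n t * G t) (Ioc 0 (T + 1)) := by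
      refine Integrable.bdd_mul (c := 1) (hG (T + 1)) ?_ (Eventually.of_forall fun t => ?_)
      · exact (continuous_iff_continuousAt.2 fun t => (hd n t).continuousAt).aestronglyMeasurable
      · rw [Real.norm_eq_abs, abs_of_nonneg (Real.smoothTransition.nonneg _)]
        exact Real.smoothTransition.le_one _
    have hi2' : IntegrableOn (fun t => h n t * G t) (Ioi 0) :=
      hi2.of_forall_sdiff_eq_zero measurableSet_Ioi fun t ht => by
        rw [hh0 n t, zero_mul]
        have : T + 1 < t := not_le.1 fun h3 => ht.2 ⟨ht.1, h3⟩
        linarith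
    rw [setIntegral_congr_fun (g := fun t => h' n t * g t + h n t * G t) measurableSet_Ioi
      (fun t ht => by simp only [hχd t ht, hχe t (le_of_lt ht)]), integral_add hi1' hi2']
    congr 1
    · refine (setIntegral_eq_of_subset_of_forall_sdiff_eq_zero measurableSet_Ioi
        (fun t ht => ?_) fun t ht => ?_).symm
      · exact hT.trans_lt ht.1
      · rw [hh'0 n t ht.2, zero_mul]
    · refine (setIntegral_eq_of_subset_of_forall_sdiff_eq_zero measurableSet_Ioi
        (fun t ht => ht.1) fun t ht => ?_).symm
      have : T + 1 < t := not_le.1 fun h3 => ht.2 ⟨ht.1, h3⟩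
      rw [hh0 n t (by linarith), zero_mul]
  have hmass : ∀ n : ℕ, ∫ t in Ioc T (T + 1 / ((n : ℝ) + 1)), h' n t = -1 := by
    intro n
    have hle : T ≤ T + 1 / ((n : ℝ) + 1) := by have := hn0 n; linarith [one_div_pos.2 this]
    rw [← intervalIntegral.integral_of_le hle,
      intervalIntegral.integral_eq_sub_of_hasDerivAt (fun t _ => hd n t)
        ((hh'c n).intervalIntegrable _ _), hh0 n _ le_rfl, hh1 n T le_rfl, zero_sub]
  have hlim1 : Tendsto (fun n : ℕ => ∫ t in Ioc T (T + 1 / ((n : ℝ) + 1)), h' n t * g t) atTop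
      (𝓝 (-g T)) := by
    rw [Metric.tendsto_atTop]
    intro ε hε
    obtain ⟨δ, hδ, hgδ⟩ := Metric.continuousWithinAt_iff.1 (hg T hT) (ε / (M + 1)) (by positivity)
    obtain ⟨N, hN⟩ := exists_nat_one_div_lt hδ
    refine ⟨N, fun n hn => ?_⟩
    have hnδ : 1 / ((n : ℝ) + 1) < δ := (Nat.one_div_le_one_div hn).trans_lt hN
    have hc : ContinuousOn (fun t => h' n t * g t) (Icc T (T + 1 / ((n : ℝ) + 1))) :=
      (hh'c n).continuousOn.mul (hg.mono fun t ht => hT.trans ht.1)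
    have hi1 : IntegrableOn (fun t => h' n t * g t) (Ioc T (T + 1 / ((n : ℝ) + 1))) :=
      hc.integrableOn_Icc.mono_set Ioc_subset_Icc_self
    have hi2 : IntegrableOn (fun t => h' n t * g T) (Ioc T (T + 1 / ((n : ℝ) + 1))) :=
      (((hh'c n).mul continuous_const).continuousOn.integrableOn_Icc).mono_set Ioc_subset_Icc_self
    have heq : (∫ t in Ioc T (T + 1 / ((n : ℝ) + 1)), h' n t * g t) - -g T =
        ∫ t in Ioc T (T + 1 / ((n : ℝ) + 1)), h' n t * (g t - g T) := by
      have h3 : -g T = ∫ t in Ioc T (T + 1 / ((n : ℝ) + 1)), h' n t * g T := by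
        rw [integral_mul_const, hmass]; ring
      rw [h3, ← integral_sub hi1 hi2]
      simp only [mul_sub]
    rw [Real.dist_eq, heq, ← Real.norm_eq_abs]
    have hvol : volume.real (Ioc T (T + 1 / ((n : ℝ) + 1))) = 1 / ((n : ℝ) + 1) := by
      rw [Real.volume_real_Ioc_of_le (by linarith [one_div_pos.2 (hn0 n)])]
      ring
    have hb := norm_setIntegral_le_of_norm_le_const (μ := volume)
      (s := Ioc T (T + 1 / ((n : ℝ) + 1))) (f := fun t => h' n t * (g t - g T))
      (C := (n + 1) * M * (ε / (M + 1))) measure_Ioc_lt_top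
      (fun t ht => by
        rw [norm_mul, Real.norm_eq_abs]
        refine mul_le_mul (hh'b n t ht) ?_ (norm_nonneg _) (mul_nonneg (hn0 n).le hM0)
        have h5 := hgδ (show t ∈ Ici (0 : ℝ) from hT.trans ht.1.le) (by
          rw [Real.dist_eq, abs_of_pos (sub_pos.2 ht.1)]; linarith [ht.2])
        rw [Real.dist_eq] at h5
        exact h5.le)
    rw [hvol] at hb
    refine hb.trans_lt ?_
    have h6 : ((n : ℝ) + 1) * M * (ε / (M + 1)) * (1 / (n + 1)) = M / (M + 1) * ε := by
      have := (hn0 n).ne'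
      field_simp
    rw [h6]
    have h7 : M / (M + 1) < 1 := (div_lt_one (by positivity)).2 (by linarith)
    nlinarith
  have hlim2 : Tendsto (fun n : ℕ => ∫ t in Ioc 0 (T + 1), h n t * G t) atTop
      (𝓝 (∫ t in Ioc 0 (T + 1), (Iic T).indicator G t)) := by
    refine tendsto_integral_of_dominated_convergence (fun t => ‖G t‖) (fun n => ?_) (hG (T + 1)).norm
      (fun n => Eventually.of_forall fun t => ?_) (Eventually.of_forall fun t => ?_)
    · exact (continuous_iff_continuousAt.2 fun t =>
        (hd n t).continuousAt).aestronglyMeasurable.mul (hG (T + 1)).1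
    · rw [norm_mul, Real.norm_eq_abs, abs_of_nonneg (Real.smoothTransition.nonneg _)]
      exact mul_le_of_le_one_left (norm_nonneg _) (Real.smoothTransition.le_one _)
    · refine tendsto_const_nhds.congr' ?_
      rcases le_or_gt t T with h1 | h1
      · refine Eventually.of_forall fun n => ?_
        simp only [hh1 n t h1, one_mul, indicator_of_mem (show t ∈ Iic T from h1)]
      · obtain ⟨N, hN⟩ := exists_nat_one_div_lt (sub_pos.2 h1)
        filter_upwards [eventually_ge_atTop N] with n hn
        have : 1 / ((n : ℝ) + 1) < t - T := (Nat.one_div_le_one_div hn).trans_lt hN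
        simp only [hh0 n t (by linarith), zero_mul,
          indicator_of_notMem (show t ∉ Iic T from not_le.2 h1)]
  have hset : ∫ t in Ioc 0 (T + 1), (Iic T).indicator G t = ∫ t in 0..T, G t := by
    rw [setIntegral_indicator measurableSet_Iic, intervalIntegral.integral_of_le hT]
    congr 2
    ext t
    simp only [mem_inter_iff, mem_Ioc, mem_Iic]
    constructor
    · exact fun h => ⟨h.1.1, h.2⟩
    · exact fun h => ⟨⟨h.1, by linarith [h.2]⟩, h.2⟩
  have hlim := ((hlim1.add hlim2).add_const g₀)
  simp only [hkey] at hlim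
  have := tendsto_nhds_unique hlim tendsto_const_nhds
  rw [hset] at this
  linarith

/-- If `g` is a primitive of `G` on `[0, ∞)`, then `g` is continuous there. -/
lemma continuousOn_of_eq_add_integral {g G : ℝ → ℝ} {g₀ : ℝ}
    (hG : ∀ T : ℝ, IntegrableOn G (Ioc 0 T))
    (h : ∀ T : ℝ, 0 ≤ T → g T = g₀ + ∫ t in 0..T, G t) : ContinuousOn g (Ici 0) := by
  intro t ht
  have h0 : (0 : ℝ) ≤ t + 1 := by linarith [mem_Ici.1 ht]
  have h1 : ContinuousOn (fun T => ∫ s in 0..T, G s) (Icc 0 (t + 1)) := by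
    rw [← uIcc_of_le h0]
    refine intervalIntegral.continuousOn_primitive_interval' (b₁ := 0) (b₂ := t + 1) ?_ left_mem_uIcc
    rw [intervalIntegrable_iff_integrableOn_Ioc_of_le h0]
    exact hG (t + 1)
  have h2 : ContinuousOn g (Icc 0 (t + 1)) :=
    (continuousOn_const.add h1).congr fun s hs => h s hs.1
  refine (h2 t ⟨ht, by linarith⟩).mono_of_mem_nhdsWithin ?_
  filter_upwards [self_mem_nhdsWithin, mem_nhdsWithin_of_mem_nhds (Iic_mem_nhds (lt_add_one t))]
    with s hs1 hs2 using ⟨hs1, hs2⟩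

/-- If `g` is a primitive of a continuous `G` on `[0, ∞)`, then `g' = G`. -/
lemma hasDerivWithinAt_of_eq_add_integral {g G : ℝ → ℝ} {g₀ : ℝ} (hG : ContinuousOn G (Ici 0))
    (h : ∀ T : ℝ, 0 ≤ T → g T = g₀ + ∫ t in 0..T, G t) {t : ℝ} (ht : 0 ≤ t) :
    HasDerivWithinAt g (G t) (Ici 0) t := by
  have hc : Continuous fun s => G (max s 0) :=
    hG.comp_continuous (continuous_id.max continuous_const) fun s => mem_Ici.2 (le_max_right _ _)
  have h1 : HasDerivAt (fun T => g₀ + ∫ s in 0..T, G (max s 0)) (G (max t 0)) t :=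
    (intervalIntegral.integral_hasDerivAt_right (hc.intervalIntegrable _ _)
      (hc.stronglyMeasurableAtFilter _ _) hc.continuousAt).const_add g₀
  rw [max_eq_left ht] at h1
  refine h1.hasDerivWithinAt.congr (fun s hs => ?_) ?_
  all_goals
    rw [h _ (by first | exact hs | exact ht)]
    congr 1
    refine intervalIntegral.integral_congr fun r hr => ?_
    rw [uIcc_of_le (by first | exact hs | exact ht)] at hr
    simp only [max_eq_left hr.1]

end HalfLine

/-! ### Moments and velocities of weak solutions -/

section WeakSolutions

variable {d : ℕ}

/-- A weakly continuous curve of probability measures on `[0, ∞)` is a Markov kernel. -/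
lemma exists_kernel {ρ : ℝ → ProbabilityMeasure (Vec d)} (hρ : ContinuousOn ρ (Ici 0)) :
    ∃ κ : Kernel ℝ (Vec d), IsMarkovKernel κ ∧ ∀ t, 0 ≤ t → κ t = (ρ t : Measure (Vec d)) := by
  have hc : Continuous fun t => ρ (max t 0) :=
    hρ.comp_continuous (continuous_id.max continuous_const) fun s => mem_Ici.2 (le_max_right _ _)
  have hm : Measurable fun t => (ρ (max t 0) : Measure (Vec d)) := by
    refine Measurable.measure_of_isPiSystem_of_isProbabilityMeasure
      (BorelSpace.measurable_eq (α := Vec d)) isPiSystem_isOpen fun s hs => ?_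
    -- the mass of an open set is lower semicontinuous
    refine LowerSemicontinuous.measurable (lowerSemicontinuous_iff_le_liminf.2 fun t => ?_)
    exact ProbabilityMeasure.le_liminf_measure_open_of_tendsto (hc.tendsto t) hs
  exact ⟨⟨fun t => (ρ (max t 0) : Measure (Vec d)), hm⟩, ⟨fun t => (ρ (max t 0)).2⟩,
    fun t ht => by
      change (ρ (max t 0) : Measure (Vec d)) = _
      rw [max_eq_left ht]⟩

lemma continuousOn_integral {ρ : ℝ → ProbabilityMeasure (Vec d)} (hρ : ContinuousOn ρ (Ici 0))
    {φ : ℝ × Vec d → ℝ} (hφ : Continuous φ) (hφc : HasCompactSupport φ) :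
    ContinuousOn (fun t => ∫ x, φ (t, x) ∂(ρ t : Measure (Vec d))) (Ici 0) := by
  obtain ⟨M, hM⟩ := hφc.exists_bound_of_continuous hφ
  have hcx : ∀ t, Continuous fun x => φ (t, x) := fun t =>
    hφ.comp (continuous_const.prodMk continuous_id)
  have hint : ∀ t s, Integrable (fun x => φ (t, x)) (ρ s : Measure (Vec d)) := fun t s =>
    (integrable_const M).mono' (hcx t).aestronglyMeasurable (Eventually.of_forall fun x => hM _)
  intro t ht
  have h1 : Tendsto (fun s => ∫ x, φ (t, x) ∂(ρ s : Measure (Vec d))) (𝓝[Ici 0] t)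
      (𝓝 (∫ x, φ (t, x) ∂(ρ t : Measure (Vec d)))) :=
    ProbabilityMeasure.tendsto_iff_forall_integral_tendsto.1 (hρ t ht)
      (BoundedContinuousFunction.ofNormedAddCommGroup (fun x => φ (t, x)) (hcx t) M fun x => hM _)
  have h2 : Tendsto (fun s => ∫ x, (φ (s, x) - φ (t, x)) ∂(ρ s : Measure (Vec d))) (𝓝[Ici 0] t)
      (𝓝 0) := by
    rw [Metric.tendsto_nhds]
    intro ε hε
    obtain ⟨δ, hδ, hu⟩ := Metric.uniformContinuous_iff.1
      (hφc.uniformContinuous_of_continuous hφ) (ε / 2) (by positivity)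
    filter_upwards [mem_nhdsWithin_of_mem_nhds (Metric.ball_mem_nhds t hδ)] with s hs
    rw [dist_zero_right]
    refine lt_of_le_of_lt (norm_integral_le_of_norm_le_const (C := ε / 2)
      (Eventually.of_forall fun x => ?_)) ?_
    · have := hu (a := (s, x)) (b := (t, x)) (by
        rw [Prod.dist_eq, dist_self]
        exact max_lt hs hδ)
      rw [dist_eq_norm] at this
      exact this.le
    · rw [probReal_univ, mul_one]
      linarith
  have h3 := h2.add h1
  rw [zero_add] at h3
  refine h3.congr fun s => ?_
  rw [integral_sub (hint s s) (hint t s), sub_add_cancel]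

lemma continuous_gaussianPotential (b : Vec d) {Q : Mat d} (hQ : Q.PosDef) :
    Continuous (gaussianPotential b Q) :=
  continuous_iff_continuousAt.2 fun x => (hasGradientAt_gaussianPotential b hQ x).continuousAt

variable {b : Vec d} {Q : Mat d} {ν : ProbabilityMeasure (Vec d)}
  {ρ : ℝ → ProbabilityMeasure (Vec d)}

/-- The integrability condition on the potential bounds the second moments. -/
lemma IsWeakSolution.exists_moment_bound (hρ : IsWeakSolution bilinearKernel (gaussianPotential b Q) ν ρ)
    (hQ : Q.PosDef) (T : ℝ) : ∃ C : ℝ, 0 ≤ C ∧ ∀ t ∈ Icc 0 T,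
      Integrable (fun y : Vec d => ‖y‖ ^ 2) (ρ t : Measure (Vec d)) ∧
      ∫ y, ‖y‖ ^ 2 ∂(ρ t : Measure (Vec d)) ≤ C := by
  obtain ⟨K, hK, hpot⟩ := exists_potential_bounds b hQ
  obtain ⟨C, hC⟩ := hρ.bounded T
  refine ⟨K * (1 + C), by positivity, fun t ht => ?_⟩
  have hVm : AEStronglyMeasurable (fun y => 1 + gaussianPotential b Q y) (ρ t : Measure (Vec d)) :=
    (continuous_const.add (continuous_gaussianPotential b hQ)).aestronglyMeasurable
  have hV : Integrable (fun y => 1 + gaussianPotential b Q y) (ρ t : Measure (Vec d)) :=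
    ⟨hVm, (hC t ht).trans_lt ENNReal.coe_lt_top⟩
  have hdom : Integrable (fun y => K * (1 + |1 + gaussianPotential b Q y|)) (ρ t : Measure (Vec d)) :=
    ((integrable_const 1).add hV.norm).const_mul K
  have hint : Integrable (fun y : Vec d => ‖y‖ ^ 2) (ρ t : Measure (Vec d)) := by
    refine hdom.mono' (by fun_prop) (Eventually.of_forall fun y => ?_)
    rw [Real.norm_of_nonneg (sq_nonneg _)]
    exact (hpot y).2
  refine ⟨hint, (integral_mono hint hdom fun y => (hpot y).2).trans ?_⟩
  have hle : ∫ y, |1 + gaussianPotential b Q y| ∂(ρ t : Measure (Vec d)) ≤ C := by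
    have h1 := integral_norm_eq_lintegral_enorm hVm
    simp only [Real.norm_eq_abs] at h1
    rw [h1]
    exact ENNReal.toReal_le_of_le_ofReal C.2 (by simpa using hC t ht)
  rw [integral_const_mul, integral_add (integrable_const _) hV.abs, integral_const, probReal_univ,
    one_smul]
  exact mul_le_mul_of_nonneg_left (add_le_add le_rfl hle) hK.le

lemma velocity_integrand_eq (b : Vec d) {Q : Mat d} (hQ : Q.PosDef) (x y : Vec d) :
    gradient (fun z => bilinearKernel x z) y - bilinearKernel x y • gradient (gaussianPotential b Q) y =
      x - bilinearKernel x y • Matrix.toEuclideanCLM (𝕜 := ℝ) Q⁻¹ (y - b) := by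
  rw [(hasGradientAt_bilinearKernel x y).gradient, (hasGradientAt_gaussianPotential b hQ y).gradient]

/-- The velocity field has linear growth. -/
lemma exists_norm_velocity_le (b : Vec d) {Q : Mat d} (hQ : Q.PosDef) :
    ∃ C : ℝ, 0 ≤ C ∧ ∀ (μ : Measure (Vec d)) [IsProbabilityMeasure μ],
      Integrable (fun y : Vec d => ‖y‖ ^ 2) μ → ∀ x,
        ‖velocity bilinearKernel (gaussianPotential b Q) μ x‖ ≤
          C * (1 + ∫ y, ‖y‖ ^ 2 ∂μ) * (1 + ‖x‖) := by
  refine ⟨1 + 2 * ‖Q⁻¹‖ * (1 + ‖b‖), by positivity, fun μ _ hμ x => ?_⟩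
  have hdom : Integrable (fun y : Vec d =>
      (1 + 2 * ‖Q⁻¹‖ * (1 + ‖b‖)) * (1 + ‖x‖) * (1 + ‖y‖ ^ 2)) μ :=
    ((integrable_const 1).add hμ).const_mul _
  refine (norm_integral_le_of_norm_le hdom (Eventually.of_forall fun y => ?_)).trans_eq ?_
  · rw [velocity_integrand_eq b hQ]
    have h1 : |bilinearKernel x y| ≤ ‖x‖ * ‖y‖ + 1 := by
      refine (abs_add_le _ _).trans ?_
      rw [abs_one]
      exact add_le_add (abs_real_inner_le_norm x y) le_rfl
    have h2 : ‖Matrix.toEuclideanCLM (𝕜 := ℝ) Q⁻¹ (y - b)‖ ≤ ‖Q⁻¹‖ * (‖y‖ + ‖b‖) := by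
      have h3 := ContinuousLinearMap.le_opNorm (Matrix.toEuclideanCLM (𝕜 := ℝ) Q⁻¹) (y - b)
      rw [Matrix.l2_opNorm_toEuclideanCLM] at h3
      exact h3.trans (mul_le_mul_of_nonneg_left (norm_sub_le _ _) (norm_nonneg _))
    refine (norm_sub_le _ _).trans ?_
    rw [norm_smul, Real.norm_eq_abs]
    have hx := norm_nonneg x
    have hy := norm_nonneg y
    have hb := norm_nonneg b
    have hq := norm_nonneg Q⁻¹
    have h4 : |bilinearKernel x y| * ‖Matrix.toEuclideanCLM (𝕜 := ℝ) Q⁻¹ (y - b)‖ ≤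
        (1 + ‖x‖) * (1 + ‖y‖) * (‖Q⁻¹‖ * ((1 + ‖y‖) * (1 + ‖b‖))) := by
      refine mul_le_mul (h1.trans ?_) (h2.trans ?_) (norm_nonneg _) (by positivity)
      · nlinarith
      · exact mul_le_mul_of_nonneg_left (by nlinarith [mul_nonneg hy hb]) hq
    have h5 : (1 + ‖y‖) ^ 2 ≤ 2 * (1 + ‖y‖ ^ 2) := by nlinarith [sq_nonneg (1 - ‖y‖)]
    have h6 : (1 + ‖x‖) * (1 + ‖y‖) * (‖Q⁻¹‖ * ((1 + ‖y‖) * (1 + ‖b‖))) ≤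
        (1 + ‖x‖) * ‖Q⁻¹‖ * (1 + ‖b‖) * (2 * (1 + ‖y‖ ^ 2)) := by
      have h7 : 0 ≤ (1 + ‖x‖) * ‖Q⁻¹‖ * (1 + ‖b‖) := by positivity
      calc _ = (1 + ‖x‖) * ‖Q⁻¹‖ * (1 + ‖b‖) * (1 + ‖y‖) ^ 2 := by ring
        _ ≤ _ := mul_le_mul_of_nonneg_left h5 h7
    have h8 : ‖x‖ ≤ (1 + ‖x‖) * (1 + ‖y‖ ^ 2) := by nlinarith [sq_nonneg ‖y‖, mul_nonneg hx (sq_nonneg ‖y‖)]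
    calc _ ≤ (1 + ‖x‖) * (1 + ‖y‖ ^ 2) + (1 + ‖x‖) * ‖Q⁻¹‖ * (1 + ‖b‖) * (2 * (1 + ‖y‖ ^ 2)) :=
          add_le_add h8 (h4.trans h6)
      _ = _ := by ring
  · rw [integral_const_mul, integral_add (integrable_const _) hμ, integral_const, probReal_univ,
      one_smul]
    ring

lemma stronglyMeasurable_velocity (b : Vec d) {Q : Mat d} (hQ : Q.PosDef) (κ : Kernel ℝ (Vec d))
    [IsMarkovKernel κ] : StronglyMeasurable fun p : ℝ × Vec d =>
      velocity bilinearKernel (gaussianPotential b Q) (κ p.1) p.2 := by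
  have h1 : Continuous (Function.uncurry fun (p : ℝ × Vec d) (y : Vec d) =>
      p.2 - bilinearKernel p.2 y • Matrix.toEuclideanCLM (𝕜 := ℝ) Q⁻¹ (y - b)) := by
    simp only [bilinearKernel, Function.uncurry_def]
    fun_prop
  have h2 := h1.stronglyMeasurable.integral_kernel_prod_right (κ := κ.prodMkRight (Vec d))
  simp only [velocity, velocity_integrand_eq b hQ]
  exact h2

lemma continuous_velocity {μ : Measure (Vec d)} [IsProbabilityMeasure μ]
    (h2 : Integrable (fun y : Vec d => ‖y‖ ^ 2) μ) (b : Vec d) {Q : Mat d} (hQ : Q.PosDef) :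
    Continuous (velocity bilinearKernel (gaussianPotential b Q) μ) := by
  rw [show velocity bilinearKernel (gaussianPotential b Q) μ = _ from funext (velocity_eq h2 b hQ)]
  exact continuous_affineImage _ _

lemma IsWeakSolution.exists_velocity_bound
    (hρ : IsWeakSolution bilinearKernel (gaussianPotential b Q) ν ρ) (hQ : Q.PosDef) (T : ℝ) :
    ∃ C : ℝ, 0 ≤ C ∧ ∀ t ∈ Icc 0 T, ∀ x,
      ‖velocity bilinearKernel (gaussianPotential b Q) (ρ t : Measure (Vec d)) x‖ ≤
        C * (1 + ‖x‖) := by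
  obtain ⟨C, hC, hmom⟩ := hρ.exists_moment_bound hQ T
  obtain ⟨D, hD, hvel⟩ := exists_norm_velocity_le b hQ
  refine ⟨D * (1 + C), by positivity, fun t ht x => (hvel _ (hmom t ht).1 x).trans ?_⟩
  have := (hmom t ht).2
  gcongr

/-- The derivative of a function of time and space along the velocity field of `ρ`. -/
def materialDeriv (b : Vec d) (Q : Mat d) (ρ : ℝ → ProbabilityMeasure (Vec d)) (φ : ℝ × Vec d → ℝ)
    (t : ℝ) (x : Vec d) : ℝ :=
  fderiv ℝ φ (t, x) (1, velocity bilinearKernel (gaussianPotential b Q) (ρ t : Measure (Vec d)) x)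

lemma abs_materialDeriv_le {φ : ℝ × Vec d → ℝ} {t C K : ℝ} {x : Vec d} (hC : 0 ≤ C)
    (hU : ‖velocity bilinearKernel (gaussianPotential b Q) (ρ t : Measure (Vec d)) x‖ ≤
      C * (1 + ‖x‖)) (hφ : ‖fderiv ℝ φ (t, x)‖ ≤ K * (1 + ‖x‖)) :
    |materialDeriv b Q ρ φ t x| ≤ 2 * K * (1 + C) * (1 + ‖x‖ ^ 2) := by
  have hx := norm_nonneg x
  have hK : 0 ≤ K := by
    have := (norm_nonneg _).trans hφ
    by_contra h
    nlinarith
  have h1 : ‖((1 : ℝ), velocity bilinearKernel (gaussianPotential b Q) (ρ t : Measure (Vec d)) x)‖ ≤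
      (1 + C) * (1 + ‖x‖) := by
    rw [Prod.norm_def, norm_one]
    refine max_le ?_ (hU.trans ?_) <;> nlinarith [mul_nonneg hC hx]
  have h2 := (ContinuousLinearMap.le_opNorm (fderiv ℝ φ (t, x)) _).trans
    (mul_le_mul hφ h1 (norm_nonneg _) (by positivity))
  refine h2.trans ?_
  have h3 : (1 + ‖x‖) ^ 2 ≤ 2 * (1 + ‖x‖ ^ 2) := by nlinarith [sq_nonneg (1 - ‖x‖)]
  calc _ = K * (1 + C) * (1 + ‖x‖) ^ 2 := by ring
    _ ≤ K * (1 + C) * (2 * (1 + ‖x‖ ^ 2)) := mul_le_mul_of_nonneg_left h3 (by positivity)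
    _ = _ := by ring

section Growth

variable {φ : ℝ × Vec d → ℝ} {T K : ℝ}

lemma IsWeakSolution.integrable_materialDeriv
    (hρ : IsWeakSolution bilinearKernel (gaussianPotential b Q) ν ρ) (hQ : Q.PosDef)
    (hφ : ContDiff ℝ ∞ φ)
    (hK : ∀ t ∈ Icc 0 T, ∀ x, ‖fderiv ℝ φ (t, x)‖ ≤ K * (1 + ‖x‖)) {t : ℝ} (ht : t ∈ Icc 0 T) :
    Integrable (materialDeriv b Q ρ φ t) (ρ t : Measure (Vec d)) := by
  obtain ⟨C, hC, hU⟩ := hρ.exists_velocity_bound hQ T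
  obtain ⟨D, hD, hmom⟩ := hρ.exists_moment_bound hQ T
  refine (((integrable_const 1).add (hmom t ht).1).const_mul (2 * K * (1 + C))).mono'
    (Continuous.aestronglyMeasurable ?_)
    (Eventually.of_forall fun x => abs_materialDeriv_le hC (hU t ht x) (hK t ht x))
  exact ((hφ.continuous_fderiv (by simp)).comp (continuous_const.prodMk continuous_id)).clm_apply
    (continuous_const.prodMk (continuous_velocity (hmom t ht).1 b hQ))

lemma IsWeakSolution.integrableOn_integral_materialDeriv
    (hρ : IsWeakSolution bilinearKernel (gaussianPotential b Q) ν ρ) (hQ : Q.PosDef)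
    (hφ : ContDiff ℝ ∞ φ)
    (hK : ∀ t ∈ Icc 0 T, ∀ x, ‖fderiv ℝ φ (t, x)‖ ≤ K * (1 + ‖x‖)) :
    IntegrableOn (fun t => ∫ x, materialDeriv b Q ρ φ t x ∂(ρ t : Measure (Vec d))) (Ioc 0 T) := by
  obtain ⟨C, hC, hU⟩ := hρ.exists_velocity_bound hQ T
  obtain ⟨D, hD, hmom⟩ := hρ.exists_moment_bound hQ T
  obtain ⟨κ, hκ, hκρ⟩ := exists_kernel hρ.continuousOn
  have hm : StronglyMeasurable fun t => ∫ x, fderiv ℝ φ (t, x)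
      (1, velocity bilinearKernel (gaussianPotential b Q) (κ t) x) ∂(κ t) := by
    refine StronglyMeasurable.integral_kernel_prod_right' (f := fun p => fderiv ℝ φ p
      (1, velocity bilinearKernel (gaussianPotential b Q) (κ p.1) p.2)) ?_
    have h1 : StronglyMeasurable (fderiv ℝ φ) := (hφ.continuous_fderiv (by simp)).stronglyMeasurable
    exact (isBoundedBilinearMap_apply (𝕜 := ℝ) (E := ℝ × Vec d) (F := ℝ)).continuous
      |>.comp_stronglyMeasurable
        (h1.prodMk (stronglyMeasurable_const.prodMk (stronglyMeasurable_velocity b hQ κ)))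
  have hae : AEStronglyMeasurable
      (fun t => ∫ x, materialDeriv b Q ρ φ t x ∂(ρ t : Measure (Vec d)))
      (volume.restrict (Ioc 0 T)) := by
    refine hm.aestronglyMeasurable.congr ?_
    filter_upwards [ae_restrict_mem measurableSet_Ioc] with t ht
    simp only [materialDeriv, hκρ t ht.1.le]
  refine Integrable.of_bound hae (2 * |K| * (1 + C) * (1 + D)) ?_
  filter_upwards [ae_restrict_mem measurableSet_Ioc] with t ht
  have ht' : t ∈ Icc 0 T := ⟨ht.1.le, ht.2⟩
  have hi := (((integrable_const 1).add (hmom t ht').1).const_mul (2 * |K| * (1 + C)))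
  refine (norm_integral_le_of_norm_le hi (Eventually.of_forall fun x =>
    abs_materialDeriv_le hC (hU t ht' x) ((hK t ht' x).trans ?_))).trans ?_
  · exact mul_le_mul_of_nonneg_right (le_abs_self K) (by positivity)
  · simp only [Pi.add_apply]
    rw [integral_const_mul, integral_add (integrable_const _) (hmom t ht').1, integral_const,
      probReal_univ, one_smul]
    exact mul_le_mul_of_nonneg_left (add_le_add le_rfl (hmom t ht').2) (by positivity)

end Growth

end WeakSolutions

/-! ### Integrated form of the weak formulation -/

section Integrated

variable {d : ℕ} {b : Vec d} {Q : Mat d} {ν : ProbabilityMeasure (Vec d)}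
  {ρ : ℝ → ProbabilityMeasure (Vec d)} {φ : ℝ × Vec d → ℝ} {T : ℝ}

/-- The weak formulation, tested with `χ(t) φ(t, x)`, is a distributional equation in time. -/
lemma IsWeakSolution.integral_eq_of_hasCompactSupport
    (hρ : IsWeakSolution bilinearKernel (gaussianPotential b Q) ν ρ) (hQ : Q.PosDef)
    (hφ : ContDiff ℝ ∞ φ) (hφc : HasCompactSupport φ) (hT : 0 ≤ T) :
    ∫ x, φ (T, x) ∂(ρ T : Measure (Vec d)) = ∫ x, φ (0, x) ∂(ν : Measure (Vec d)) +
      ∫ t in 0..T, ∫ x, materialDeriv b Q ρ φ t x ∂(ρ t : Measure (Vec d)) := by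
  have hφd : Differentiable ℝ φ := hφ.differentiable (by simp)
  obtain ⟨M, hM⟩ := hφc.exists_bound_of_continuous hφ.continuous
  obtain ⟨K, hK⟩ := (hφc.fderiv (𝕜 := ℝ)).exists_bound_of_continuous (hφ.continuous_fderiv (by simp))
  have hK0 : 0 ≤ K := (norm_nonneg _).trans (hK 0)
  have hgrowth : ∀ t x, ‖fderiv ℝ φ (t, x)‖ ≤ K * (1 + ‖x‖) := fun t x =>
    (hK _).trans (le_mul_of_one_le_right hK0 (by linarith [norm_nonneg x]))
  refine eq_add_integral_of_weak (g := fun t => ∫ x, φ (t, x) ∂(ρ t : Measure (Vec d)))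
    (continuousOn_integral hρ.continuousOn hφ.continuous hφc)
    (fun S => hρ.integrableOn_integral_materialDeriv hQ hφ fun t _ => hgrowth t) (fun χ hχ _ => ?_) hT
  have hw := hρ.weak (fun p => χ p.1 * φ p) ((hχ.comp contDiff_fst).mul hφ) hφc.mul_left
  simp only [integral_const_mul] at hw
  refine Eq.trans ?_ hw
  congr 1
  refine setIntegral_congr_fun measurableSet_Ioi fun t ht => ?_
  have ht' : t ∈ Icc 0 t := ⟨le_of_lt (mem_Ioi.1 ht), le_rfl⟩
  have hd : ∀ x v, fderiv ℝ (fun p : ℝ × Vec d => χ p.1 * φ p) (t, x) (1, v) =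
      deriv χ t * φ (t, x) + χ t * fderiv ℝ φ (t, x) (1, v) := by
    intro x v
    have h1 : HasFDerivAt (fun p : ℝ × Vec d => χ p.1) _ (t, x) :=
      ((hχ.differentiable (by simp) t).hasFDerivAt).comp (t, x) hasFDerivAt_fst
    rw [show fderiv ℝ (fun p : ℝ × Vec d => χ p.1 * φ p) (t, x) = _ from
      (h1.mul (hφd (t, x)).hasFDerivAt).fderiv]
    simp
    ring
  have hχφ : Differentiable ℝ (fun p : ℝ × Vec d => χ p.1 * φ p) :=
    ((hχ.comp contDiff_fst).mul hφ).differentiable (by simp)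
  have hint1 : Integrable (fun x => φ (t, x)) (ρ t : Measure (Vec d)) :=
    (integrable_const M).mono'
      (hφ.continuous.comp (continuous_const.prodMk continuous_id)).aestronglyMeasurable
      (Eventually.of_forall fun x => hM _)
  have hint2 := hρ.integrable_materialDeriv hQ hφ (fun t _ => hgrowth t) ht'
  simp only [deriv_add_inner_gradient hχφ, hd]
  rw [integral_add (hint1.const_mul _) (Integrable.const_mul (by exact hint2) _), integral_const_mul,
    integral_const_mul]
  rfl

/-- The test functions in the integrated weak formulation may grow quadratically in space, with
derivatives that grow linearly: the potential bounds the second moments, and cut-offs converge. -/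
lemma IsWeakSolution.integral_eq
    (hρ : IsWeakSolution bilinearKernel (gaussianPotential b Q) ν ρ) (hQ : Q.PosDef)
    (hν : Integrable (fun y : Vec d => ‖y‖ ^ 2) (ν : Measure (Vec d)))
    (hφ : ContDiff ℝ ∞ φ) {K : ℝ} (hT : 0 ≤ T)
    (hK0 : ∀ t ∈ Icc 0 T, ∀ x, |φ (t, x)| ≤ K * (1 + ‖x‖ ^ 2))
    (hK1 : ∀ t ∈ Icc 0 T, ∀ x, ‖fderiv ℝ φ (t, x)‖ ≤ K * (1 + ‖x‖)) :
    ∫ x, φ (T, x) ∂(ρ T : Measure (Vec d)) = ∫ x, φ (0, x) ∂(ν : Measure (Vec d)) +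
      ∫ t in 0..T, ∫ x, materialDeriv b Q ρ φ t x ∂(ρ t : Measure (Vec d)) := by
  have hφd : Differentiable ℝ φ := hφ.differentiable (by simp)
  obtain ⟨C, hC, hU⟩ := hρ.exists_velocity_bound hQ T
  obtain ⟨D, hD, hmom⟩ := hρ.exists_moment_bound hQ T
  let θ : ContDiffBump (0 : ℝ × Vec d) := ⟨1, 2, one_pos, one_lt_two⟩
  have hθs : ContDiff ℝ ∞ (θ : ℝ × Vec d → ℝ) := θ.contDiff
  obtain ⟨M, hM⟩ := (θ.hasCompactSupport.fderiv (𝕜 := ℝ)).exists_bound_of_continuous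
    (hθs.continuous_fderiv (by simp))
  have hM0 : 0 ≤ M := (norm_nonneg _).trans (hM 0)
  have hn0 : ∀ n : ℕ, (0 : ℝ) < n + 1 := fun n => by positivity
  set ψ : ℕ → ℝ × Vec d → ℝ := fun n p => θ (((n : ℝ) + 1)⁻¹ • p) with hψ
  set Φ : ℕ → ℝ × Vec d → ℝ := fun n p => ψ n p * φ p with hΦ
  have hψs : ∀ n, ContDiff ℝ ∞ (ψ n) := fun n => hθs.comp (contDiff_const_smul _)
  have hΦs : ∀ n, ContDiff ℝ ∞ (Φ n) := fun n => (hψs n).mul hφ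
  have hψc : ∀ n, HasCompactSupport (ψ n) := fun n =>
    θ.hasCompactSupport.comp_homeomorph (Homeomorph.smulOfNeZero ((n : ℝ) + 1)⁻¹ (inv_ne_zero (hn0 n).ne'))
  have hψabs : ∀ n p, |ψ n p| ≤ 1 := fun n p => by
    rw [abs_of_nonneg θ.nonneg]; exact θ.le_one
  have hψd : ∀ n p, HasFDerivAt (ψ n) (((n : ℝ) + 1)⁻¹ • fderiv ℝ θ (((n : ℝ) + 1)⁻¹ • p)) p := by
    intro n p
    have h1 := (hθs.differentiable (by simp) (((n : ℝ) + 1)⁻¹ • p)).hasFDerivAt.comp p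
      ((hasFDerivAt_id p).const_smul ((n : ℝ) + 1)⁻¹)
    refine h1.congr_fderiv ?_
    ext v <;> simp
  -- near a given point, the cut-off has no effect in the limit
  have hev : ∀ p : ℝ × Vec d, ∀ᶠ n in atTop, Φ n =ᶠ[𝓝 p] φ := by
    intro p
    obtain ⟨N, hN⟩ := exists_nat_gt ‖p‖
    filter_upwards [eventually_ge_atTop N] with n hn
    have hpn : ‖p‖ < (n : ℝ) + 1 := by
      have : (N : ℝ) ≤ n := by exact_mod_cast hn
      linarith
    filter_upwards [(isOpen_lt continuous_norm continuous_const).mem_nhds hpn] with q hq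
    have : ψ n q = 1 := by
      refine θ.one_of_mem_closedBall ?_
      rw [mem_closedBall_zero_iff, norm_smul, norm_inv, Real.norm_of_nonneg (hn0 n).le]
      exact inv_mul_le_one_of_le₀ (le_of_lt hq) (hn0 n).le
    simp only [hΦ, this, one_mul]
  have hΦ0 : ∀ n, ∀ t ∈ Icc 0 T, ∀ x, |Φ n (t, x)| ≤ K * (1 + ‖x‖ ^ 2) := fun n t ht x => by
    simp only [hΦ]
    rw [abs_mul]
    exact (mul_le_of_le_one_left (abs_nonneg _) (hψabs n _)).trans (hK0 t ht x)
  -- the derivative of the cut-off is `O(1 / n)` and supported in `‖x‖ ≤ 2 (n + 1)`, so that its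
  -- product with the quadratically growing `φ` grows linearly, uniformly in `n`
  have hΦ1 : ∀ n, ∀ t ∈ Icc 0 T, ∀ x, ‖fderiv ℝ (Φ n) (t, x)‖ ≤ K * (1 + 2 * M) * (1 + ‖x‖) := by
    intro n t ht x
    have hKx := (abs_nonneg _).trans (hK0 t ht x)
    have hx := norm_nonneg x
    have hK : 0 ≤ K := by
      by_contra h
      nlinarith [sq_nonneg ‖x‖]
    have h1 : ‖fderiv ℝ θ (((n : ℝ) + 1)⁻¹ • (t, x))‖ * (((n : ℝ) + 1)⁻¹ * |φ (t, x)|) ≤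
        M * (K * (1 + 2 * ‖x‖)) := by
      by_cases hmem : ‖x‖ ≤ 2 * (n + 1)
      · refine mul_le_mul (hM _) ?_ (by have := hn0 n; positivity) hM0
        rw [inv_mul_le_iff₀ (hn0 n)]
        refine (hK0 t ht x).trans ?_
        have h2 : 1 + ‖x‖ ^ 2 ≤ (n + 1) * (1 + 2 * ‖x‖) := by
          nlinarith [(Nat.cast_nonneg n : (0 : ℝ) ≤ n)]
        nlinarith [mul_le_mul_of_nonneg_left h2 hK]
      · have h0 : fderiv ℝ θ (((n : ℝ) + 1)⁻¹ • (t, x)) = 0 := by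
          refine image_eq_zero_of_notMem_tsupport fun hm => hmem ?_
          have h3 := tsupport_fderiv_subset ℝ hm
          rw [θ.tsupport_eq, mem_closedBall_zero_iff, norm_smul, norm_inv,
            Real.norm_of_nonneg (hn0 n).le, inv_mul_le_iff₀ (hn0 n)] at h3
          have h4 : ‖x‖ ≤ ‖(t, x)‖ := norm_snd_le (t, x)
          have h5 : θ.rOut = 2 := rfl
          rw [h5] at h3
          linarith
        rw [h0, norm_zero, zero_mul]
        positivity
    rw [show fderiv ℝ (Φ n) (t, x) = _ from
      ((hψd n (t, x)).mul (hφd (t, x)).hasFDerivAt).fderiv]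
    refine (norm_add_le _ _).trans ?_
    rw [norm_smul, norm_smul, norm_smul, norm_inv, Real.norm_of_nonneg (hn0 n).le, Real.norm_eq_abs,
      Real.norm_eq_abs]
    have h6 : |ψ n (t, x)| * ‖fderiv ℝ φ (t, x)‖ ≤ K * (1 + ‖x‖) :=
      (mul_le_of_le_one_left (norm_nonneg _) (hψabs n _)).trans (hK1 t ht x)
    nlinarith [mul_nonneg hM0 hK]
  have hcont : ∀ {f : ℝ × Vec d → ℝ}, Continuous f → ∀ t, Continuous fun x => f (t, x) :=
    fun hf t => hf.comp (continuous_const.prodMk continuous_id)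
  -- convergence of the integrals at a fixed time
  have hlim0 : ∀ t ∈ Icc 0 T, ∀ μ : Measure (Vec d), IsProbabilityMeasure μ →
      Integrable (fun y : Vec d => ‖y‖ ^ 2) μ →
      Tendsto (fun n => ∫ x, Φ n (t, x) ∂μ) atTop (𝓝 (∫ x, φ (t, x) ∂μ)) := fun t ht μ _ hμ =>
    tendsto_integral_of_dominated_convergence (fun x => K * (1 + ‖x‖ ^ 2))
      (fun n => (hcont (hΦs n).continuous t).aestronglyMeasurable)
      (((integrable_const 1).add hμ).const_mul K)
      (fun n => Eventually.of_forall fun x => hΦ0 n t ht x)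
      (Eventually.of_forall fun x => tendsto_const_nhds.congr'
        ((hev (t, x)).mono fun n hn => hn.eq_of_nhds.symm))
  have hlimt : ∀ t ∈ Icc 0 T,
      Tendsto (fun n => ∫ x, materialDeriv b Q ρ (Φ n) t x ∂(ρ t : Measure (Vec d))) atTop
        (𝓝 (∫ x, materialDeriv b Q ρ φ t x ∂(ρ t : Measure (Vec d)))) := fun t ht =>
    tendsto_integral_of_dominated_convergence
      (fun x => 2 * (K * (1 + 2 * M)) * (1 + C) * (1 + ‖x‖ ^ 2))
      (fun n => (hρ.integrable_materialDeriv hQ (hΦs n) (hΦ1 n) ht).1)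
      (((integrable_const 1).add (hmom t ht).1).const_mul _)
      (fun n => Eventually.of_forall fun x => abs_materialDeriv_le hC (hU t ht x) (hΦ1 n t ht x))
      (Eventually.of_forall fun x => tendsto_const_nhds.congr'
        ((hev (t, x)).mono fun n hn => by simp only [materialDeriv, hn.fderiv_eq]))
  have hlim : Tendsto (fun n => ∫ t in 0..T, ∫ x, materialDeriv b Q ρ (Φ n) t x ∂(ρ t : Measure (Vec d)))
      atTop (𝓝 (∫ t in 0..T, ∫ x, materialDeriv b Q ρ φ t x ∂(ρ t : Measure (Vec d)))) := by
    simp only [intervalIntegral.integral_of_le hT]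
    refine tendsto_integral_of_dominated_convergence
      (fun _ => 2 * (K * (1 + 2 * M)) * (1 + C) * (1 + D))
      (fun n => (hρ.integrableOn_integral_materialDeriv hQ (hΦs n) (hΦ1 n)).1) (integrable_const _)
      (fun n => ?_) ?_
    · filter_upwards [ae_restrict_mem measurableSet_Ioc] with t ht
      have ht' : t ∈ Icc 0 T := ⟨ht.1.le, ht.2⟩
      have hK : 0 ≤ K := by
        have := (abs_nonneg _).trans (hK0 t ht' 0)
        simpa using this
      refine (norm_integral_le_of_norm_le (((integrable_const 1).add (hmom t ht').1).const_mul _)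
        (Eventually.of_forall fun x => abs_materialDeriv_le hC (hU t ht' x) (hΦ1 n t ht' x))).trans ?_
      simp only [Pi.add_apply]
      rw [integral_const_mul, integral_add (integrable_const _) (hmom t ht').1, integral_const,
        probReal_univ, one_smul]
      exact mul_le_mul_of_nonneg_left (add_le_add le_rfl (hmom t ht').2) (by positivity)
    · filter_upwards [ae_restrict_mem measurableSet_Ioc] with t ht using hlimt t ⟨ht.1.le, ht.2⟩
  have hfin := (hlim0 0 ⟨le_rfl, hT⟩ (ν : Measure (Vec d)) inferInstance hν).add hlim
  refine tendsto_nhds_unique (hlim0 T ⟨hT, le_rfl⟩ (ρ T : Measure (Vec d)) inferInstance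
    (hmom T ⟨hT, le_rfl⟩).1) (hfin.congr fun n => ?_)
  exact (hρ.integral_eq_of_hasCompactSupport hQ (hΦs n) (hψc n).mul_right hT).symm

end Integrated

/-! ### The moments of a weak solution -/

section Moments

variable {d : ℕ} {b : Vec d} {Q : Mat d} {ν : ProbabilityMeasure (Vec d)}
  {ρ : ℝ → ProbabilityMeasure (Vec d)}

lemma integral_affineImage_apply {μ : Measure (Vec d)} [IsProbabilityMeasure μ]
    (h2 : Integrable (fun y : Vec d => ‖y‖ ^ 2) μ) (c : Vec d) (A : Mat d) (i : Fin d) :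
    ∫ x, affineImage c A x i ∂μ = c i + ∑ k, A i k * ∫ y, y k ∂μ := by
  have hi : ∀ k ∈ Finset.univ, Integrable (fun y : Vec d => A i k * y k) μ := fun k _ =>
    (integrable_coord h2 k).const_mul _
  simp only [affineImage, PiLp.add_apply, Matrix.ofLp_toEuclideanCLM, Matrix.mulVec, dotProduct]
  rw [integral_add (integrable_const _) (integrable_finsetSum _ hi), integral_finsetSum _ hi,
    integral_const, probReal_univ, one_smul]
  simp only [integral_const_mul]

lemma integral_mul_affineImage_apply {μ : Measure (Vec d)} [IsProbabilityMeasure μ]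
    (h2 : Integrable (fun y : Vec d => ‖y‖ ^ 2) μ) (c : Vec d) (A : Mat d) (i j : Fin d) :
    Integrable (fun x : Vec d => x i * affineImage c A x j) μ ∧
    ∫ x : Vec d, x i * affineImage c A x j ∂μ =
      c j * ∫ y, y i ∂μ + ∑ k, A j k * ∫ y, y i * y k ∂μ := by
  have hi : ∀ k ∈ Finset.univ, Integrable (fun y : Vec d => A j k * (y i * y k)) μ := fun k _ =>
    (integrable_coord_mul h2 i k).const_mul _
  have h0 : ∀ x : Vec d, x i * affineImage c A x j = c j * x i + ∑ k, A j k * (x i * x k) := by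
    intro x
    simp only [affineImage, PiLp.add_apply, Matrix.ofLp_toEuclideanCLM, Matrix.mulVec, dotProduct,
      mul_add, Finset.mul_sum]
    rw [mul_comm]
    congr 1
    exact Finset.sum_congr rfl fun k _ => by ring
  simp only [h0]
  refine ⟨((integrable_coord h2 i).const_mul _).add (integrable_finsetSum _ hi), ?_⟩
  rw [integral_add ((integrable_coord h2 i).const_mul _) (integrable_finsetSum _ hi),
    integral_finsetSum _ hi]
  simp only [integral_const_mul]

lemma hasFDerivAt_snd_apply (i : Fin d) (p : ℝ × Vec d) : HasFDerivAt (fun p : ℝ × Vec d => p.2 i)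
    ((EuclideanSpace.proj (𝕜 := ℝ) i).comp (ContinuousLinearMap.snd ℝ ℝ (Vec d))) p :=
  ((EuclideanSpace.proj (𝕜 := ℝ) i).comp (ContinuousLinearMap.snd ℝ ℝ (Vec d))).hasFDerivAt

lemma contDiff_snd_apply (i : Fin d) {n : WithTop ℕ∞} : ContDiff ℝ n (fun p : ℝ × Vec d => p.2 i) :=
  ((EuclideanSpace.proj (𝕜 := ℝ) i).comp (ContinuousLinearMap.snd ℝ ℝ (Vec d))).contDiff

lemma fderiv_snd_apply (i : Fin d) (p v : ℝ × Vec d) :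
    fderiv ℝ (fun p : ℝ × Vec d => p.2 i) p v = v.2 i := by
  rw [(hasFDerivAt_snd_apply i p).fderiv]
  rfl

lemma fderiv_snd_apply_mul (i j : Fin d) (p v : ℝ × Vec d) :
    fderiv ℝ (fun p : ℝ × Vec d => p.2 i * p.2 j) p v = p.2 i * v.2 j + p.2 j * v.2 i := by
  rw [show fderiv ℝ (fun p : ℝ × Vec d => p.2 i * p.2 j) p = _ from
    ((hasFDerivAt_snd_apply i p).mul (hasFDerivAt_snd_apply j p)).fderiv]
  rfl

lemma norm_fderiv_snd_apply_le (i : Fin d) (t : ℝ) (x : Vec d) :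
    ‖fderiv ℝ (fun p : ℝ × Vec d => p.2 i) (t, x)‖ ≤ 2 * (1 + ‖x‖) := by
  refine ContinuousLinearMap.opNorm_le_bound _ (by positivity) fun v => ?_
  rw [fderiv_snd_apply]
  have h1 := (PiLp.norm_apply_le v.2 i).trans (norm_snd_le v)
  nlinarith [norm_nonneg x, norm_nonneg v]

lemma norm_fderiv_snd_apply_mul_le (i j : Fin d) (t : ℝ) (x : Vec d) :
    ‖fderiv ℝ (fun p : ℝ × Vec d => p.2 i * p.2 j) (t, x)‖ ≤ 2 * (1 + ‖x‖) := by
  refine ContinuousLinearMap.opNorm_le_bound _ (by positivity) fun v => ?_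
  rw [fderiv_snd_apply_mul]
  have h1 := fun k => (PiLp.norm_apply_le v.2 k).trans (norm_snd_le v)
  have h2 := fun k => PiLp.norm_apply_le x k
  refine (norm_add_le _ _).trans ?_
  rw [norm_mul, norm_mul]
  have h3 := mul_le_mul (h2 i) (h1 j) (norm_nonneg _) (norm_nonneg _)
  have h4 := mul_le_mul (h2 j) (h1 i) (norm_nonneg _) (norm_nonneg _)
  nlinarith [norm_nonneg v]

lemma continuousOn_driftVec_apply (b : Vec d) (Q : Mat d) {m : ℝ → Vec d} {s : Set ℝ}
    (hm : ContinuousOn m s) (i : Fin d) : ContinuousOn (fun t => driftVec b Q (m t) i) s := by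
  have h1 : Continuous fun x : Vec d => driftVec b Q x i :=
    (EuclideanSpace.proj (𝕜 := ℝ) i).continuous.comp
      (contDiff_driftVec (n := ∞) b Q contDiff_id).continuous
  exact h1.comp_continuousOn hm

lemma continuousOn_driftMat_apply (b : Vec d) (Q : Mat d) {m : ℝ → Vec d} {S : ℝ → Mat d} {s : Set ℝ}
    (hm : ∀ i, ContinuousOn (fun t => m t i) s) (hS : ∀ i j, ContinuousOn (fun t => S t i j) s)
    (i j : Fin d) : ContinuousOn (fun t => driftMat b Q (m t) (S t) i j) s := by
  simp only [driftMat, Matrix.sub_apply, Matrix.mul_apply, Matrix.add_apply, Matrix.vecMulVec_apply,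
    WithLp.ofLp_sub, Pi.sub_apply]
  exact continuousOn_const.sub (continuousOn_finsetSum _ fun k _ => continuousOn_const.mul
    ((hS k j).add (((hm k).sub continuousOn_const).mul (hm j))))

/-- The mean and the covariance of a weak solution solve the mean-covariance system: the coordinates
and their products are admissible test functions, and the velocity field is affine. -/
lemma IsWeakSolution.isODESolution
    (hρ : IsWeakSolution bilinearKernel (gaussianPotential b Q) ν ρ) (hQ : Q.PosDef)
    (hν : Integrable (fun y : Vec d => ‖y‖ ^ 2) (ν : Measure (Vec d))) :
    IsODESolution b Q (meanVec (ν : Measure (Vec d))) (covMat (ν : Measure (Vec d)))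
      (fun t => meanVec (ρ t : Measure (Vec d))) (fun t => covMat (ρ t : Measure (Vec d))) := by
  set v : Fin d → ℝ → ℝ := fun i t => ∫ y : Vec d, y i ∂(ρ t : Measure (Vec d)) with hv
  set w : Fin d → Fin d → ℝ → ℝ := fun i j t => ∫ y : Vec d, y i * y j ∂(ρ t : Measure (Vec d)) with hw
  set c : ℝ → Vec d := fun t => driftVec b Q (meanVec (ρ t : Measure (Vec d))) with hc
  set A : ℝ → Mat d := fun t => driftMat b Q (meanVec (ρ t : Measure (Vec d)))
    (covMat (ρ t : Measure (Vec d))) with hA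
  have hmom : ∀ t, 0 ≤ t → Integrable (fun y : Vec d => ‖y‖ ^ 2) (ρ t : Measure (Vec d)) := fun t ht =>
    ((hρ.exists_moment_bound hQ t).choose_spec.2 t ⟨ht, le_rfl⟩).1
  set φ₁ : Fin d → ℝ × Vec d → ℝ := fun i p => p.2 i with hφ₁
  set φ₂ : Fin d → Fin d → ℝ × Vec d → ℝ := fun i j p => p.2 i * p.2 j with hφ₂
  have hs₁ : ∀ i, ContDiff ℝ ∞ (φ₁ i) := fun i => contDiff_snd_apply i
  have hs₂ : ∀ i j, ContDiff ℝ ∞ (φ₂ i j) := fun i j =>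
    (contDiff_snd_apply i).mul (contDiff_snd_apply j)
  -- the right-hand sides
  have hG₁ : ∀ i t, 0 ≤ t → ∫ x, materialDeriv b Q ρ (φ₁ i) t x ∂(ρ t : Measure (Vec d)) =
      c t i + ∑ k, A t i k * v k t := by
    intro i t ht
    simp only [materialDeriv, hφ₁, fderiv_snd_apply, velocity_eq (hmom t ht) b hQ]
    exact integral_affineImage_apply (hmom t ht) _ _ i
  have hG₂ : ∀ i j t, 0 ≤ t → ∫ x, materialDeriv b Q ρ (φ₂ i j) t x ∂(ρ t : Measure (Vec d)) =
      (c t j * v i t + ∑ k, A t j k * w i k t) + (c t i * v j t + ∑ k, A t i k * w j k t) := by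
    intro i j t ht
    simp only [materialDeriv, hφ₂, fderiv_snd_apply_mul, velocity_eq (hmom t ht) b hQ]
    obtain ⟨h1, h2⟩ := integral_mul_affineImage_apply (hmom t ht) (c t) (A t) i j
    obtain ⟨h3, h4⟩ := integral_mul_affineImage_apply (hmom t ht) (c t) (A t) j i
    rw [← h2, ← h4]
    exact integral_add h1 h3
  have hI₁ : ∀ i T, 0 ≤ T → v i T = ∫ y : Vec d, y i ∂(ν : Measure (Vec d)) +
      ∫ t in 0..T, ∫ x, materialDeriv b Q ρ (φ₁ i) t x ∂(ρ t : Measure (Vec d)) := fun i T hT =>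
    hρ.integral_eq hQ hν (hs₁ i) hT (K := 2) (fun t _ x => by
      have := PiLp.norm_apply_le x i
      rw [Real.norm_eq_abs] at this
      simp only [hφ₁]
      nlinarith [sq_nonneg (1 - ‖x‖)]) fun t _ x => norm_fderiv_snd_apply_le i t x
  have hI₂ : ∀ i j T, 0 ≤ T → w i j T = ∫ y : Vec d, y i * y j ∂(ν : Measure (Vec d)) +
      ∫ t in 0..T, ∫ x, materialDeriv b Q ρ (φ₂ i j) t x ∂(ρ t : Measure (Vec d)) := fun i j T hT =>
    hρ.integral_eq hQ hν (hs₂ i j) hT (K := 2) (fun t _ x => by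
      have h1 := PiLp.norm_apply_le x i
      have h2 := PiLp.norm_apply_le x j
      simp only [hφ₂]
      rw [← Real.norm_eq_abs, norm_mul]
      nlinarith [mul_le_mul h1 h2 (norm_nonneg _) (norm_nonneg _), sq_nonneg ‖x‖])
      fun t _ x => norm_fderiv_snd_apply_mul_le i j t x
  -- continuity of the moments, hence of the right-hand sides
  have hvc : ∀ i, ContinuousOn (v i) (Ici 0) := fun i =>
    continuousOn_of_eq_add_integral (fun T => hρ.integrableOn_integral_materialDeriv hQ (hs₁ i)
      fun t _ x => norm_fderiv_snd_apply_le i t x) (hI₁ i)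
  have hwc : ∀ i j, ContinuousOn (w i j) (Ici 0) := fun i j =>
    continuousOn_of_eq_add_integral (fun T => hρ.integrableOn_integral_materialDeriv hQ (hs₂ i j)
      fun t _ x => norm_fderiv_snd_apply_mul_le i j t x) (hI₂ i j)
  have hmc : ContinuousOn (fun t => meanVec (ρ t : Measure (Vec d))) (Ici 0) :=
    (PiLp.continuous_toLp 2 _).comp_continuousOn (continuousOn_pi.2 hvc)
  have hSc : ∀ i j, ContinuousOn (fun t => covMat (ρ t : Measure (Vec d)) i j) (Ici 0) := fun i j =>
    (hwc i j).sub ((hvc i).mul (hvc j))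
  have hcc : ∀ i, ContinuousOn (fun t => c t i) (Ici 0) := continuousOn_driftVec_apply b Q hmc
  have hAc : ∀ i k, ContinuousOn (fun t => A t i k) (Ici 0) := continuousOn_driftMat_apply b Q hvc hSc
  have hv' : ∀ i t, 0 ≤ t → HasDerivWithinAt (v i) (c t i + ∑ k, A t i k * v k t) (Ici 0) t := by
    intro i t ht
    rw [← hG₁ i t ht]
    refine hasDerivWithinAt_of_eq_add_integral (ContinuousOn.congr ?_ fun s hs => hG₁ i s hs)
      (hI₁ i) ht
    exact (hcc i).add (continuousOn_finsetSum _ fun k _ => (hAc i k).mul (hvc k))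
  have hw' : ∀ i j t, 0 ≤ t → HasDerivWithinAt (w i j) ((c t j * v i t + ∑ k, A t j k * w i k t) +
      (c t i * v j t + ∑ k, A t i k * w j k t)) (Ici 0) t := by
    intro i j t ht
    rw [← hG₂ i j t ht]
    refine hasDerivWithinAt_of_eq_add_integral (ContinuousOn.congr ?_ fun s hs => hG₂ i j s hs)
      (hI₂ i j) ht
    exact (((hcc j).mul (hvc i)).add (continuousOn_finsetSum _ fun k _ => (hAc j k).mul (hwc i k))).add
      (((hcc i).mul (hvc j)).add (continuousOn_finsetSum _ fun k _ => (hAc i k).mul (hwc j k)))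
  constructor
  · ext i
    have := hI₁ i 0 le_rfl
    rwa [intervalIntegral.integral_same, add_zero] at this
  · ext i j
    have h1 := hI₁ i 0 le_rfl
    have h2 := hI₁ j 0 le_rfl
    have h3 := hI₂ i j 0 le_rfl
    rw [intervalIntegral.integral_same, add_zero] at h1 h2 h3
    simp only [covMat, Matrix.of_apply]
    rw [← h1, ← h2, ← h3]
  · intro t ht
    rw [meanField_eq, hasDerivWithinAt_vec_iff]
    intro i
    refine (hv' i t ht).congr_deriv ?_
    rw [add_comm]
    rfl
  · intro t ht
    have hsymm : (covMat (ρ t : Measure (Vec d)))ᵀ = covMat (ρ t : Measure (Vec d)) := by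
      ext i j
      simp only [covMat, Matrix.transpose_apply, Matrix.of_apply]
      rw [mul_comm (∫ y : Vec d, y j ∂(ρ t : Measure (Vec d)))]
      simp only [mul_comm]
    rw [covField_eq b hQ _ hsymm, hasDerivWithinAt_mat_iff]
    intro i j
    refine ((hw' i j t ht).sub ((hv' i t ht).mul (hv' j t ht))).congr_deriv ?_
    have hwsymm : ∀ k, w j k t = w k j t := fun k => by simp only [hw, mul_comm]
    have h1 : (A t * covMat (ρ t : Measure (Vec d))) i j =
        ∑ k, A t i k * w j k t - (∑ k, A t i k * v k t) * v j t := by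
      simp only [Matrix.mul_apply, covMat, Matrix.of_apply, hwsymm]
      rw [Finset.sum_mul, ← Finset.sum_sub_distrib]
      exact Finset.sum_congr rfl fun k _ => by simp only [hw, hv]; ring
    have h2 : (covMat (ρ t : Measure (Vec d)) * (A t)ᵀ) i j =
        ∑ k, A t j k * w i k t - v i t * ∑ k, A t j k * v k t := by
      simp only [Matrix.mul_apply, covMat, Matrix.of_apply, Matrix.transpose_apply]
      rw [Finset.mul_sum, ← Finset.sum_sub_distrib]
      exact Finset.sum_congr rfl fun k _ => by simp only [hw, hv]; ring
    rw [Matrix.add_apply]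
    change _ = (A t * covMat (ρ t : Measure (Vec d))) i j +
      (covMat (ρ t : Measure (Vec d)) * (A t)ᵀ) i j
    rw [h1, h2]
    ring

end Moments

/-! ### Uniqueness of weak solutions -/

section Uniqueness

variable {d : ℕ} {b : Vec d} {Q : Mat d} {ν : ProbabilityMeasure (Vec d)}
  {ρ : ℝ → ProbabilityMeasure (Vec d)} {m : ℝ → Vec d} {E : ℝ → Mat d}

/-- A smooth function of an affine functional `⟪β t, x - m t⟫` with smooth coefficients has a
derivative of linear growth in `x`, locally uniformly in `t`. -/
lemma exists_norm_fderiv_comp_inner_le {β : ℝ → Vec d} (hβ : ContDiff ℝ ∞ β) (hm : ContDiff ℝ ∞ m)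
    {f : ℝ → ℝ} (hf : ContDiff ℝ ∞ f) (hf' : ∀ x, |deriv f x| ≤ 1) (T : ℝ) :
    ∃ K : ℝ, 0 ≤ K ∧ ∀ t ∈ Icc 0 T, ∀ x,
      ‖fderiv ℝ (fun p : ℝ × Vec d => f (inner ℝ (β p.1) (p.2 - m p.1))) (t, x)‖ ≤ K * (1 + ‖x‖) := by
  have hc : Continuous fun t => ‖deriv β t‖ * (1 + ‖m t‖) + ‖β t‖ * (1 + ‖deriv m t‖) := by
    have h1 : Continuous (deriv β) := hβ.continuous_deriv (by simp)
    have h2 : Continuous (deriv m) := hm.continuous_deriv (by simp)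
    exact (h1.norm.mul (continuous_const.add hm.continuous.norm)).add
      (hβ.continuous.norm.mul (continuous_const.add h2.norm))
  obtain ⟨K, hK⟩ := (isCompact_Icc (a := (0 : ℝ)) (b := T)).exists_bound_of_continuousOn hc.continuousOn
  refine ⟨|K|, abs_nonneg K, fun t ht x => ?_⟩
  have hβd : HasDerivAt β (deriv β t) t := (hβ.differentiable (by simp) t).hasDerivAt
  have hmd : HasDerivAt m (deriv m t) t := (hm.differentiable (by simp) t).hasDerivAt
  have h1 : HasFDerivAt (fun p : ℝ × Vec d => β p.1) _ (t, x) :=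
    hβd.hasFDerivAt.comp (t, x) hasFDerivAt_fst
  have h2 : HasFDerivAt (fun p : ℝ × Vec d => m p.1) _ (t, x) :=
    hmd.hasFDerivAt.comp (t, x) hasFDerivAt_fst
  have h3 := h1.inner ℝ ((hasFDerivAt_snd (p := (t, x))).sub h2)
  have h4 := ((hf.differentiable (by simp)
    (inner ℝ (β t) (x - m t))).hasDerivAt).comp_hasFDerivAt (t, x) h3
  have hx := norm_nonneg x
  rw [show fderiv ℝ (fun p : ℝ × Vec d => f (inner ℝ (β p.1) (p.2 - m p.1))) (t, x) = _ from h4.fderiv]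
  refine ContinuousLinearMap.opNorm_le_bound _ (by positivity) fun v => ?_
  rw [_root_.smul_apply, norm_smul, Real.norm_eq_abs]
  refine (mul_le_of_le_one_left (norm_nonneg _) (hf' _)).trans ?_
  simp only [ContinuousLinearMap.comp_apply, ContinuousLinearMap.prod_apply, fderivInnerCLM_apply,
    _root_.sub_apply, ContinuousLinearMap.coe_fst', ContinuousLinearMap.coe_snd',
    ContinuousLinearMap.toSpanSingleton_apply]
  have hv1 : |v.1| ≤ ‖v‖ := norm_fst_le v
  have hv2 := norm_snd_le v
  have h5 : ‖v.2 - v.1 • deriv m t‖ ≤ (1 + ‖deriv m t‖) * ‖v‖ := by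
    refine (norm_sub_le _ _).trans ?_
    rw [norm_smul, Real.norm_eq_abs]
    nlinarith [mul_le_mul_of_nonneg_right hv1 (norm_nonneg (deriv m t))]
  have h6 : ‖v.1 • deriv β t‖ ≤ ‖v‖ * ‖deriv β t‖ := by
    rw [norm_smul, Real.norm_eq_abs]
    exact mul_le_mul_of_nonneg_right hv1 (norm_nonneg _)
  have h7 : ‖x - m t‖ ≤ (1 + ‖m t‖) * (1 + ‖x‖) := by
    refine (norm_sub_le _ _).trans ?_
    nlinarith [norm_nonneg (m t), mul_nonneg (norm_nonneg (m t)) hx]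
  have h8 := (le_abs_self _).trans (hK t ht)
  refine (norm_add_le _ _).trans ?_
  have h9 := (norm_inner_le_norm (𝕜 := ℝ) (β t) (v.2 - v.1 • deriv m t)).trans
    (mul_le_mul_of_nonneg_left h5 (norm_nonneg _))
  have h10 := (norm_inner_le_norm (𝕜 := ℝ) (v.1 • deriv β t) (x - m t)).trans
    (mul_le_mul h6 h7 (norm_nonneg _) (by positivity))
  have h11 : 0 ≤ ‖β t‖ * (1 + ‖deriv m t‖) * ‖v‖ * ‖x‖ := by positivity
  have h12 : 0 ≤ (1 + ‖x‖) * ‖v‖ := by positivity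
  calc _ ≤ ‖β t‖ * ((1 + ‖deriv m t‖) * ‖v‖) +
        ‖v‖ * ‖deriv β t‖ * ((1 + ‖m t‖) * (1 + ‖x‖)) := add_le_add h9 h10
    _ ≤ (‖deriv β t‖ * (1 + ‖m t‖) + ‖β t‖ * (1 + ‖deriv m t‖)) * ((1 + ‖x‖) * ‖v‖) := by linarith
    _ ≤ |K| * ((1 + ‖x‖) * ‖v‖) := mul_le_mul_of_nonneg_right (h8.trans (le_abs_self K)) h12
    _ = _ := by ring

/-- Once the first two moments are known, the velocity field is a given affine field, and functions
that are constant along its trajectories have conserved integrals. -/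
lemma IsWeakSolution.integral_transport
    (hρ : IsWeakSolution bilinearKernel (gaussianPotential b Q) ν ρ) (hQ : Q.PosDef)
    (hν : Integrable (fun y : Vec d => ‖y‖ ^ 2) (ν : Measure (Vec d))) (h : IsAffineFlow b Q m E)
    (hmom : ∀ t, 0 ≤ t → meanVec (ρ t : Measure (Vec d)) = m t ∧
      covMat (ρ t : Measure (Vec d)) = E t * (E t)ᵀ)
    {f : ℝ → ℝ} (hf : ContDiff ℝ ∞ f) (hf0 : ∀ x, |f x| ≤ 1) (hf' : ∀ x, |deriv f x| ≤ 1)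
    {T : ℝ} (hT : 0 ≤ T) (η : Vec d) :
    ∫ x, f (inner ℝ η (x - m T)) ∂(ρ T : Measure (Vec d)) =
      ∫ x, f (inner ℝ (WithLp.toLp 2 (((E 0)ᵀ)⁻¹ *ᵥ ((E T)ᵀ *ᵥ η.ofLp)) : Vec d) (x - m 0))
        ∂(ν : Measure (Vec d)) := by
  set w : Vec d := WithLp.toLp 2 ((E T)ᵀ *ᵥ η.ofLp) with hw
  -- `β` is such that `⟪β t, x - m t⟫` is constant along trajectories, and `β T = η`
  set β : ℝ → Vec d := fun t => WithLp.toLp 2 (((E t)ᵀ)⁻¹ *ᵥ w.ofLp) with hβ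
  have hdet : ∀ t, (E t)ᵀ.det ≠ 0 := fun t => by rw [Matrix.det_transpose]; exact h.det_ne_zero t
  have hβs : ContDiff ℝ ∞ β := contDiff_mulVec
    (contDiff_matrix_inv (contDiff_transpose.comp h.contDiff_factor) hdet) contDiff_const
  have hβE : ∀ t z, inner ℝ (β t) (affineImage (m t) (E t) z - m t) = (inner ℝ w z : ℝ) := by
    intro t z
    rw [affineImage, add_sub_cancel_left, Matrix.inner_toEuclideanCLM, hβ]
    simp only
    rw [Matrix.dotProduct_mulVec, ← Matrix.mulVec_transpose, Matrix.mulVec_mulVec,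
      Matrix.mul_nonsing_inv _ (hdet t).isUnit, Matrix.one_mulVec, PiLp.inner_apply, dotProduct]
    exact Finset.sum_congr rfl fun i _ => by simp [mul_comm]
  have hβT : β T = η := by
    rw [hβ, hw]
    simp only
    rw [Matrix.mulVec_mulVec, Matrix.nonsing_inv_mul _ (hdet T).isUnit, Matrix.one_mulVec]
  set φ : ℝ × Vec d → ℝ := fun p => f (inner ℝ (β p.1) (p.2 - m p.1)) with hφ
  have hφs : ContDiff ℝ ∞ φ := hf.comp ((hβs.comp contDiff_fst).inner ℝ
    (contDiff_snd.sub (h.contDiff_mean.comp contDiff_fst)))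
  obtain ⟨K, hK0, hK⟩ := exists_norm_fderiv_comp_inner_le hβs h.contDiff_mean hf hf' T
  have heq := hρ.integral_eq hQ hν hφs hT (K := 1 + K)
    (fun t _ x => (hf0 _).trans (by nlinarith [sq_nonneg ‖x‖, mul_nonneg hK0 (sq_nonneg ‖x‖)]))
    (fun t ht x => (hK t ht x).trans
      (mul_le_mul_of_nonneg_right (by linarith) (by positivity)))
  have hzero : ∀ t, 0 ≤ t → ∀ x, materialDeriv b Q ρ φ t x = 0 := by
    intro t ht x
    obtain ⟨z, rfl⟩ : ∃ z, affineImage (m t) (E t) z = x := by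
      refine ⟨WithLp.toLp 2 ((E t)⁻¹ *ᵥ (x - m t).ofLp), ?_⟩
      rw [affineImage, Matrix.toEuclideanCLM_toLp, Matrix.mulVec_mulVec,
        Matrix.mul_nonsing_inv _ (h.det_ne_zero t).isUnit, Matrix.one_mulVec]
      simp
    have h2 : Integrable (fun y : Vec d => ‖y‖ ^ 2) (ρ t : Measure (Vec d)) :=
      ((hρ.exists_moment_bound hQ t).choose_spec.2 t ⟨ht, le_rfl⟩).1
    have h1 : HasDerivAt (fun s => φ (s, affineImage (m s) (E s) z))
        (materialDeriv b Q ρ φ t (affineImage (m t) (E t) z)) t := by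
      rw [materialDeriv, velocity_eq h2 b hQ, (hmom t ht).1, (hmom t ht).2]
      exact (hφs.differentiable (by simp) (t, _)).hasFDerivAt.comp_hasDerivAt t
        ((hasDerivAt_id t).prodMk (h.hasDerivAt_affineImage ht z))
    have h3 : (fun s => φ (s, affineImage (m s) (E s) z)) = fun _ => f (inner ℝ w z) := by
      funext s
      simp only [hφ, hβE]
    rw [h3] at h1
    exact h1.unique (hasDerivAt_const t _)
  have hint : ∫ t in 0..T, ∫ x, materialDeriv b Q ρ φ t x ∂(ρ t : Measure (Vec d)) = 0 := by
    rw [intervalIntegral.integral_congr (g := fun _ => (0 : ℝ)) fun t ht => ?_,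
      intervalIntegral.integral_zero]
    rw [uIcc_of_le hT] at ht
    simp only [hzero t ht.1, integral_zero]
  rw [hint, add_zero] at heq
  simp only [hφ, hβT] at heq
  exact heq

lemma exp_inner_mul_I (x η a : Vec d) : Complex.exp (inner ℝ x η * Complex.I) =
    Complex.exp (inner ℝ η a * Complex.I) *
      (((Real.cos (inner ℝ η (x - a)) : ℝ) : ℂ) + ((Real.sin (inner ℝ η (x - a)) : ℝ) : ℂ) * Complex.I) := by
  rw [Complex.ofReal_cos, Complex.ofReal_sin, ← Complex.exp_mul_I, ← Complex.exp_add, ← add_mul,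
    inner_sub_right, real_inner_comm]
  push_cast
  ring_nf

lemma charFun_eq_integral_cos_add_sin (μ : Measure (Vec d)) [IsProbabilityMeasure μ] (η a : Vec d) :
    charFun μ η = Complex.exp (inner ℝ η a * Complex.I) *
      (((∫ x, Real.cos (inner ℝ η (x - a)) ∂μ : ℝ) : ℂ) +
        ((∫ x, Real.sin (inner ℝ η (x - a)) ∂μ : ℝ) : ℂ) * Complex.I) := by
  have hc : Continuous fun x : Vec d => (inner ℝ η (x - a) : ℝ) := by fun_prop
  have h1 : Integrable (fun x : Vec d => Real.cos (inner ℝ η (x - a))) μ :=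
    Integrable.of_bound (Real.continuous_cos.comp hc).aestronglyMeasurable 1
      (Eventually.of_forall fun x => Real.abs_cos_le_one _)
  have h2 : Integrable (fun x : Vec d => Real.sin (inner ℝ η (x - a))) μ :=
    Integrable.of_bound (Real.continuous_sin.comp hc).aestronglyMeasurable 1
      (Eventually.of_forall fun x => Real.abs_sin_le_one _)
  rw [charFun_apply]
  simp only [exp_inner_mul_I _ η a]
  rw [integral_const_mul, integral_add h1.ofReal (h2.ofReal.mul_const _), integral_mul_const,
    integral_complex_ofReal, integral_complex_ofReal]

/-- Two weak solutions whose mean and covariance are those of the flow coincide. -/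
lemma IsWeakSolution.eq_of_moments {ρ' : ℝ → ProbabilityMeasure (Vec d)}
    (hρ : IsWeakSolution bilinearKernel (gaussianPotential b Q) ν ρ)
    (hρ' : IsWeakSolution bilinearKernel (gaussianPotential b Q) ν ρ') (hQ : Q.PosDef)
    (hν : Integrable (fun y : Vec d => ‖y‖ ^ 2) (ν : Measure (Vec d))) (h : IsAffineFlow b Q m E)
    (hmom : ∀ t, 0 ≤ t → meanVec (ρ t : Measure (Vec d)) = m t ∧
      covMat (ρ t : Measure (Vec d)) = E t * (E t)ᵀ)
    (hmom' : ∀ t, 0 ≤ t → meanVec (ρ' t : Measure (Vec d)) = m t ∧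
      covMat (ρ' t : Measure (Vec d)) = E t * (E t)ᵀ) {T : ℝ} (hT : 0 ≤ T) : ρ T = ρ' T := by
  refine Subtype.ext ?_
  change (ρ T : Measure (Vec d)) = (ρ' T : Measure (Vec d))
  refine Measure.ext_of_charFun (funext fun η => ?_)
  have hcos : ∀ x, |deriv Real.cos x| ≤ 1 := fun x => by
    rw [Real.deriv_cos, abs_neg]; exact Real.abs_sin_le_one x
  have hsin : ∀ x, |deriv Real.sin x| ≤ 1 := fun x => by
    rw [Real.deriv_sin]; exact Real.abs_cos_le_one x
  rw [charFun_eq_integral_cos_add_sin _ η (m T), charFun_eq_integral_cos_add_sin _ η (m T),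
    hρ.integral_transport hQ hν h hmom Real.contDiff_cos Real.abs_cos_le_one hcos hT,
    hρ.integral_transport hQ hν h hmom Real.contDiff_sin Real.abs_sin_le_one hsin hT,
    hρ'.integral_transport hQ hν h hmom' Real.contDiff_cos Real.abs_cos_le_one hcos hT,
    hρ'.integral_transport hQ hν h hmom' Real.contDiff_sin Real.abs_sin_le_one hsin hT]

/-- A weak solution that starts at a Gaussian law is the Gaussian curve of the flow. -/
lemma IsAffineFlow.eq_gaussianLaw (h : IsAffineFlow b Q m E) (hQ : Q.PosDef)
    (hρ : IsWeakSolution bilinearKernel (gaussianPotential b Q)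
      (gaussianLaw (m 0) (E 0 * (E 0)ᵀ)) ρ) {t : ℝ} (ht : 0 ≤ t) :
    ρ t = gaussianLaw (m t) (E t * (E t)ᵀ) := by
  have hpd : ∀ t, (E t * (E t)ᵀ).PosSemidef := fun t =>
    (posDef_mul_transpose (h.det_ne_zero t)).posSemidef
  have hν := integrable_norm_sq_gaussian (m 0) (E 0 * (E 0)ᵀ)
  have hode := hρ.isODESolution hQ hν
  rw [coe_gaussianLaw, meanVec_gaussian, covMat_gaussian _ (hpd 0)] at hode
  exact hρ.eq_of_moments (h.isWeakSolution hQ) hQ hν h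
    (fun s hs => isODESolution_unique (h.isODESolution hQ) hode s hs)
    (fun s _ => ⟨by rw [coe_gaussianLaw, meanVec_gaussian],
      by rw [coe_gaussianLaw, covMat_gaussian _ (hpd s)]⟩) ht

end Uniqueness

end SVGD

end

theorem mainTheorem3 (d : ℕ) (hd : 0 < d)
    (b : SVGD.Vec d) (Q : SVGD.Mat d) (hQ : Q.PosDef)
    (m₀ : SVGD.Vec d) (S₀ : SVGD.Mat d) (hS₀ : S₀.PosDef) :
    ∃ (m : ℝ → SVGD.Vec d) (S : ℝ → SVGD.Mat d),
      -- the mean-covariance system has a unique global solution, and it stays in the Gaussian family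
      SVGD.IsODESolution b Q m₀ S₀ m S ∧
      (∀ t, 0 ≤ t → (S t).PosDef) ∧
      (∀ (m' : ℝ → SVGD.Vec d) (S' : ℝ → SVGD.Mat d), SVGD.IsODESolution b Q m₀ S₀ m' S' →
        ∀ t, 0 ≤ t → m' t = m t ∧ S' t = S t) ∧
      -- the Gaussian curve that it defines solves the SVGD equation, classically and weakly
      SVGD.IsClassicalSolution SVGD.bilinearKernel (SVGD.gaussianPotential b Q)
        (SVGD.gaussianDensity m₀ S₀) (fun t => SVGD.gaussianDensity (m t) (S t)) ∧
      SVGD.IsWeakSolution SVGD.bilinearKernel (SVGD.gaussianPotential b Q)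
        (SVGD.gaussianLaw m₀ S₀) (fun t => SVGD.gaussianLaw (m t) (S t)) ∧
      (∀ t, 0 ≤ t → (SVGD.gaussianLaw (m t) (S t) : MeasureTheory.Measure (SVGD.Vec d)) =
        MeasureTheory.volume.withDensity
          (fun x => ENNReal.ofReal (SVGD.gaussianDensity (m t) (S t) x))) ∧
      -- every solution that starts at the Gaussian is this curve, and it converges to the target
      (∀ ρ : ℝ → MeasureTheory.ProbabilityMeasure (SVGD.Vec d),
        SVGD.IsWeakSolution SVGD.bilinearKernel (SVGD.gaussianPotential b Q)
          (SVGD.gaussianLaw m₀ S₀) ρ →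
        (∀ t, 0 ≤ t → ρ t = SVGD.gaussianLaw (m t) (S t)) ∧
        Filter.Tendsto ρ Filter.atTop (nhds (SVGD.gaussianLaw b Q))) ∧
      -- rates
      ∃ γ lam : ℝ,
        IsLeast (spectrum ℝ (SVGD.rateMatrix b Q)) γ ∧
        IsGreatest (spectrum ℝ Q) lam ∧
        γ > 1 / (1 + b.ofLp ⬝ᵥ b.ofLp + 2 * lam) ∧
        ∀ ε : ℝ, 0 < ε →
          ((fun t => m t - b) =O[Filter.atTop] fun t : ℝ => Real.exp (-2 * (γ - ε) * t)) ∧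
          ((fun t => S t - Q) =O[Filter.atTop] fun t : ℝ => Real.exp (-2 * (γ - ε) * t)) := by
  obtain ⟨hEE, hEt, hEu⟩ := SVGD.sqrt_spec hS₀
  obtain ⟨m, E, hm0, hE0, h⟩ := SVGD.exists_isAffineFlow b hQ m₀ hEu.ne_zero
  have hS0 : E 0 * (E 0)ᵀ = S₀ := by rw [hE0, hEt, hEE]
  have hpd : ∀ t, (E t * (E t)ᵀ).PosDef := fun t => SVGD.posDef_mul_transpose (h.det_ne_zero t)
  subst hm0 hS0
  obtain ⟨γ, lam, hγ0, hγ, hlam, hgap, hcoer⟩ := SVGD.exists_rate hd b hQ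
  refine ⟨m, fun t => E t * (E t)ᵀ, h.isODESolution hQ, fun t _ => hpd t,
    fun m' S' h' => SVGD.isODESolution_unique (h.isODESolution hQ) h', h.isClassicalSolution hQ,
    h.isWeakSolution hQ, fun t _ => SVGD.multivariateGaussian_eq_withDensity (m t) (hpd t),
    fun ρ hρ => ⟨fun t ht => h.eq_gaussianLaw hQ hρ ht, ?_⟩,
    γ, lam, hγ, hlam, hgap, fun ε hε => h.isBigO hQ hγ0 hcoer hε⟩
  have hlim := SVGD.tendsto_gaussianLaw (Eventually.of_forall fun t => (hpd t).posSemidef)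
    hQ.posSemidef (h.tendsto hQ).1 (h.tendsto hQ).2
  refine hlim.congr' ?_
  filter_upwards [eventually_ge_atTop 0] with t ht using (h.eq_gaussianLaw hQ hρ ht).symm
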